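/- **Setting (free $p$-form gauge theories).** Let $n\ge 0$ be the spacetime dimension and let $(B^a)_a$ be any family of exterior form gauge fields of form degrees $p_a\ge 1$, with ghosts and ghosts of ghosts. For $0\le l\le p_a$ write $B^{a(l,p_a-l)}_{\mu_1\dots\mu_l}$ for the (antisymmetric) components of form degree $l$ and ghost number $p_a-l$. They are commuting or anticommuting according to the parity of the ghost number. Let $\mathcal P$ be the real graded commutative algebra generated by $dx^\mu$ (odd) and all derivatives $\partial_{\alpha_1\dots\alpha_k}B^{a(l,p_a-l)}_{\mu_1\dots\mu_l}$: local forms with polynomial coefficients and no explicit $x$-dependence. Put $B^{a(l,p_a-l)}=\frac1{l!}B^{a(l,p_a-l)}_{\mu_1\dots\mu_l}dx^{\mu_1}\cdots dx^{\mu_l}$ and $d=dx^\mu\partial_\mu$. Let $\gamma$ be the odd derivation of $\mathcal P$ that commutes with $\partial_\mu$, kills $dx^\mu$, and satisfies $\gamma B^{a(l+1,p_a-l-1)}+dB^{a(l,p_a-l)}=0$ and $\gamma B^{a(0,p_a)}=0$. Then $\gamma^2=d^2=\gamma d+d\gamma=0$. Let $\mathcal P^{L}\subset\mathcal P$ be the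 subalgebra of Lorentz invariant elements (those annihilated by all infinitesimal Lorentz transformations). The *small algebra* $\mathcal A\subset\mathcal P^{L}$ is the algebra generated by the exterior forms $B^{a(l,p_a-l)}$ and $dB^{a(l,p_a-l)}$, $0\le l\le p_a$. Let $\mathcal A'\subset\mathcal P$ be the algebra generated by $\mathcal A$ and the constant forms $dx^\mu$. All these algebras are stable under $\gamma$ and $d$. For an algebra $\mathcal Q$ stable under $\gamma$ and $d$: an element $a\in\mathcal Q$ is a *solution* (of the Wess–Zumino condition) if $\gamma a+db=0$ for some $b\in\mathcal Q$; it is *trivial* if $a=\gamma m+dn$ with $m,n\in\mathcal Q$; it *descends trivially* if $a=a'+\gamma m+dn$ with $m,n,a'\in\mathcal Q$ and $\gamma a'=0$. Put $E_0(\mathcal Q)=H(\gamma,\mathcal Q)$ and $E_{r+1}(\mathcal Q)=H(d_r,E_r(\mathcal Q))$, where $d_r[X]=[dc_r]$ for any chain $c_0=X,c_1,\dots,c_r\in\mathcal Q$ with $\gamma X=0$ and $dc_i+\gamma c_{i+1}=0$ for $0\le i<r$ (this is well defined). **Theorem.** Let $(\mathcal Q,\mathcal S)$ be either $(\mathcal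 P^{L},\mathcal A)$ or $(\mathcal P,\mathcal A')$. Then: 1. Every solution $a\in\mathcal Q$ (in particular every solution that descends non-trivially) can be written $a=s+t+\gamma m+dn$, where $s\in\mathcal S$ is a solution in $\mathcal S$ (so $\gamma s+db_s=0$ with $b_s\in\mathcal S$), $t\in\mathcal Q$ descends trivially, and $m,n\in\mathcal Q$. 2. For every $r\ge1$, the map $q_r:E_r(\mathcal S)\to E_r(\mathcal Q)$ induced by the inclusion commutes with the differentials, $q_r d_r=d_r q_r$, and is injective. For every form degree $k<n$ it restricts to a bijection from the classes of form degree $k$ in $E_r(\mathcal S)$ onto those of form degree $k$ in $E_r(\mathcal Q)$. In particular $E_1\cong E_1^{\rm small}$, and hence $E_r\cong E_r^{\rm small}$ for all $r\ge 1$, in form degree smaller than $n$. -/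

import Mathlib

namespace PForm

/-! ### Two anticommuting differentials, the Wess-Zumino condition and the spaces `E_r` -/

/-- Two anticommuting differentials `γ` and `d` on a real vector space. -/
structure Bidiff (V : Type*) [AddCommGroup V] [Module ℝ V] where
  γ : V →ₗ[ℝ] V
  d : V →ₗ[ℝ] V
  γ_γ : ∀ x, γ (γ x) = 0
  d_d : ∀ x, d (d x) = 0
  γ_d : ∀ x, γ (d x) + d (γ x) = 0

namespace Bidiff

variable {V W : Type*} [AddCommGroup V] [Module ℝ V] [AddCommGroup W] [Module ℝ W]

/-- `a` solves the Wess-Zumino consistency condition `γ a + d b = 0` for some `b`. -/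
def IsWZ (D : Bidiff V) (a : V) : Prop := ∃ b, D.γ a + D.d b = 0

/-- `a` is a trivial solution, `a = γ m + d n`. -/
def IsTrivial (D : Bidiff V) (a : V) : Prop := ∃ m n, a = D.γ m + D.d n

/-- `a` descends trivially: it is equivalent to a strictly `γ`-closed element. -/
def DescendsTrivially (D : Bidiff V) (a : V) : Prop :=
  ∃ a', D.γ a' = 0 ∧ D.IsTrivial (a - a')

/-- `D.lift r` is the relation consisting of the pairs `(X, u)` such that `X` is `γ`-closed and
there are `c 0 = X, c 1, …, c r = u` with `d (c i) + γ (c (i + 1)) = 0` for `i < r`: the element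
`u` is obtained from the bottom `X` by `r` successive lifts. -/
def lift (D : Bidiff V) (r : ℕ) : Submodule ℝ (V × V) where
  carrier := {q | ∃ c : ℕ → V, c 0 = q.1 ∧ c r = q.2 ∧ D.γ q.1 = 0 ∧
    ∀ i < r, D.d (c i) + D.γ (c (i + 1)) = 0}
  zero_mem' := ⟨fun _ => 0, rfl, rfl, by simp, by simp⟩
  add_mem' := by
    rintro q q' ⟨c, h0, h1, h2, h3⟩ ⟨c', h0', h1', h2', h3'⟩
    refine ⟨c + c', by simp [h0, h0'], by simp [h1, h1'], by simp [h2, h2'], fun i hi => ?_⟩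
    have e := congrArg₂ (· + ·) (h3 i hi) (h3' i hi)
    simp only [add_zero] at e
    rw [← e]
    simp only [Pi.add_apply, map_add]
    abel
  smul_mem' := by
    rintro t q ⟨c, h0, h1, h2, h3⟩
    refine ⟨t • c, by simp [h0], by simp [h1], by simp [h2], fun i hi => ?_⟩
    simp only [Pi.smul_apply, map_smul, ← smul_add, h3 i hi, smul_zero]

/-- The elements of `V` that represent `0` in `E_r`: `B 0` is the image of `γ`, and
`B (r + 1)` adds to `B r` the representatives `d u` of the image of `d_r`. -/
def B (D : Bidiff V) : ℕ → Submodule ℝ V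
  | 0 => LinearMap.range D.γ
  | r + 1 => D.B r ⊔ ((D.lift r).map (LinearMap.snd ℝ V V)).map D.d

/-- The elements of `V` that represent a class in `E_r`: `Z 0` is the kernel of `γ`, and
`Z (r + 1)` consists of the elements `X` of `Z r` with `d_r [X] = 0`, where `d_r [X]` is the class
of `d u` for an `r`-fold lift `u` of `X`. -/
def Z (D : Bidiff V) : ℕ → Submodule ℝ V
  | 0 => LinearMap.ker D.γ
  | r + 1 => D.Z r ⊓
      ((D.lift r) ⊓ ((D.B r).comap D.d).comap (LinearMap.snd ℝ V V)).map (LinearMap.fst ℝ V V)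

theorem mem_lift (D : Bidiff V) {r : ℕ} {X u : V} : (X, u) ∈ D.lift r ↔
    ∃ c : ℕ → V, c 0 = X ∧ c r = u ∧ D.γ X = 0 ∧
      ∀ i < r, D.d (c i) + D.γ (c (i + 1)) = 0 := Iff.rfl

theorem mem_B_succ (D : Bidiff V) {r : ℕ} {Y : V} : Y ∈ D.B (r + 1) ↔
    ∃ X u, (X, u) ∈ D.lift r ∧ Y - D.d u ∈ D.B r := by
  simp only [B, Submodule.mem_sup, Submodule.mem_map, Prod.exists, LinearMap.snd_apply]
  constructor
  · rintro ⟨y, hy, z, ⟨u, ⟨X, u', h, rfl⟩, rfl⟩, rfl⟩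
    exact ⟨X, u', h, by simpa using hy⟩
  · rintro ⟨X, u, h, hy⟩
    exact ⟨_, hy, _, ⟨u, ⟨X, u, h, rfl⟩, rfl⟩, by simp⟩

theorem mem_Z_succ (D : Bidiff V) {r : ℕ} {X : V} : X ∈ D.Z (r + 1) ↔
    X ∈ D.Z r ∧ ∃ u, (X, u) ∈ D.lift r ∧ D.d u ∈ D.B r := by
  simp only [Z, Submodule.mem_inf, Submodule.mem_map, Prod.exists, LinearMap.fst_apply,
    Submodule.mem_comap, LinearMap.snd_apply]
  constructor
  · rintro ⟨h, X', u, ⟨h1, h2⟩, rfl⟩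
    exact ⟨h, u, h1, h2⟩
  · rintro ⟨h, u, h1, h2⟩
    exact ⟨h, X, u, ⟨h1, h2⟩, rfl⟩

theorem γ_d' (D : Bidiff V) (x : V) : D.γ (D.d x) = -D.d (D.γ x) :=
  eq_neg_of_add_eq_zero_left (D.γ_d x)

theorem d_γ' (D : Bidiff V) (x : V) : D.d (D.γ x) = -D.γ (D.d x) :=
  eq_neg_of_add_eq_zero_right (D.γ_d x)

/-- Replacing the last steps of a descent: a shorter lift may be subtracted from a longer one. -/
theorem lift_add (D : Bidiff V) {r i : ℕ} (hi : i < r) {X u X' u' : V} (h : (X, u) ∈ D.lift r)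
    (h' : (X', u') ∈ D.lift i) : (X, u + u') ∈ D.lift r := by
  obtain ⟨c, h0, h1, h2, h3⟩ := D.mem_lift.1 h
  obtain ⟨c', h0', h1', h2', h3'⟩ := D.mem_lift.1 h'
  refine D.mem_lift.2 ⟨fun j => c j + if r - i ≤ j then c' (j - (r - i)) else 0, ?_, ?_, h2, ?_⟩
  · simp [h0, show ¬ (r - i ≤ 0) by omega]
  · simp [h1, show r - (r - i) = i by omega, h1']
  · intro j hj
    have e := h3 j hj
    simp only [map_add]
    rcases lt_trichotomy (j + 1) (r - i) with hlt | heq | hgt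
    · simp [show ¬ (r - i ≤ j) by omega, show ¬ (r - i ≤ j + 1) by omega, e]
    · have : D.γ (c' 0) = 0 := by rw [h0', h2']
      simp [show ¬ (r - i ≤ j) by omega, show (r - i ≤ j + 1) by omega, e,
        show j + 1 - (r - i) = 0 by omega, this]
    · have e' := h3' (j - (r - i)) (by omega)
      rw [show j - (r - i) + 1 = j + 1 - (r - i) by omega] at e'
      simp only [show (r - i ≤ j) by omega, show (r - i ≤ j + 1) by omega, if_true]
      rw [add_add_add_comm, e, e', add_zero]

theorem B_mono (D : Bidiff V) {r s : ℕ} (h : r ≤ s) : D.B r ≤ D.B s := by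
  induction s, h using Nat.le_induction with
  | base => exact le_rfl
  | succ s _ ih => exact ih.trans le_sup_left

theorem lift_zero (D : Bidiff V) {X u : V} : (X, u) ∈ D.lift 0 ↔ u = X ∧ D.γ X = 0 := by
  rw [mem_lift]
  constructor
  · rintro ⟨c, h0, h1, h2, -⟩
    exact ⟨h1 ▸ h0, h2⟩
  · rintro ⟨rfl, h⟩
    exact ⟨fun _ => u, rfl, rfl, h, by simp⟩

theorem lift_succ (D : Bidiff V) {r : ℕ} {X v : V} : (X, v) ∈ D.lift (r + 1) ↔
    ∃ u, (X, u) ∈ D.lift r ∧ D.d u + D.γ v = 0 := by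
  constructor
  · intro h
    obtain ⟨c, h0, h1, h2, h3⟩ := D.mem_lift.1 h
    exact ⟨c r, D.mem_lift.2 ⟨c, h0, rfl, h2, fun i hi => h3 i (by omega)⟩,
      by rw [← h1]; exact h3 r (by omega)⟩
  · rintro ⟨u, h, hv⟩
    obtain ⟨c, h0, h1, h2, h3⟩ := D.mem_lift.1 h
    refine D.mem_lift.2 ⟨fun j => if j ≤ r then c j else v, by simp [h0], by simp, h2, ?_⟩
    intro i hi
    rcases Nat.lt_succ_iff_lt_or_eq.1 hi with hi' | rfl
    · simpa [hi'.le, Nat.succ_le_of_lt hi'] using h3 i hi'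
    · simpa [h1] using hv

theorem γ_of_lift (D : Bidiff V) {r : ℕ} {X u : V} (h : (X, u) ∈ D.lift r) : D.γ X = 0 := by
  obtain ⟨c, -, -, h2, -⟩ := D.mem_lift.1 h
  exact h2

theorem γ_d_of_lift (D : Bidiff V) {r : ℕ} {X u : V} (h : (X, u) ∈ D.lift r) :
    D.γ (D.d u) = 0 := by
  cases r with
  | zero =>
    obtain ⟨rfl, h⟩ := D.lift_zero.1 h
    rw [γ_d', h, map_zero, neg_zero]
  | succ r =>
    obtain ⟨v, -, hv⟩ := D.lift_succ.1 h
    rw [γ_d', eq_neg_of_add_eq_zero_right hv, map_neg, D.d_d, neg_zero, neg_zero]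

theorem exists_of_mem_B (D : Bidiff V) {r : ℕ} {Y : V} (h : Y ∈ D.B r) :
    D.γ Y = 0 ∧ ∃ a w, Y = D.γ a + D.d w := by
  induction r generalizing Y with
  | zero =>
    obtain ⟨a, rfl⟩ := h
    exact ⟨D.γ_γ a, a, 0, by simp⟩
  | succ r ih =>
    obtain ⟨X, u, hl, hY⟩ := D.mem_B_succ.1 h
    obtain ⟨h1, a, w, h2⟩ := ih hY
    refine ⟨?_, a, w + u, ?_⟩
    · rw [map_sub, D.γ_d_of_lift hl, sub_zero] at h1
      exact h1
    · rw [map_add, ← add_assoc, ← h2, sub_add_cancel]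

theorem lift_trivial (D : Bidiff V) {Y a w : V} (h : D.γ Y = 0) (hY : Y = D.γ a + D.d w) (s : ℕ) :
    ∃ u, (Y, u) ∈ D.lift s ∧ D.γ (D.d u) = 0 := by
  have h1 : ∃ u, (Y, u) ∈ D.lift s := by
    refine ⟨_, D.mem_lift.2 ⟨fun j => if j = 0 then Y else if j = 1 then D.d a else 0,
      rfl, rfl, h, ?_⟩⟩
    rintro (_ | _ | i) -
    · simp [hY, D.d_d, D.d_γ']
    · simp [D.d_d]
    · simp
  obtain ⟨u, hu⟩ := h1
  exact ⟨u, hu, D.γ_d_of_lift hu⟩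

theorem exists_lift_range (D : Bidiff V) {r s : ℕ} (hs : s ≤ r) {X u : V}
    (h : (X, u) ∈ D.lift r) (hu : D.d u ∈ D.B s) :
    ∃ v, (X, v) ∈ D.lift r ∧ D.d v ∈ LinearMap.range D.γ := by
  induction s generalizing u with
  | zero => exact ⟨u, h, hu⟩
  | succ s ih =>
    obtain ⟨X', w, hw, hY⟩ := D.mem_B_succ.1 hu
    refine ih (by omega) (u := u + -w)
      (D.lift_add (i := s) (by omega) h (X' := -X') ?_) ?_
    · exact (D.lift s).neg_mem hw
    · simpa [sub_eq_add_neg] using hY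

/-- An element represents a class in `E_r` if and only if it can be lifted `r` times. -/
theorem mem_Z_iff (D : Bidiff V) {r : ℕ} {X : V} : X ∈ D.Z r ↔ ∃ u, (X, u) ∈ D.lift r := by
  induction r with
  | zero =>
    constructor
    · intro h
      exact ⟨X, D.lift_zero.2 ⟨rfl, h⟩⟩
    · rintro ⟨u, h⟩
      exact D.γ_of_lift h
  | succ r ih =>
    rw [mem_Z_succ]
    constructor
    · rintro ⟨-, u, hu, hB⟩
      obtain ⟨v, hv, m, hm⟩ := D.exists_lift_range le_rfl hu hB
      exact ⟨-m, D.lift_succ.2 ⟨v, hv, by simp [hm]⟩⟩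
    · rintro ⟨v, hv⟩
      obtain ⟨u, hu, huv⟩ := D.lift_succ.1 hv
      refine ⟨ih.2 ⟨u, hu⟩, u, hu, D.B_mono (Nat.zero_le r) ⟨-v, ?_⟩⟩
      rw [map_neg, eq_neg_of_add_eq_zero_left huv]

theorem B_le_Z (D : Bidiff V) (r s : ℕ) : D.B r ≤ D.Z s := by
  intro Y hY
  obtain ⟨h, a, w, hY⟩ := D.exists_of_mem_B hY
  obtain ⟨u, hu, -⟩ := D.lift_trivial h hY s
  exact D.mem_Z_iff.2 ⟨u, hu⟩

theorem d_lift_mem_B (D : Bidiff V) {r : ℕ} {X u : V} (h : (X, u) ∈ D.lift r) :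
    D.d u ∈ D.B (r + 1) :=
  D.mem_B_succ.2 ⟨X, u, h, by simp⟩

theorem d_lift_mem_Z (D : Bidiff V) {r : ℕ} {X u : V} (h : (X, u) ∈ D.lift r) :
    D.d u ∈ D.Z r :=
  D.B_le_Z _ _ (D.d_lift_mem_B h)

/-- The class of `d u` in `E_r` does not depend on the choice of the lift `u`. -/
theorem d_lift_mem_B_of_mem_B (D : Bidiff V) {r : ℕ} {X u : V} (h : (X, u) ∈ D.lift r)
    (hX : X ∈ D.B r) : D.d u ∈ D.B r := by
  cases r with
  | zero =>
    obtain ⟨rfl, -⟩ := D.lift_zero.1 h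
    obtain ⟨a, rfl⟩ := hX
    exact ⟨-D.d a, by simp [D.d_γ']⟩
  | succ r =>
    obtain ⟨-, a, w, hX⟩ := D.exists_of_mem_B hX
    obtain ⟨c, h0, h1, h2, h3⟩ := D.mem_lift.1 h
    have key : (c 1 - D.d a, (if r = 0 then c 1 - D.d a else c (r + 1))) ∈ D.lift r := by
      refine D.mem_lift.2 ⟨fun j => if j = 0 then c 1 - D.d a else c (j + 1), by simp, by simp, ?_, ?_⟩
      · have e := h3 0 (by omega)
        rw [h0, hX, map_add, D.d_d, add_zero, D.d_γ', zero_add] at e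
        rw [map_sub, sub_eq_add_neg, add_comm]
        exact e
      · intro i hi
        have e := h3 (i + 1) (by omega)
        by_cases hi0 : i = 0
        · subst hi0
          simpa [D.d_d] using e
        · simpa [hi0] using e
    have := D.d_lift_mem_B key
    split_ifs at this with hr
    · subst hr
      rw [map_sub, D.d_d, sub_zero] at this
      rwa [← h1]
    · rwa [← h1]

/-- The space `E_r`. -/
abbrev E (D : Bidiff V) (r : ℕ) : Type _ := ↥(D.Z r) ⧸ (D.B r).submoduleOf (D.Z r)

/-- The class in `E_r` of an element that can be lifted `r` times. -/
def cls (D : Bidiff V) (r : ℕ) : ↥(D.Z r) →ₗ[ℝ] D.E r := ((D.B r).submoduleOf (D.Z r)).mkQ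

theorem cls_eq_zero (D : Bidiff V) {r : ℕ} {X : ↥(D.Z r)} : D.cls r X = 0 ↔ (X : V) ∈ D.B r :=
  Submodule.Quotient.mk_eq_zero _

theorem cls_d_eq (D : Bidiff V) {r : ℕ} {X X' u u' : V} (h : (X, u) ∈ D.lift r)
    (h' : (X', u') ∈ D.lift r) (hX : X - X' ∈ D.B r) :
    D.cls r ⟨D.d u, D.d_lift_mem_Z h⟩ = D.cls r ⟨D.d u', D.d_lift_mem_Z h'⟩ := by
  rw [← sub_eq_zero, ← map_sub, cls_eq_zero]
  have := D.d_lift_mem_B_of_mem_B ((D.lift r).sub_mem h h') hX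
  simpa using this

/-- The differential `d_r : E_r → E_r`, `d_r [X] = [d u]` where `u` is an `r`-fold lift of `X`. -/
noncomputable def dE (D : Bidiff V) (r : ℕ) : D.E r →ₗ[ℝ] D.E r :=
  Submodule.liftQ _
    { toFun := fun X => D.cls r ⟨D.d (D.mem_Z_iff.1 X.2).choose,
        D.d_lift_mem_Z (D.mem_Z_iff.1 X.2).choose_spec⟩
      map_add' := fun X Y => by
        have h := (D.lift r).add_mem (D.mem_Z_iff.1 X.2).choose_spec
          (D.mem_Z_iff.1 Y.2).choose_spec
        rw [← map_add, D.cls_d_eq (D.mem_Z_iff.1 (X + Y).2).choose_spec h (by simp)]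
        congr 1
        ext
        simp
      map_smul' := fun t X => by
        have h := (D.lift r).smul_mem t (D.mem_Z_iff.1 X.2).choose_spec
        rw [RingHom.id_apply, ← map_smul,
          D.cls_d_eq (D.mem_Z_iff.1 (t • X).2).choose_spec h (by simp)]
        congr 1
        ext
        simp }
    (fun X hX => by
      rw [LinearMap.mem_ker, LinearMap.coe_mk, AddHom.coe_mk, cls_eq_zero]
      exact D.d_lift_mem_B_of_mem_B (D.mem_Z_iff.1 X.2).choose_spec hX)

theorem dE_cls (D : Bidiff V) {r : ℕ} {X u : V} (h : (X, u) ∈ D.lift r) :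
    D.dE r (D.cls r ⟨X, D.mem_Z_iff.2 ⟨u, h⟩⟩) = D.cls r ⟨D.d u, D.d_lift_mem_Z h⟩ :=
  D.cls_d_eq (D.mem_Z_iff.1 (D.mem_Z_iff.2 ⟨u, h⟩)).choose_spec h (by simp)

theorem cls_surjective (D : Bidiff V) (r : ℕ) : Function.Surjective (D.cls r) :=
  Submodule.mkQ_surjective _

theorem dE_dE (D : Bidiff V) (r : ℕ) (x : D.E r) : D.dE r (D.dE r x) = 0 := by
  obtain ⟨⟨X, hX⟩, rfl⟩ := D.cls_surjective r x
  obtain ⟨u, hu⟩ := D.mem_Z_iff.1 hX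
  have hv : ∃ v, (D.d u, v) ∈ D.lift r ∧ D.d v = 0 := by
    refine ⟨if r = 0 then D.d u else 0, D.mem_lift.2 ⟨fun j => if j = 0 then D.d u else 0,
      by simp, by simp, D.γ_d_of_lift hu, ?_⟩, ?_⟩
    · rintro (_ | i) - <;> simp [D.d_d]
    · split_ifs <;> simp [D.d_d]
  obtain ⟨v, hv, hdv⟩ := hv
  rw [D.dE_cls hu, D.dE_cls hv, cls_eq_zero]
  simp [hdv]

/-- The space `E_(r+1)` is the cohomology of `d_r` in `E_r`. -/
theorem exists_E_succ_equiv (D : Bidiff V) (r : ℕ) :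
    ∃ e : D.E (r + 1) ≃ₗ[ℝ] (↥(LinearMap.ker (D.dE r)) ⧸
        (LinearMap.range (D.dE r)).submoduleOf (LinearMap.ker (D.dE r))),
      ∀ (X : V) (h : X ∈ D.Z (r + 1)) (h' : X ∈ D.Z r)
        (h'' : D.cls r ⟨X, h'⟩ ∈ LinearMap.ker (D.dE r)),
        e (D.cls (r + 1) ⟨X, h⟩) = Submodule.Quotient.mk ⟨D.cls r ⟨X, h'⟩, h''⟩ := by
  have hle : D.Z (r + 1) ≤ D.Z r := fun X hX => (D.mem_Z_succ.1 hX).1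
  have hker : ∀ X : ↥(D.Z (r + 1)), D.cls r ⟨X, hle X.2⟩ ∈ LinearMap.ker (D.dE r) := by
    rintro ⟨X, hX⟩
    obtain ⟨u, hu, hB⟩ := (D.mem_Z_succ.1 hX).2
    rw [LinearMap.mem_ker, D.dE_cls hu, cls_eq_zero]
    exact hB
  let f : ↥(D.Z (r + 1)) →ₗ[ℝ] (↥(LinearMap.ker (D.dE r)) ⧸
        (LinearMap.range (D.dE r)).submoduleOf (LinearMap.ker (D.dE r))) :=
    (Submodule.mkQ _).comp
      (((D.cls r).comp (Submodule.inclusion hle)).codRestrict (LinearMap.ker (D.dE r)) hker)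
  have hf : Function.Surjective f := by
    intro y
    obtain ⟨⟨y, hy⟩, rfl⟩ := Submodule.mkQ_surjective _ y
    obtain ⟨⟨X, hX⟩, rfl⟩ := D.cls_surjective r y
    obtain ⟨u, hu⟩ := D.mem_Z_iff.1 hX
    rw [LinearMap.mem_ker, D.dE_cls hu, cls_eq_zero] at hy
    exact ⟨⟨X, D.mem_Z_succ.2 ⟨hX, u, hu, hy⟩⟩, rfl⟩
  have hfk : LinearMap.ker f = (D.B (r + 1)).submoduleOf (D.Z (r + 1)) := by
    ext ⟨X, hX⟩
    have h1 : ⟨X, hX⟩ ∈ LinearMap.ker f ↔ D.cls r ⟨X, hle hX⟩ ∈ LinearMap.range (D.dE r) := by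
      rw [LinearMap.mem_ker]
      exact Submodule.Quotient.mk_eq_zero _
    rw [h1, LinearMap.mem_range]
    change _ ↔ X ∈ D.B (r + 1)
    constructor
    · rintro ⟨y, hy⟩
      obtain ⟨⟨W, hW⟩, rfl⟩ := D.cls_surjective r y
      obtain ⟨u, hu⟩ := D.mem_Z_iff.1 hW
      rw [D.dE_cls hu, ← sub_eq_zero, ← map_sub, cls_eq_zero] at hy
      refine D.mem_B_succ.2 ⟨W, u, hu, ?_⟩
      simpa using (D.B r).neg_mem hy
    · intro h
      obtain ⟨W, u, hu, hB⟩ := D.mem_B_succ.1 h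
      refine ⟨D.cls r ⟨W, D.mem_Z_iff.2 ⟨u, hu⟩⟩, ?_⟩
      rw [D.dE_cls hu, ← sub_eq_zero, ← map_sub, cls_eq_zero]
      simpa using (D.B r).neg_mem hB
  refine ⟨(Submodule.quotEquivOfEq _ _ hfk.symm).trans (f.quotKerEquivOfSurjective hf), ?_⟩
  intro X h h' h''
  rfl

/-- The restriction of the two differentials to a stable subspace. -/
def restrict (D : Bidiff V) (Q : Submodule ℝ V) (hγ : ∀ x ∈ Q, D.γ x ∈ Q)
    (hd : ∀ x ∈ Q, D.d x ∈ Q) : Bidiff ↥Q where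
  γ := D.γ.restrict hγ
  d := D.d.restrict hd
  γ_γ x := Subtype.ext (D.γ_γ x)
  d_d x := Subtype.ext (D.d_d x)
  γ_d x := Subtype.ext (D.γ_d x)

/-- A linear map that commutes with `γ` and `d`. -/
def IsHom (D : Bidiff V) (D' : Bidiff W) (f : V →ₗ[ℝ] W) : Prop :=
  (∀ x, f (D.γ x) = D'.γ (f x)) ∧ ∀ x, f (D.d x) = D'.d (f x)

theorem IsHom.lift {D : Bidiff V} {D' : Bidiff W} {f : V →ₗ[ℝ] W} (hf : D.IsHom D' f) {r : ℕ}
    {X u : V} (h : (X, u) ∈ D.lift r) : (f X, f u) ∈ D'.lift r := by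
  obtain ⟨c, h0, h1, h2, h3⟩ := D.mem_lift.1 h
  refine D'.mem_lift.2 ⟨fun i => f (c i), congrArg f h0, congrArg f h1,
    by rw [← hf.1, h2, map_zero], ?_⟩
  intro i hi
  rw [← hf.1, ← hf.2, ← map_add, h3 i hi, map_zero]

theorem IsHom.mem_B {D : Bidiff V} {D' : Bidiff W} {f : V →ₗ[ℝ] W} (hf : D.IsHom D' f) {r : ℕ}
    {X : V} (h : X ∈ D.B r) : f X ∈ D'.B r := by
  induction r generalizing X with
  | zero =>
    obtain ⟨a, rfl⟩ := h
    exact ⟨f a, (hf.1 a).symm⟩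
  | succ r ih =>
    obtain ⟨Y, u, hu, hB⟩ := D.mem_B_succ.1 h
    refine D'.mem_B_succ.2 ⟨f Y, f u, hf.lift hu, ?_⟩
    rw [← hf.2, ← map_sub]
    exact ih hB

theorem IsHom.mem_Z {D : Bidiff V} {D' : Bidiff W} {f : V →ₗ[ℝ] W} (hf : D.IsHom D' f) {r : ℕ}
    {X : V} (h : X ∈ D.Z r) : f X ∈ D'.Z r := by
  obtain ⟨u, hu⟩ := D.mem_Z_iff.1 h
  exact D'.mem_Z_iff.2 ⟨f u, hf.lift hu⟩

/-- The linear map `E_r → E'_r` induced by a linear map that commutes with `γ` and `d`. -/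
def mapE {D : Bidiff V} {D' : Bidiff W} {f : V →ₗ[ℝ] W} (hf : D.IsHom D' f) (r : ℕ) :
    D.E r →ₗ[ℝ] D'.E r :=
  Submodule.mapQ _ _ (f.restrict fun _ h => hf.mem_Z h) (fun _ h => hf.mem_B h)

/-- The classes in `E_r` that are represented by an element of the subspace `F` of `V`. -/
def classesIn (D : Bidiff V) (F : Submodule ℝ V) (r : ℕ) : Submodule ℝ (D.E r) :=
  (F.submoduleOf (D.Z r)).map (D.cls r)

end Bidiff
end PForm
namespace PForm

/-! ### The algebra of local forms -/

/-- The generators of the algebra of local forms in `n` spacetime dimensions, for gauge potentials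
`B^a` of form degree `p a`: the differentials `dx^μ`, and, for each form degree `l ≤ p a`, the
components `∂_α B^{a(l, p a - l)}_{μ_1 … μ_l}` of the field (`l = p a`) and of the ghosts
(`l < p a`) together with their derivatives; a multiset `α` of indices stands for the commuting
partial derivatives that act. -/
inductive Gen {ι : Type*} (n : ℕ) (p : ι → ℕ) : Type _
  | dx (μ : Fin n) : Gen n p
  | fld (a : ι) (l : ℕ) (hl : l ≤ p a) (μ : Fin l → Fin n) (α : Multiset (Fin n)) : Gen n p

variable {ι : Type*} {n : ℕ} {p : ι → ℕ}

/-- The degree that gives the Grassmann parity: `1` for `dx^μ`, the ghost number for the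
components of the fields and ghosts. -/
def Gen.deg : Gen n p → ℕ
  | .dx _ => 1
  | .fld a l _ _ _ => p a - l

/-- The form degree of a generator. -/
def Gen.formDeg : Gen n p → ℕ
  | .dx _ => 1
  | .fld _ _ _ _ _ => 0

/-- The defining relations: graded commutativity, and antisymmetry of the components. -/
inductive Rel (n : ℕ) (p : ι → ℕ) : FreeAlgebra ℝ (Gen n p) → FreeAlgebra ℝ (Gen n p) → Prop
  | comm (x y : Gen n p) : Rel n p (FreeAlgebra.ι ℝ x * FreeAlgebra.ι ℝ y)
      ((-1 : ℝ) ^ (x.deg * y.deg) • (FreeAlgebra.ι ℝ y * FreeAlgebra.ι ℝ x))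
  | antisymm (a : ι) (l : ℕ) (hl : l ≤ p a) (μ : Fin l → Fin n) (α : Multiset (Fin n))
      (σ : Equiv.Perm (Fin l)) :
      Rel n p (FreeAlgebra.ι ℝ (.fld a l hl (μ ∘ σ) α))
        (((σ.sign : ℤ) : ℝ) • FreeAlgebra.ι ℝ (.fld a l hl μ α))

/-- The algebra of spacetime forms whose coefficients are polynomials in the fields, the ghosts and
their derivatives, without explicit dependence on the spacetime coordinates. -/
def LocalForm (n : ℕ) (p : ι → ℕ) : Type _ := RingQuot (Rel n p)

instance : Ring (LocalForm n p) := inferInstanceAs (Ring (RingQuot (Rel n p)))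

instance : Algebra ℝ (LocalForm n p) := inferInstanceAs (Algebra ℝ (RingQuot (Rel n p)))

/-- The quotient map. -/
def mkHom (n : ℕ) (p : ι → ℕ) : FreeAlgebra ℝ (Gen n p) →ₐ[ℝ] LocalForm n p :=
  RingQuot.mkAlgHom ℝ (Rel n p)

/-- The generators as elements of the algebra of local forms. -/
def gen (x : Gen n p) : LocalForm n p := mkHom n p (FreeAlgebra.ι ℝ x)

/-- The form `dx^μ`. -/
def dx (n : ℕ) (p : ι → ℕ) (μ : Fin n) : LocalForm n p := gen (.dx μ)

/-- The component `∂_α B^{a(l, p a - l)}_{μ_1 … μ_l}`. -/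
def fld (a : ι) (l : ℕ) (hl : l ≤ p a) (μ : Fin l → Fin n) (α : Multiset (Fin n)) :
    LocalForm n p := gen (.fld a l hl μ α)

theorem gen_comm (x y : Gen n p) :
    gen x * gen y = (-1 : ℝ) ^ (x.deg * y.deg) • (gen y * gen x) := by
  have : mkHom n p _ = mkHom n p _ := RingQuot.mkAlgHom_rel ℝ (Rel.comm (n := n) (p := p) x y)
  simpa only [gen, map_mul, map_smul] using this

theorem fld_perm (a : ι) (l : ℕ) (hl : l ≤ p a) (μ : Fin l → Fin n) (α : Multiset (Fin n))
    (σ : Equiv.Perm (Fin l)) :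
    fld a l hl (μ ∘ σ) α = ((σ.sign : ℤ) : ℝ) • (fld a l hl μ α : LocalForm n p) := by
  have : mkHom n p _ = mkHom n p _ :=
    RingQuot.mkAlgHom_rel ℝ (Rel.antisymm (n := n) (p := p) a l hl μ α σ)
  simpa only [fld, gen, map_smul] using this

theorem LocalForm.induction {C : LocalForm n p → Prop} (halg : ∀ r : ℝ, C (algebraMap ℝ _ r))
    (hgen : ∀ x, C (gen x)) (hmul : ∀ x y, C x → C y → C (x * y))
    (hadd : ∀ x y, C x → C y → C (x + y)) (a : LocalForm n p) : C a := by
  obtain ⟨b, rfl⟩ : ∃ b, mkHom n p b = a := RingQuot.mkAlgHom_surjective ℝ (Rel n p) a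
  induction b using FreeAlgebra.induction with
  | grade0 r => simpa using halg r
  | grade1 x => exact hgen x
  | mul x y hx hy => simpa using hmul _ _ hx hy
  | add x y hx hy => simpa using hadd _ _ hx hy

/-- The algebra homomorphism with given values on the generators. -/
def liftHom {S : Type*} [Semiring S] [Algebra ℝ S] (f : Gen n p → S)
    (h1 : ∀ x y, f x * f y = (-1 : ℝ) ^ (x.deg * y.deg) • (f y * f x))
    (h2 : ∀ a l hl μ α (σ : Equiv.Perm (Fin l)),
      f (.fld a l hl (μ ∘ σ) α) = ((σ.sign : ℤ) : ℝ) • f (.fld a l hl μ α)) :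
    LocalForm n p →ₐ[ℝ] S :=
  RingQuot.liftAlgHom ℝ ⟨FreeAlgebra.lift ℝ f, by
    intro x y hxy
    cases hxy with
    | comm x y => simpa using h1 x y
    | antisymm a l hl μ α σ => simpa using h2 a l hl μ α σ⟩

theorem eq_zero_of_eq_neg {a : LocalForm n p} (h : a = -a) : a = 0 := by
  have h2 : (2 : ℝ) • a = 0 := by
    rw [two_smul]
    nth_rewrite 2 [h]
    exact add_neg_cancel a
  exact (smul_eq_zero.1 h2).resolve_left two_ne_zero

theorem liftHom_gen {S : Type*} [Semiring S] [Algebra ℝ S] (f : Gen n p → S)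
    (h1 : ∀ x y, f x * f y = (-1 : ℝ) ^ (x.deg * y.deg) • (f y * f x))
    (h2 : ∀ a l hl μ α (σ : Equiv.Perm (Fin l)),
      f (.fld a l hl (μ ∘ σ) α) = ((σ.sign : ℤ) : ℝ) • f (.fld a l hl μ α)) (x : Gen n p) :
    liftHom f h1 h2 (gen x) = f x := by
  have h := RingQuot.liftAlgHom_mkAlgHom_apply (S := ℝ) (FreeAlgebra.lift ℝ f) (s := Rel n p) (by
    intro x y hxy
    cases hxy with
    | comm x y => simpa using h1 x y
    | antisymm a l hl μ α σ => simpa using h2 a l hl μ α σ) (FreeAlgebra.ι ℝ x)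
  exact h.trans (by simp)

theorem hom_ext {S : Type*} [Semiring S] [Algebra ℝ S] {f g : LocalForm n p →ₐ[ℝ] S}
    (h : ∀ x, f (gen x) = g (gen x)) (a : LocalForm n p) : f a = g a := by
  induction a using LocalForm.induction with
  | halg r => simp
  | hgen x => exact h x
  | hmul x y hx hy => simp [hx, hy]
  | hadd x y hx hy => simp [hx, hy]

/-- The power `e` of the parity automorphism. -/
def tw (e : ℕ) : LocalForm n p →ₐ[ℝ] LocalForm n p :=
  liftHom (fun x => (-1 : ℝ) ^ (e * x.deg) • gen x)
    (fun x y => by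
      simp only [smul_mul_smul_comm]
      rw [gen_comm x y, smul_comm, mul_comm ((-1 : ℝ) ^ (e * x.deg))])
    (fun a l hl μ α σ => by
      rw [show gen (.fld a l hl (μ ∘ σ) α) = ((σ.sign : ℤ) : ℝ) •
        (gen (.fld a l hl μ α) : LocalForm n p) from fld_perm a l hl μ α σ, smul_comm]
      rfl)

theorem tw_gen (e : ℕ) (x : Gen n p) : tw e (gen x) = (-1 : ℝ) ^ (e * x.deg) • gen x :=
  liftHom_gen _ _ _ _

theorem tw_zero (a : LocalForm n p) : tw 0 a = a := by
  have := hom_ext (f := tw 0) (g := AlgHom.id ℝ (LocalForm n p)) (fun x => by simp [tw_gen]) a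
  simpa using this

/-- `a` commutes with all generators as an element of parity `i`. -/
def SC (i : ℕ) (a : LocalForm n p) : Prop :=
  ∀ y : Gen n p, a * gen y = (-1 : ℝ) ^ (i * y.deg) • (gen y * a)

theorem SC.gen (x : Gen n p) : SC x.deg (PForm.gen x) := fun y => gen_comm x y

theorem SC.zero (i : ℕ) : SC i (0 : LocalForm n p) := fun y => by simp

theorem SC.add {i : ℕ} {a b : LocalForm n p} (ha : SC i a) (hb : SC i b) : SC i (a + b) :=
  fun y => by rw [add_mul, ha y, hb y, mul_add, smul_add]

theorem SC.smul {i : ℕ} {a : LocalForm n p} (t : ℝ) (ha : SC i a) : SC i (t • a) :=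
  fun y => by rw [smul_mul_assoc, ha y, mul_smul_comm, smul_comm]

theorem SC.neg {i : ℕ} {a : LocalForm n p} (ha : SC i a) : SC i (-a) := by
  rw [← neg_one_smul ℝ a]
  exact ha.smul (-1)

theorem SC.sum {i : ℕ} {J : Type*} (s : Finset J) {f : J → LocalForm n p}
    (h : ∀ j ∈ s, SC i (f j)) : SC i (∑ j ∈ s, f j) := by
  classical
  induction s using Finset.induction_on with
  | empty => simpa using SC.zero i
  | insert j s hj ih =>
    rw [Finset.sum_insert hj]
    exact (h j (by simp)).add (ih fun k hk => h k (by simp [hk]))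

theorem SC.msum {i : ℕ} (s : Multiset (LocalForm n p)) (h : ∀ a ∈ s, SC i a) : SC i s.sum := by
  induction s using Multiset.induction with
  | empty => simpa using SC.zero i
  | cons a s ih =>
    rw [Multiset.sum_cons]
    exact (h a (by simp)).add (ih fun b hb => h b (by simp [hb]))

theorem SC.congr {i j : ℕ} {a : LocalForm n p} (h : SC i a) (hij : Even (i + j)) : SC j a := by
  intro y
  rw [h y]
  congr 1
  rw [pow_mul, pow_mul]
  congr 1
  rcases Nat.even_or_odd i with hi | hi
  · rw [hi.neg_one_pow, ((Nat.even_add.1 hij).1 hi).neg_one_pow]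
  · have hj : Odd j := by
      rw [← Nat.not_even_iff_odd, ← Nat.even_add.1 hij, Nat.not_even_iff_odd]
      exact hi
    rw [hi.neg_one_pow, hj.neg_one_pow]

/-- Auxiliary homomorphism for `der`. -/
def derHom (e : ℕ) (f : Gen n p → LocalForm n p) (h1 : ∀ x, SC (x.deg + e) (f x))
    (h2 : ∀ a l hl μ α (σ : Equiv.Perm (Fin l)),
      f (.fld a l hl (μ ∘ σ) α) = ((σ.sign : ℤ) : ℝ) • f (.fld a l hl μ α)) :
    LocalForm n p →ₐ[ℝ] Matrix (Fin 2) (Fin 2) (LocalForm n p) :=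
  liftHom (fun x => !![tw e (gen x), f x; 0, gen x])
    (fun x y => by
      have e1 : tw e (gen x) * tw e (gen y) =
          (-1 : ℝ) ^ (x.deg * y.deg) • (tw e (gen y) * tw e (gen x)) := by
        rw [← map_mul, gen_comm, map_smul, map_mul]
      have e2 : tw e (gen x) * f y + f x * gen y =
          (-1 : ℝ) ^ (x.deg * y.deg) • (tw e (gen y) * f x + f y * gen x) := by
        rw [h1 x y, h1 y x, tw_gen, tw_gen, smul_mul_assoc, smul_mul_assoc, smul_add, smul_smul,
          smul_smul, ← pow_add, ← pow_add, add_comm]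
        congr 2
        · ring
        · rw [show x.deg * y.deg + (y.deg + e) * x.deg = e * x.deg + 2 * (x.deg * y.deg) by ring,
            pow_add, pow_mul (-1 : ℝ) 2]
          simp
      ext i j
      fin_cases i <;> fin_cases j
      · simpa using e1
      · simpa using e2
      · simp
      · simpa using gen_comm x y)
    (fun a l hl μ α σ => by
      have e1 : gen (.fld a l hl (μ ∘ σ) α) = ((σ.sign : ℤ) : ℝ) •
        (gen (.fld a l hl μ α) : LocalForm n p) := fld_perm a l hl μ α σ
      rw [h2, e1, map_smul]
      ext i j
      fin_cases i <;> fin_cases j <;> simp)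

/-- The (anti)derivation of parity `e` with given values on the generators. -/
def der (e : ℕ) (f : Gen n p → LocalForm n p) (h1 : ∀ x, SC (x.deg + e) (f x))
    (h2 : ∀ a l hl μ α (σ : Equiv.Perm (Fin l)),
      f (.fld a l hl (μ ∘ σ) α) = ((σ.sign : ℤ) : ℝ) • f (.fld a l hl μ α)) :
    LocalForm n p →ₗ[ℝ] LocalForm n p where
  toFun a := derHom e f h1 h2 a 0 1
  map_add' a b := by simp
  map_smul' t a := by simp

section der

variable (e : ℕ) (f : Gen n p → LocalForm n p) (h1 : ∀ x, SC (x.deg + e) (f x))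
    (h2 : ∀ a l hl μ α (σ : Equiv.Perm (Fin l)),
      f (.fld a l hl (μ ∘ σ) α) = ((σ.sign : ℤ) : ℝ) • f (.fld a l hl μ α))

theorem der_gen (x : Gen n p) : der e f h1 h2 (gen x) = f x := by
  simp [der, derHom, liftHom_gen]

theorem derHom_apply (a : LocalForm n p) :
    derHom e f h1 h2 a = !![tw e a, der e f h1 h2 a; 0, a] := by
  induction a using LocalForm.induction with
  | halg r =>
    ext i j
    fin_cases i <;> fin_cases j <;> simp [der, Matrix.algebraMap_matrix_apply]
  | hgen x => rw [der_gen, derHom, liftHom_gen]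
  | hmul x y hx hy =>
    have : derHom e f h1 h2 (x * y) = derHom e f h1 h2 x * derHom e f h1 h2 y := map_mul _ _ _
    ext i j
    fin_cases i <;> fin_cases j
    · rw [this, hx, hy]; simp
    · simp [der]
    · rw [this, hx, hy]; simp
    · rw [this, hx, hy]; simp
  | hadd x y hx hy =>
    rw [map_add, hx, hy]
    ext i j
    fin_cases i <;> fin_cases j <;> simp

theorem der_mul (a b : LocalForm n p) :
    der e f h1 h2 (a * b) = der e f h1 h2 a * b + tw e a * der e f h1 h2 b := by
  have h : der e f h1 h2 (a * b) = (derHom e f h1 h2 a * derHom e f h1 h2 b) 0 1 := by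
    simp [der]
  rw [h, derHom_apply, derHom_apply]
  simp [add_comm]

theorem der_algebraMap (r : ℝ) : der e f h1 h2 (algebraMap ℝ _ r) = 0 := by
  simp [der, Matrix.algebraMap_matrix_apply]

end der

end PForm
namespace PForm

/-! ### The differentials `d` and `γ` -/

variable {ι : Type*} {n : ℕ} {p : ι → ℕ}

/-- Values of `∂_ν` on the generators. -/
def pdGen (ν : Fin n) : Gen n p → LocalForm n p
  | .dx _ => 0
  | .fld a l hl μ α => fld a l hl μ (ν ::ₘ α)

/-- The total derivative `∂_ν`. -/
def pd (ν : Fin n) : LocalForm n p →ₗ[ℝ] LocalForm n p :=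
  der 0 (pdGen ν)
    (fun x => by
      cases x with
      | dx μ => exact SC.zero _
      | fld a l hl μ α => exact SC.gen (.fld a l hl μ (ν ::ₘ α)))
    (fun a l hl μ α σ => fld_perm a l hl μ (ν ::ₘ α) σ)

/-- The exterior derivative `d = dx^ν ∂_ν`. -/
def extD : LocalForm n p →ₗ[ℝ] LocalForm n p :=
  ∑ ν, (LinearMap.mulLeft ℝ (dx n p ν)).comp (pd ν)

/-- Values of `γ` on the generators: up to a sign and normalization, `γ B_{μ_0 … μ_l}` is the
antisymmetrization of `∂_{μ_0} C_{μ_1 … μ_l}`. The sign and the normalization are those for which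
`γ B^{a(l + 1, p a - l - 1)} + d B^{a(l, p a - l)} = 0`, see `brst_form_succ`. -/
noncomputable def brstGen : Gen n p → LocalForm n p
  | .dx _ => 0
  | .fld _ 0 _ _ _ => 0
  | .fld a (l + 1) hl μ α => ((-1 : ℝ) ^ (p a - (l + 1)) / (l.factorial : ℝ)) •
      ∑ σ : Equiv.Perm (Fin (l + 1)), ((σ.sign : ℤ) : ℝ) •
        fld a l (Nat.le_of_succ_le hl) (fun i => μ (σ i.succ)) (μ (σ 0) ::ₘ α)

/-- The BRST differential `γ`. -/
noncomputable def brst : LocalForm n p →ₗ[ℝ] LocalForm n p :=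
  der 1 brstGen
    (fun x => by
      cases x with
      | dx μ => exact SC.zero _
      | fld a l hl μ α =>
        cases l with
        | zero => exact SC.zero _
        | succ l =>
          refine SC.smul _ (SC.sum _ fun σ _ => SC.smul _ ?_)
          have h := SC.gen (n := n) (Gen.fld a l (Nat.le_of_succ_le hl) (fun i => μ (σ i.succ))
            (μ (σ 0) ::ₘ α))
          refine h.congr ?_
          simp only [Gen.deg]
          exact ⟨p a - l, by omega⟩)
    (fun a l hl μ α σ => by
      cases l with
      | zero => simp [brstGen]
      | succ l =>
        simp only [brstGen]
        rw [smul_comm]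
        congr 1
        rw [Finset.smul_sum]
        refine Fintype.sum_equiv (Equiv.mulLeft σ) _ _ fun τ => ?_
        rw [smul_smul]
        congr 1
        simp only [Equiv.coe_mulLeft, Equiv.Perm.sign_mul]
        rcases Int.units_eq_one_or σ.sign with h | h <;> simp [h])

theorem pd_fld (ν : Fin n) (a : ι) (l : ℕ) (hl : l ≤ p a) (μ : Fin l → Fin n)
    (α : Multiset (Fin n)) : pd ν (fld a l hl μ α) = fld a l hl μ (ν ::ₘ α) :=
  der_gen _ _ _ _ _

theorem pd_dx (ν μ : Fin n) : pd ν (dx n p μ) = 0 := der_gen _ _ _ _ _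

theorem pd_mul (ν : Fin n) (a b : LocalForm n p) : pd ν (a * b) = pd ν a * b + a * pd ν b := by
  have : pd ν (a * b) = pd ν a * b + tw 0 a * pd ν b := der_mul _ _ _ _ _ _
  rwa [tw_zero] at this

theorem pd_algebraMap (ν : Fin n) (r : ℝ) : pd ν (algebraMap ℝ (LocalForm n p) r) = 0 :=
  der_algebraMap _ _ _ _ _

theorem brst_dx (μ : Fin n) : brst (dx n p μ) = 0 := der_gen _ _ _ _ _

theorem brst_fld_zero (a : ι) (hl : 0 ≤ p a) (μ : Fin 0 → Fin n) (α : Multiset (Fin n)) :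
    brst (fld a 0 hl μ α) = 0 := der_gen _ _ _ _ _

theorem brst_fld_succ (a : ι) (l : ℕ) (hl : l + 1 ≤ p a) (μ : Fin (l + 1) → Fin n)
    (α : Multiset (Fin n)) :
    brst (fld a (l + 1) hl μ α) = ((-1 : ℝ) ^ (p a - (l + 1)) / (l.factorial : ℝ)) •
      ∑ σ : Equiv.Perm (Fin (l + 1)), ((σ.sign : ℤ) : ℝ) •
        fld a l (Nat.le_of_succ_le hl) (fun i => μ (σ i.succ)) (μ (σ 0) ::ₘ α) :=
  der_gen _ _ _ _ _

theorem brst_mul (a b : LocalForm n p) : brst (a * b) = brst a * b + tw 1 a * brst b :=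
  der_mul _ _ _ _ _ _

theorem brst_algebraMap (r : ℝ) : brst (algebraMap ℝ (LocalForm n p) r) = 0 :=
  der_algebraMap _ _ _ _ _

theorem extD_apply (a : LocalForm n p) : extD a = ∑ ν, dx n p ν * pd ν a := by
  simp [extD]

theorem dx_mul (ν : Fin n) (a : LocalForm n p) : dx n p ν * a = tw 1 a * dx n p ν := by
  induction a using LocalForm.induction with
  | halg r => rw [AlgHom.commutes, Algebra.commutes]
  | hgen x =>
    rw [tw_gen, dx, gen_comm, Gen.deg]
    simp
  | hmul x y hx hy => rw [← mul_assoc, hx, mul_assoc, hy, map_mul, mul_assoc]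
  | hadd x y hx hy => rw [mul_add, hx, hy, map_add, add_mul]

theorem extD_mul (a b : LocalForm n p) : extD (a * b) = extD a * b + tw 1 a * extD b := by
  simp only [extD_apply, Finset.sum_mul, Finset.mul_sum, ← Finset.sum_add_distrib]
  refine Finset.sum_congr rfl fun ν _ => ?_
  rw [pd_mul, mul_add, ← mul_assoc, ← mul_assoc, dx_mul ν a, mul_assoc (tw 1 a)]

theorem pd_pd (ν ρ : Fin n) (a : LocalForm n p) : pd ν (pd ρ a) = pd ρ (pd ν a) := by
  induction a using LocalForm.induction with
  | halg r => simp [pd_algebraMap]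
  | hgen x =>
    cases x with
    | dx μ => rw [show gen (.dx μ) = dx n p μ from rfl, pd_dx, pd_dx, map_zero, map_zero]
    | fld a l hl μ α =>
      rw [show gen (.fld a l hl μ α) = (fld a l hl μ α : LocalForm n p) from rfl]
      simp only [pd_fld, Multiset.cons_swap ν ρ]
  | hmul x y hx hy =>
    simp only [pd_mul, map_add, hx, hy]
    abel
  | hadd x y hx hy => simp [hx, hy]

theorem pd_tw (ν : Fin n) (e : ℕ) (a : LocalForm n p) : pd ν (tw e a) = tw e (pd ν a) := by
  induction a using LocalForm.induction with
  | halg r => simp [pd_algebraMap]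
  | hgen x =>
    cases x with
    | dx μ =>
      rw [tw_gen, map_smul, show gen (.dx μ) = dx n p μ from rfl, pd_dx, map_zero, smul_zero]
    | fld a l hl μ α =>
      rw [tw_gen, map_smul, show gen (.fld a l hl μ α) = (fld a l hl μ α : LocalForm n p) from rfl,
        pd_fld, fld, tw_gen]
      rfl
  | hmul x y hx hy => simp only [pd_mul, map_mul, map_add, hx, hy]
  | hadd x y hx hy => simp [hx, hy]

theorem pd_brst (ν : Fin n) (a : LocalForm n p) : pd ν (brst a) = brst (pd ν a) := by
  induction a using LocalForm.induction with
  | halg r => simp [pd_algebraMap, brst_algebraMap]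
  | hgen x =>
    cases x with
    | dx μ => rw [show gen (.dx μ) = dx n p μ from rfl, pd_dx, brst_dx, map_zero, map_zero]
    | fld a l hl μ α =>
      rw [show gen (.fld a l hl μ α) = (fld a l hl μ α : LocalForm n p) from rfl]
      cases l with
      | zero => rw [brst_fld_zero, pd_fld, brst_fld_zero, map_zero]
      | succ l =>
        simp only [brst_fld_succ, pd_fld, map_smul, map_sum, Multiset.cons_swap ν]
  | hmul x y hx hy =>
    simp only [pd_mul, brst_mul, map_add, hx, hy, pd_tw]
    abel
  | hadd x y hx hy => simp [hx, hy]

theorem tw_brst (a : LocalForm n p) : tw 1 (brst a) = -brst (tw 1 a) := by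
  induction a using LocalForm.induction with
  | halg r => simp [brst_algebraMap]
  | hgen x =>
    cases x with
    | dx μ =>
      rw [tw_gen, map_smul, show gen (.dx μ) = dx n p μ from rfl, brst_dx]
      simp
    | fld a l hl μ α =>
      rw [tw_gen, map_smul, show gen (.fld a l hl μ α) = (fld a l hl μ α : LocalForm n p) from rfl]
      cases l with
      | zero => simp [brst_fld_zero]
      | succ l =>
        rw [brst_fld_succ]
        simp only [map_smul, map_sum, fld, tw_gen, Gen.deg]
        rw [show 1 * (p a - l) = 1 * (p a - (l + 1)) + 1 by omega]
        simp only [pow_succ, mul_neg, mul_one, neg_smul, smul_neg, Finset.sum_neg_distrib, neg_inj]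
        simp only [Finset.smul_sum]
        refine Finset.sum_congr rfl fun σ _ => ?_
        simp only [smul_smul]
        congr 1
        ring
  | hmul x y hx hy =>
    simp only [brst_mul, map_mul, map_add, hx, hy]
    simp only [neg_mul, mul_neg, neg_add]
  | hadd x y hx hy => simp only [map_add, hx, hy, neg_add]

theorem dx_dx (ν ρ : Fin n) : dx n p ν * dx n p ρ = -(dx n p ρ * dx n p ν) := by
  rw [dx, dx, gen_comm]
  simp [Gen.deg]

theorem extD_extD (a : LocalForm n p) : extD (extD a) = 0 := by
  have h : extD (extD a) = ∑ ν, ∑ ρ, dx n p ν * dx n p ρ * pd ν (pd ρ a) := by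
    rw [extD_apply]
    refine Finset.sum_congr rfl fun ν _ => ?_
    rw [extD_apply, map_sum, Finset.mul_sum]
    refine Finset.sum_congr rfl fun ρ _ => ?_
    rw [pd_mul, pd_dx, zero_mul, zero_add, mul_assoc]
  have h' : extD (extD a) = -extD (extD a) := by
    conv_rhs => rw [h, Finset.sum_comm]
    rw [h, ← Finset.sum_neg_distrib]
    refine Finset.sum_congr rfl fun ν _ => ?_
    rw [← Finset.sum_neg_distrib]
    refine Finset.sum_congr rfl fun ρ _ => ?_
    rw [pd_pd, dx_dx, neg_mul]
  exact eq_zero_of_eq_neg h'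

theorem brst_extD (a : LocalForm n p) : brst (extD a) + extD (brst a) = 0 := by
  rw [extD_apply, extD_apply, map_sum, ← Finset.sum_add_distrib]
  refine Finset.sum_eq_zero fun ν _ => ?_
  rw [brst_mul, brst_dx, zero_mul, zero_add, pd_brst, dx, tw_gen]
  simp [Gen.deg]

theorem sum_perm_swap {l : ℕ} (F : (Fin l → Fin n) → Multiset (Fin n) → LocalForm n p)
    (μ : Fin (l + 2) → Fin n) (α : Multiset (Fin n)) :
    ∑ σ : Equiv.Perm (Fin (l + 2)), ((σ.sign : ℤ) : ℝ) •
      F (fun i => μ (σ i.succ.succ)) (μ (σ 1) ::ₘ μ (σ 0) ::ₘ α) = 0 := by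
  refine eq_zero_of_eq_neg ?_
  rw [← Finset.sum_neg_distrib]
  refine Fintype.sum_equiv (Equiv.mulRight (Equiv.swap 0 1)) _ _ fun σ => ?_
  have h : ∀ i : Fin l, Equiv.swap (0 : Fin (l + 2)) 1 i.succ.succ = i.succ.succ := fun i =>
    Equiv.swap_apply_of_ne_of_ne (Fin.succ_ne_zero _) (by
      rw [← Fin.succ_zero_eq_one]
      exact fun h => Fin.succ_ne_zero _ (Fin.succ_injective _ h))
  simp [Equiv.Perm.sign_mul, h, Multiset.cons_swap (μ (σ 1))]

theorem brst_brst_fld (a : ι) (l : ℕ) (hl : l ≤ p a) (μ : Fin l → Fin n) (α : Multiset (Fin n)) :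
    brst (brst (fld a l hl μ α : LocalForm n p)) = 0 := by
  match l with
  | 0 => rw [brst_fld_zero, map_zero]
  | 1 =>
    rw [brst_fld_succ]
    simp [brst_fld_zero]
  | l + 2 =>
    rw [brst_fld_succ]
    simp only [map_smul, map_sum, brst_fld_succ]
    simp only [smul_comm _ ((-1 : ℝ) ^ (p a - (l + 1)) / (l.factorial : ℝ)), ← Finset.smul_sum]
    simp only [Finset.smul_sum]
    rw [Finset.sum_comm]
    refine Finset.sum_eq_zero fun τ _ => ?_
    rw [← Finset.smul_sum, ← Finset.smul_sum]
    convert smul_zero _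
    convert smul_zero _
    have h := sum_perm_swap (fun μ α => (fld a l (by omega) μ α : LocalForm n p)) μ α
    have ht : ∀ j : Fin (l + 1), Equiv.Perm.decomposeFin.symm (0, τ) j.succ = (τ j).succ := by
      intro j
      simp
    have h0 : Equiv.Perm.decomposeFin.symm (0, τ) 0 = 0 := by simp
    have hs : ((Equiv.Perm.decomposeFin.symm (0, τ)).sign) = τ.sign := by simp
    rw [← h]
    refine Fintype.sum_equiv (Equiv.mulRight (Equiv.Perm.decomposeFin.symm (0, τ))) _ _ fun σ => ?_
    rw [smul_smul]
    have h1 : (1 : Fin (l + 2)) = (0 : Fin (l + 1)).succ := rfl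
    simp only [Equiv.coe_mulRight, Equiv.Perm.sign_mul, hs, Equiv.Perm.mul_apply, ht, h0, h1]
    push_cast
    rfl

theorem brst_brst (a : LocalForm n p) : brst (brst a) = 0 := by
  induction a using LocalForm.induction with
  | halg r => simp [brst_algebraMap]
  | hgen x =>
    cases x with
    | dx μ => rw [show gen (.dx μ) = dx n p μ from rfl, brst_dx, map_zero]
    | fld a l hl μ α => exact brst_brst_fld a l hl μ α
  | hmul x y hx hy =>
    simp only [brst_mul, map_add, hx, hy, tw_brst]
    simp
  | hadd x y hx hy => simp [hx, hy]

/-- The algebra of local forms with `γ` and `d`. -/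
noncomputable def localForms (n : ℕ) (p : ι → ℕ) : Bidiff (LocalForm n p) where
  γ := brst
  d := extD
  γ_γ := brst_brst
  d_d := extD_extD
  γ_d := brst_extD

end PForm
namespace PForm

/-! ### Exterior forms and the small algebra -/

variable {ι : Type*} {n : ℕ} {p : ι → ℕ}

/-- The product `dx^{μ_1} ⋯ dx^{μ_l}`. -/
def dxs (p : ι → ℕ) {l : ℕ} (μ : Fin l → Fin n) : LocalForm n p :=
  (List.ofFn fun i => dx n p (μ i)).prod

/-- The exterior form `B^{a(l, p a - l)} = (1 / l!) B_{μ_1 … μ_l} dx^{μ_1} ⋯ dx^{μ_l}`. -/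
noncomputable def form (n : ℕ) {p : ι → ℕ} (a : ι) (l : ℕ) (hl : l ≤ p a) : LocalForm n p :=
  (1 / (l.factorial : ℝ)) • ∑ μ : Fin l → Fin n, fld a l hl μ 0 * dxs p μ

theorem dxs_succ {l : ℕ} (μ : Fin (l + 1) → Fin n) :
    dxs p μ = dx n p (μ 0) * dxs p (fun i => μ i.succ) := by
  simp [dxs, List.ofFn_succ]

theorem dxs_zero (μ : Fin 0 → Fin n) : dxs p μ = 1 := by
  simp [dxs]

theorem tw_dx (μ : Fin n) : tw 1 (dx n p μ) = -dx n p μ := by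
  rw [dx, tw_gen]
  simp [Gen.deg]

theorem tw_fld (a : ι) (l : ℕ) (hl : l ≤ p a) (μ : Fin l → Fin n) (α : Multiset (Fin n)) :
    tw 1 (fld a l hl μ α : LocalForm n p) = (-1 : ℝ) ^ (p a - l) • fld a l hl μ α := by
  rw [fld, tw_gen]
  simp [Gen.deg]

theorem tw_dxs {l : ℕ} (μ : Fin l → Fin n) : tw 1 (dxs p μ) = (-1 : ℝ) ^ l • dxs p μ := by
  induction l with
  | zero => simp [dxs_zero]
  | succ l ih =>
    rw [dxs_succ, map_mul, ih, tw_dx, pow_succ]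
    simp

theorem brst_dxs {l : ℕ} (μ : Fin l → Fin n) : brst (dxs p μ) = 0 := by
  induction l with
  | zero =>
    rw [dxs_zero, ← map_one (algebraMap ℝ (LocalForm n p)), brst_algebraMap]
  | succ l ih => rw [dxs_succ, brst_mul, brst_dx, ih, zero_mul, mul_zero, add_zero]

theorem pd_dxs (ν : Fin n) {l : ℕ} (μ : Fin l → Fin n) : pd ν (dxs p μ) = 0 := by
  induction l with
  | zero =>
    rw [dxs_zero, ← map_one (algebraMap ℝ (LocalForm n p)), pd_algebraMap]
  | succ l ih => rw [dxs_succ, pd_mul, pd_dx, ih, zero_mul, mul_zero, add_zero]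

theorem dxs_perm {l : ℕ} (μ : Fin l → Fin n) (σ : Equiv.Perm (Fin l)) :
    dxs p (μ ∘ σ) = ((σ.sign : ℤ) : ℝ) • dxs p μ := by
  let f : (Fin n → ℝ) →ₗ[ℝ] LocalForm n p :=
    ∑ i, (LinearMap.toSpanSingleton ℝ _ (dx n p i)).comp (LinearMap.proj i)
  have hf : ∀ v, f v * f v = 0 := by
    intro v
    have h : ∀ v, f v = ∑ i, v i • dx n p i := fun v => by simp [f]
    refine eq_zero_of_eq_neg ?_
    rw [h, Finset.sum_mul_sum]
    conv_rhs => rw [Finset.sum_comm]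
    rw [← Finset.sum_neg_distrib]
    refine Finset.sum_congr rfl fun i _ => ?_
    rw [← Finset.sum_neg_distrib]
    refine Finset.sum_congr rfl fun j _ => ?_
    rw [smul_mul_smul_comm, smul_mul_smul_comm, dx_dx, smul_neg, mul_comm (v i)]
  have hs : ∀ i, f (Pi.single i 1) = dx n p i := by
    intro i
    simp [f, Pi.single_apply]
  let g := ExteriorAlgebra.lift ℝ ⟨f, hf⟩
  have hg : ∀ ρ : Fin l → Fin n,
      dxs p ρ = g (ExteriorAlgebra.ιMulti ℝ l (fun i => (Pi.single (ρ i) (1 : ℝ) : Fin n → ℝ))) := by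
    intro ρ
    rw [ExteriorAlgebra.ιMulti_apply, map_list_prod, List.map_ofFn, dxs]
    congr 2
    funext i
    simp only [Function.comp_apply, g, ExteriorAlgebra.lift_ι_apply, hs]
  have h := (ExteriorAlgebra.ιMulti ℝ l).map_perm
    (fun i => (Pi.single (μ i) (1 : ℝ) : Fin n → ℝ)) σ
  rw [hg, hg, ← map_smul]
  congr 1

theorem extD_form (a : ι) (l : ℕ) (hl : l ≤ p a) :
    extD (form n a l hl) = ((-1 : ℝ) ^ (p a - l) / (l.factorial : ℝ)) •
      ∑ μ : Fin l → Fin n, ∑ ν, fld a l hl μ {ν} * (dx n p ν * dxs p μ) := by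
  rw [form, map_smul, map_sum, show (-1 : ℝ) ^ (p a - l) / (l.factorial : ℝ) =
    1 / (l.factorial : ℝ) * (-1 : ℝ) ^ (p a - l) by ring, mul_smul]
  congr 1
  rw [Finset.smul_sum]
  refine Finset.sum_congr rfl fun μ _ => ?_
  rw [extD_apply, Finset.smul_sum]
  refine Finset.sum_congr rfl fun ν _ => ?_
  rw [pd_mul, pd_dxs, mul_zero, add_zero, pd_fld, ← mul_assoc, dx_mul, tw_fld, smul_mul_assoc,
    smul_mul_assoc, mul_assoc]
  rfl

theorem brst_form_zero (a : ι) (hl : 0 ≤ p a) : brst (form n a 0 hl) = 0 := by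
  rw [form, map_smul, map_sum, Finset.sum_eq_zero, smul_zero]
  intro μ _
  rw [brst_mul, brst_fld_zero, brst_dxs, zero_mul, mul_zero, add_zero]

/-- The BRST transformations in terms of exterior forms. -/
theorem brst_form_succ (a : ι) (l : ℕ) (hl : l + 1 ≤ p a) :
    brst (form n a (l + 1) hl) + extD (form n a l (Nat.le_of_succ_le hl)) = 0 := by
  have h1 : ∀ σ : Equiv.Perm (Fin (l + 1)), ∑ μ : Fin (l + 1) → Fin n,
      (((σ.sign : ℤ) : ℝ) • fld a l (Nat.le_of_succ_le hl) (fun i => μ (σ i.succ)) {μ (σ 0)}) *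
        dxs p μ = ∑ μ : Fin l → Fin n, ∑ ν,
          fld a l (Nat.le_of_succ_le hl) μ {ν} * (dx n p ν * dxs p μ) := by
    intro σ
    have e1 : ∑ μ : Fin (l + 1) → Fin n,
      (((σ.sign : ℤ) : ℝ) • fld a l (Nat.le_of_succ_le hl) (fun i => μ (σ i.succ)) {μ (σ 0)}) *
        dxs p μ = ∑ μ : Fin (l + 1) → Fin n,
          fld a l (Nat.le_of_succ_le hl) (fun i => μ i.succ) {μ 0} * dxs p μ := by
      refine Fintype.sum_equiv (Equiv.arrowCongr σ.symm (Equiv.refl _)) _ _ fun μ => ?_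
      have : (Equiv.arrowCongr σ.symm (Equiv.refl (Fin n))) μ = μ ∘ σ := by
        funext i
        simp [Equiv.arrowCongr]
      rw [this, dxs_perm, smul_mul_assoc, mul_smul_comm]
      rfl
    rw [e1, Finset.sum_comm, ← Fintype.sum_prod_type']
    refine Fintype.sum_equiv (Fin.consEquiv (fun _ => Fin n)).symm _ _ fun μ => ?_
    rw [dxs_succ]
    rfl
  have h2 : brst (form n a (l + 1) hl) = -extD (form n a l (Nat.le_of_succ_le hl)) := by
    rw [extD_form, form, map_smul, map_sum]
    have : ∀ μ : Fin (l + 1) → Fin n, brst (fld a (l + 1) hl μ 0 * dxs p μ) =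
        ((-1 : ℝ) ^ (p a - (l + 1)) / (l.factorial : ℝ)) • ∑ σ : Equiv.Perm (Fin (l + 1)),
          (((σ.sign : ℤ) : ℝ) • fld a l (Nat.le_of_succ_le hl) (fun i => μ (σ i.succ)) {μ (σ 0)}) *
            dxs p μ := by
      intro μ
      rw [brst_mul, brst_dxs, mul_zero, add_zero, brst_fld_succ, smul_mul_assoc, Finset.sum_mul]
      rfl
    simp only [this]
    rw [← Finset.smul_sum, Finset.sum_comm]
    simp only [h1]
    rw [Finset.sum_const, Finset.card_univ, Fintype.card_perm, Fintype.card_fin,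
      ← Nat.cast_smul_eq_nsmul ℝ, smul_smul, smul_smul, ← neg_smul]
    congr 1
    rw [show p a - l = p a - (l + 1) + 1 by omega, pow_succ]
    have := Nat.factorial_ne_zero (l + 1)
    field_simp
  rw [h2, neg_add_cancel]

theorem tw_form (a : ι) (l : ℕ) (hl : l ≤ p a) :
    tw 1 (form n a l hl) = (-1 : ℝ) ^ p a • form n a l hl := by
  rw [form, map_smul, map_sum, smul_comm]
  congr 1
  rw [Finset.smul_sum]
  refine Finset.sum_congr rfl fun μ _ => ?_
  rw [map_mul, tw_fld, tw_dxs, smul_mul_smul_comm, ← pow_add, Nat.sub_add_cancel hl]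

theorem tw_extD (a : LocalForm n p) : tw 1 (extD a) = -extD (tw 1 a) := by
  rw [extD_apply, extD_apply, map_sum, ← Finset.sum_neg_distrib]
  refine Finset.sum_congr rfl fun ν _ => ?_
  rw [map_mul, tw_dx, pd_tw, neg_mul]

/-- The generators of the small algebra: the exterior forms `B^{a(l, p a - l)}` and their exterior
derivatives. -/
def smallGens (n : ℕ) (p : ι → ℕ) : Set (LocalForm n p) :=
  {x | ∃ a l, ∃ hl : l ≤ p a, x = form n a l hl ∨ x = extD (form n a l hl)}

/-- The small algebra. -/
def smallAlg (n : ℕ) (p : ι → ℕ) : Subalgebra ℝ (LocalForm n p) :=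
  Algebra.adjoin ℝ (smallGens n p)

/-- The small algebra with constant forms as coefficients: the algebra generated by the exterior
forms `B^{a(l, p a - l)}`, their exterior derivatives and the constant forms `dx^μ`. -/
def smallAlgConst (n : ℕ) (p : ι → ℕ) : Subalgebra ℝ (LocalForm n p) :=
  Algebra.adjoin ℝ (smallGens n p ∪ Set.range (dx n p))

theorem adjoin_stable {S : Set (LocalForm n p)} (htw : ∀ x ∈ S, tw 1 x ∈ Algebra.adjoin ℝ S)
    (D : LocalForm n p →ₗ[ℝ] LocalForm n p) (hD : ∀ x ∈ S, D x ∈ Algebra.adjoin ℝ S)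
    (hmul : ∀ a b, D (a * b) = D a * b + tw 1 a * D b)
    (halg : ∀ r, D (algebraMap ℝ _ r) = 0) :
    ∀ x ∈ Subalgebra.toSubmodule (Algebra.adjoin ℝ S),
      D x ∈ Subalgebra.toSubmodule (Algebra.adjoin ℝ S) := by
  intro x hx
  have htw' : ∀ y ∈ Algebra.adjoin ℝ S, tw 1 y ∈ Algebra.adjoin ℝ S := by
    intro y hy
    have : Algebra.adjoin ℝ S ≤ (Algebra.adjoin ℝ S).comap (tw 1) := Algebra.adjoin_le htw
    exact this hy
  rw [Subalgebra.mem_toSubmodule] at hx ⊢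
  induction hx using Algebra.adjoin_induction with
  | mem x h => exact hD x h
  | algebraMap r => rw [halg]; exact zero_mem _
  | add x y hx hy h1 h2 => rw [map_add]; exact add_mem h1 h2
  | mul x y hx hy h1 h2 =>
    rw [hmul]
    exact add_mem (mul_mem h1 hy) (mul_mem (htw' x hx) h2)

theorem extD_algebraMap (r : ℝ) : extD (algebraMap ℝ (LocalForm n p) r) = 0 := by
  simp [extD_apply, pd_algebraMap]

theorem smallGens_tw {A : Subalgebra ℝ (LocalForm n p)} (hA : smallGens n p ⊆ A) :
    ∀ x ∈ smallGens n p, tw 1 x ∈ A := by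
  rintro x ⟨a, l, hl, rfl | rfl⟩
  · rw [tw_form]
    exact A.smul_mem (hA ⟨a, l, hl, Or.inl rfl⟩) _
  · rw [tw_extD, tw_form, map_smul]
    exact neg_mem (A.smul_mem (hA ⟨a, l, hl, Or.inr rfl⟩) _)

theorem smallGens_extD {A : Subalgebra ℝ (LocalForm n p)} (hA : smallGens n p ⊆ A) :
    ∀ x ∈ smallGens n p, extD x ∈ A := by
  rintro x ⟨a, l, hl, rfl | rfl⟩
  · exact hA ⟨a, l, hl, Or.inr rfl⟩
  · rw [extD_extD]
    exact zero_mem _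

theorem smallGens_brst {A : Subalgebra ℝ (LocalForm n p)} (hA : smallGens n p ⊆ A) :
    ∀ x ∈ smallGens n p, brst x ∈ A := by
  have key : ∀ a l, ∀ hl : l ≤ p a, brst (form n a l hl) ∈ A ∧
      extD (brst (form n a l hl)) = 0 := by
    intro a l hl
    cases l with
    | zero =>
      rw [brst_form_zero, map_zero]
      exact ⟨zero_mem _, rfl⟩
    | succ l =>
      rw [eq_neg_of_add_eq_zero_left (brst_form_succ a l hl), map_neg, extD_extD, neg_zero]
      exact ⟨neg_mem (hA ⟨a, l, _, Or.inr rfl⟩), rfl⟩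
  rintro x ⟨a, l, hl, rfl | rfl⟩
  · exact (key a l hl).1
  · rw [eq_neg_of_add_eq_zero_left (brst_extD _), (key a l hl).2, neg_zero]
    exact zero_mem _

/-- The small algebra with `γ` and `d`. -/
noncomputable def small (n : ℕ) (p : ι → ℕ) : Bidiff ↥(Subalgebra.toSubmodule (smallAlg n p)) :=
  (localForms n p).restrict _
    (adjoin_stable (smallGens_tw Algebra.subset_adjoin) brst
      (smallGens_brst Algebra.subset_adjoin) brst_mul brst_algebraMap)
    (adjoin_stable (smallGens_tw Algebra.subset_adjoin) extD
      (smallGens_extD Algebra.subset_adjoin) extD_mul extD_algebraMap)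

/-- The small algebra with constant forms as coefficients, with `γ` and `d`. -/
noncomputable def smallConst (n : ℕ) (p : ι → ℕ) :
    Bidiff ↥(Subalgebra.toSubmodule (smallAlgConst n p)) :=
  (localForms n p).restrict _
    (adjoin_stable
      (by
        rintro x (hx | ⟨μ, rfl⟩)
        · exact smallGens_tw (Set.subset_union_left.trans Algebra.subset_adjoin) x hx
        · rw [tw_dx]
          exact neg_mem (Algebra.subset_adjoin (Or.inr ⟨μ, rfl⟩)))
      brst
      (by
        rintro x (hx | ⟨μ, rfl⟩)
        · exact smallGens_brst (Set.subset_union_left.trans Algebra.subset_adjoin) x hx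
        · rw [brst_dx]
          exact zero_mem _)
      brst_mul brst_algebraMap)
    (adjoin_stable
      (by
        rintro x (hx | ⟨μ, rfl⟩)
        · exact smallGens_tw (Set.subset_union_left.trans Algebra.subset_adjoin) x hx
        · rw [tw_dx]
          exact neg_mem (Algebra.subset_adjoin (Or.inr ⟨μ, rfl⟩)))
      extD
      (by
        rintro x (hx | ⟨μ, rfl⟩)
        · exact smallGens_extD (Set.subset_union_left.trans Algebra.subset_adjoin) x hx
        · rw [extD_apply]
          simp only [pd_dx, mul_zero, Finset.sum_const_zero]
          exact zero_mem _)
      extD_mul extD_algebraMap)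

/-- The local forms of form degree `k`. -/
def formsOfDegree (n : ℕ) (p : ι → ℕ) (k : ℕ) : Submodule ℝ (LocalForm n p) :=
  Submodule.span ℝ {x | ∃ L : List (Gen n p), (L.map Gen.formDeg).sum = k ∧ x = (L.map gen).prod}

/-! ### Lorentz invariance -/

/-- The Lorentz Lie algebra: the matrices `ω` with `ωᵀ η + η ω = 0` for the Minkowski metric
`η = diag(-1, 1, …, 1)`. -/
def lorentzAlg (n : ℕ) : Set (Matrix (Fin n) (Fin n) ℝ) :=
  {ω | ω.transpose * Matrix.diagonal (fun μ : Fin n => if (μ : ℕ) = 0 then (-1 : ℝ) else 1) +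
    Matrix.diagonal (fun μ : Fin n => if (μ : ℕ) = 0 then (-1 : ℝ) else 1) * ω = 0}

/-- Values of the infinitesimal linear transformation `ω` on the generators: `dx^μ` transforms as a
vector, `∂_α B_{μ_1 … μ_l}` transforms as a covariant tensor in all its indices. -/
noncomputable def rotGen (ω : Matrix (Fin n) (Fin n) ℝ) : Gen n p → LocalForm n p
  | .dx μ => ∑ ν, ω μ ν • dx n p ν
  | .fld a l hl μ α => -(∑ j, ∑ ν, ω ν (μ j) • fld a l hl (Function.update μ j ν) α) -
      (α.map fun ρ => ∑ ν, ω ν ρ • fld a l hl μ (ν ::ₘ α.erase ρ)).sum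

/-- The derivation of the algebra of local forms given by an infinitesimal linear
transformation `ω`. -/
noncomputable def rot (ω : Matrix (Fin n) (Fin n) ℝ) : LocalForm n p →ₗ[ℝ] LocalForm n p :=
  der 0 (rotGen ω)
    (fun x => by
      cases x with
      | dx μ => exact SC.sum _ fun ν _ => (SC.gen (Gen.dx ν)).smul _
      | fld a l hl μ α =>
        have h : ∀ μ' α', SC (p a - l + 0) (fld a l hl μ' α' : LocalForm n p) := fun μ' α' =>
          SC.gen (Gen.fld a l hl μ' α')
        rw [rotGen, sub_eq_add_neg]
        refine (SC.neg (SC.sum _ fun j _ => SC.sum _ fun ν _ => (h _ _).smul _)).add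
          (SC.neg (SC.msum _ fun x hx => ?_))
        obtain ⟨ρ, -, rfl⟩ := Multiset.mem_map.1 hx
        exact SC.sum _ fun ν _ => (h _ _).smul _)
    (fun a l hl μ α σ => by
      simp only [rotGen]
      rw [smul_sub, smul_neg]
      congr 2
      · rw [Finset.smul_sum]
        refine Fintype.sum_equiv σ _ _ fun j => ?_
        rw [Finset.smul_sum]
        refine Finset.sum_congr rfl fun ν _ => ?_
        have : Function.update (μ ∘ σ) j ν = Function.update μ (σ j) ν ∘ σ := by
          rw [Function.update_comp_equiv, Equiv.symm_apply_apply]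
        rw [this, fld_perm, smul_comm]
        rfl
      · rw [Multiset.smul_sum, Multiset.map_map]
        congr 1
        refine Multiset.map_congr rfl fun ρ _ => ?_
        rw [Function.comp_apply, Finset.smul_sum]
        refine Finset.sum_congr rfl fun ν _ => ?_
        rw [fld_perm, smul_comm])

variable (ω : Matrix (Fin n) (Fin n) ℝ)

theorem rot_mul (a b : LocalForm n p) : rot ω (a * b) = rot ω a * b + a * rot ω b := by
  have : rot ω (a * b) = rot ω a * b + tw 0 a * rot ω b := der_mul _ _ _ _ _ _
  rwa [tw_zero] at this

theorem rot_algebraMap (r : ℝ) : rot ω (algebraMap ℝ (LocalForm n p) r) = 0 :=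
  der_algebraMap _ _ _ _ _

theorem rot_dx (μ : Fin n) : rot ω (dx n p μ) = ∑ ν, ω μ ν • dx n p ν := der_gen _ _ _ _ _

theorem rot_fld (a : ι) (l : ℕ) (hl : l ≤ p a) (μ : Fin l → Fin n) (α : Multiset (Fin n)) :
    rot ω (fld a l hl μ α) =
      -(∑ j, ∑ ν, ω ν (μ j) • fld a l hl (Function.update μ j ν) α) -
      (α.map fun ρ => ∑ ν, ω ν ρ • fld a l hl μ (ν ::ₘ α.erase ρ)).sum := der_gen _ _ _ _ _

theorem rot_fld_cons (a : ι) (l : ℕ) (hl : l ≤ p a) (μ : Fin l → Fin n) (ρ : Fin n)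
    (α : Multiset (Fin n)) :
    rot ω (fld a l hl μ (ρ ::ₘ α)) =
      -(∑ j, ∑ ν, ω ν (μ j) • fld a l hl (Function.update μ j ν) (ρ ::ₘ α)) -
      (∑ ν, ω ν ρ • fld a l hl μ (ν ::ₘ α)) -
      (α.map fun τ => ∑ ν, ω ν τ • fld a l hl μ (ν ::ₘ ρ ::ₘ α.erase τ)).sum := by
  rw [rot_fld, Multiset.map_cons, Multiset.sum_cons, Multiset.erase_cons_head, ← sub_sub]
  congr 2
  refine Multiset.map_congr rfl fun τ hτ => ?_
  rw [Multiset.erase_cons_tail_of_mem hτ]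

theorem rot_pd (ν : Fin n) (a : LocalForm n p) :
    rot ω (pd ν a) = pd ν (rot ω a) - ∑ ρ, ω ρ ν • pd ρ a := by
  induction a using LocalForm.induction with
  | halg r => simp [pd_algebraMap, rot_algebraMap]
  | hgen x =>
    cases x with
    | dx μ =>
      rw [show gen (.dx μ) = dx n p μ from rfl, rot_dx]
      simp [pd_dx]
    | fld a l hl μ α =>
      rw [show gen (.fld a l hl μ α) = (fld a l hl μ α : LocalForm n p) from rfl, pd_fld,
        rot_fld_cons, rot_fld]
      have h : pd ν ((α.map fun ρ => ∑ κ, ω κ ρ • fld a l hl μ (κ ::ₘ α.erase ρ)).sum) =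
          (α.map fun τ => ∑ κ, ω κ τ •
            (fld a l hl μ (κ ::ₘ ν ::ₘ α.erase τ) : LocalForm n p)).sum := by
        rw [map_multiset_sum, Multiset.map_map]
        congr 1
        refine Multiset.map_congr rfl fun τ _ => ?_
        simp only [Function.comp_apply, map_sum, map_smul, pd_fld, Multiset.cons_swap ν]
      rw [map_sub, map_neg, h]
      simp only [map_sum, map_smul, pd_fld]
      abel
  | hmul x y hx hy =>
    simp only [pd_mul, rot_mul, map_add, hx, hy, smul_add, Finset.sum_add_distrib, sub_mul, mul_sub,
      Finset.sum_mul, Finset.mul_sum, smul_mul_assoc, mul_smul_comm]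
    abel
  | hadd x y hx hy =>
    simp only [map_add, hx, hy, smul_add, Finset.sum_add_distrib]
    abel

theorem rot_extD (a : LocalForm n p) : rot ω (extD a) = extD (rot ω a) := by
  rw [extD_apply, extD_apply, map_sum]
  simp only [rot_mul, rot_dx, rot_pd, mul_sub, Finset.sum_add_distrib, Finset.sum_sub_distrib]
  have : ∑ x, (∑ ν, ω x ν • dx n p ν) * pd x a = ∑ x, dx n p x * ∑ ρ, ω ρ x • pd ρ a := by
    simp only [Finset.sum_mul, Finset.mul_sum]
    rw [Finset.sum_comm]
    simp only [smul_mul_assoc, mul_smul_comm]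
  rw [this]
  abel

theorem rot_tw (a : LocalForm n p) : rot ω (tw 1 a) = tw 1 (rot ω a) := by
  induction a using LocalForm.induction with
  | halg r => simp [rot_algebraMap]
  | hgen x =>
    cases x with
    | dx μ =>
      rw [show gen (.dx μ) = dx n p μ from rfl, tw_dx, map_neg, rot_dx]
      simp [tw_dx]
    | fld a l hl μ α =>
      rw [show gen (.fld a l hl μ α) = (fld a l hl μ α : LocalForm n p) from rfl, tw_fld, map_smul,
        rot_fld]
      simp only [map_sub, map_neg, map_sum, map_smul, map_multiset_sum, Multiset.map_map,
        Function.comp_def, tw_fld, smul_sub, smul_neg, Finset.smul_sum, Multiset.smul_sum]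
      congr 2
      · refine Finset.sum_congr rfl fun j _ => Finset.sum_congr rfl fun ν _ => smul_comm _ _ _
      · congr 1
        funext τ
        exact Finset.sum_congr rfl fun ν _ => smul_comm _ _ _
  | hmul x y hx hy => simp only [rot_mul, map_mul, map_add, hx, hy]
  | hadd x y hx hy => simp [hx, hy]

theorem sum_multiset_comm {J K : Type*} (s : Multiset J) (t : Finset K)
    (f : K → J → LocalForm n p) :
    (s.map fun i => ∑ k ∈ t, f k i).sum = ∑ k ∈ t, (s.map (f k)).sum := by
  induction s using Multiset.induction with
  | empty => simp
  | cons i s ih => simp only [Multiset.map_cons, Multiset.sum_cons, ih, Finset.sum_add_distrib]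

theorem rot_brst_fld (a : ι) (l : ℕ) (hl : l ≤ p a) (μ : Fin l → Fin n) (α : Multiset (Fin n)) :
    rot ω (brst (fld a l hl μ α : LocalForm n p)) = brst (rot ω (fld a l hl μ α)) := by
  cases l with
  | zero =>
    rw [brst_fld_zero, map_zero, rot_fld]
    simp only [map_sub, map_neg, map_sum, map_smul, map_multiset_sum, Multiset.map_map,
      Function.comp_def, brst_fld_zero]
    simp
  | succ l =>
    rw [brst_fld_succ, map_smul, map_sum, rot_fld]
    simp only [map_smul, rot_fld_cons]
    simp only [map_sub, map_neg, map_sum, map_smul, map_multiset_sum, Multiset.map_map,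
      Function.comp_def, brst_fld_succ]
    set c : ℝ := (-1 : ℝ) ^ (p a - (l + 1)) / (l.factorial : ℝ)
    have e1 : ∑ j, ∑ ν, ω ν (μ j) • c • ∑ σ : Equiv.Perm (Fin (l + 1)), ((σ.sign : ℤ) : ℝ) •
        (fld a l (Nat.le_of_succ_le hl) (fun i => Function.update μ j ν (σ i.succ))
          (Function.update μ j ν (σ 0) ::ₘ α) : LocalForm n p) =
        c • ∑ σ : Equiv.Perm (Fin (l + 1)), ((σ.sign : ℤ) : ℝ) •
          ((∑ ν, ω ν (μ (σ 0)) • fld a l (Nat.le_of_succ_le hl) (fun i => μ (σ i.succ)) (ν ::ₘ α)) +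
          ∑ j : Fin l, ∑ ν, ω ν (μ (σ j.succ)) • fld a l (Nat.le_of_succ_le hl)
            (Function.update (fun i => μ (σ i.succ)) j ν) (μ (σ 0) ::ₘ α)) := by
      have e2 : ∀ σ : Equiv.Perm (Fin (l + 1)),
          ∑ j, ∑ ν, ω ν (μ j) • (fld a l (Nat.le_of_succ_le hl)
            (fun i => Function.update μ j ν (σ i.succ))
            (Function.update μ j ν (σ 0) ::ₘ α) : LocalForm n p) =
          (∑ ν, ω ν (μ (σ 0)) • fld a l (Nat.le_of_succ_le hl) (fun i => μ (σ i.succ)) (ν ::ₘ α)) +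
          ∑ j : Fin l, ∑ ν, ω ν (μ (σ j.succ)) • fld a l (Nat.le_of_succ_le hl)
            (Function.update (fun i => μ (σ i.succ)) j ν) (μ (σ 0) ::ₘ α) := by
        intro σ
        rw [← Equiv.sum_comp σ, Fin.sum_univ_succ]
        congr 1
        · refine Finset.sum_congr rfl fun ν _ => ?_
          simp
        · refine Finset.sum_congr rfl fun j _ => Finset.sum_congr rfl fun ν _ => ?_
          congr 2
          · funext i
            simp [Function.update_apply]
          · simp [(Fin.succ_ne_zero j).symm]
      simp only [← e2, Finset.smul_sum]
      conv_rhs => rw [Finset.sum_comm]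
      refine Finset.sum_congr rfl fun j _ => ?_
      conv_rhs => rw [Finset.sum_comm]
      refine Finset.sum_congr rfl fun ν _ => Finset.sum_congr rfl fun σ _ => ?_
      simp only [smul_smul]
      congr 1
      ring
    have e3 : (α.map fun ρ => ∑ ν, ω ν ρ • c • ∑ σ : Equiv.Perm (Fin (l + 1)),
        ((σ.sign : ℤ) : ℝ) • (fld a l (Nat.le_of_succ_le hl) (fun i => μ (σ i.succ))
          (μ (σ 0) ::ₘ ν ::ₘ α.erase ρ) : LocalForm n p)).sum =
        c • ∑ σ : Equiv.Perm (Fin (l + 1)), ((σ.sign : ℤ) : ℝ) •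
          (α.map fun τ => ∑ ν, ω ν τ • (fld a l (Nat.le_of_succ_le hl) (fun i => μ (σ i.succ))
            (ν ::ₘ μ (σ 0) ::ₘ α.erase τ) : LocalForm n p)).sum := by
      simp only [Finset.smul_sum, Multiset.smul_sum, Multiset.map_map, Function.comp_def]
      rw [← sum_multiset_comm]
      congr 1
      refine Multiset.map_congr rfl fun ρ _ => ?_
      rw [Finset.sum_comm]
      refine Finset.sum_congr rfl fun σ _ => Finset.sum_congr rfl fun ν _ => ?_
      rw [Multiset.cons_swap]
      simp only [smul_smul]
      congr 1
      ring
    rw [e1, e3]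
    simp only [smul_sub, smul_add, smul_neg, Finset.sum_add_distrib, Finset.sum_sub_distrib,
      Finset.sum_neg_distrib]
    abel

theorem rot_brst (a : LocalForm n p) : rot ω (brst a) = brst (rot ω a) := by
  induction a using LocalForm.induction with
  | halg r => simp [rot_algebraMap, brst_algebraMap]
  | hgen x =>
    cases x with
    | dx μ =>
      rw [show gen (.dx μ) = dx n p μ from rfl, brst_dx, rot_dx]
      simp [brst_dx]
    | fld a l hl μ α => exact rot_brst_fld ω a l hl μ α
  | hmul x y hx hy =>
    simp only [brst_mul, rot_mul, map_add, hx, hy, rot_tw]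
    abel
  | hadd x y hx hy => simp [hx, hy]

theorem rot_dxs {l : ℕ} (μ : Fin l → Fin n) :
    rot ω (dxs p μ) = ∑ j, ∑ ν, ω (μ j) ν • dxs p (Function.update μ j ν) := by
  induction l with
  | zero =>
    rw [dxs_zero, ← map_one (algebraMap ℝ (LocalForm n p)), rot_algebraMap]
    simp
  | succ l ih =>
    rw [dxs_succ, rot_mul, ih, rot_dx, Fin.sum_univ_succ, Finset.sum_mul, Finset.mul_sum]
    congr 1
    · refine Finset.sum_congr rfl fun ν _ => ?_
      rw [dxs_succ, smul_mul_assoc]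
      simp [Fin.succ_ne_zero]
    · refine Finset.sum_congr rfl fun j _ => ?_
      rw [Finset.mul_sum]
      refine Finset.sum_congr rfl fun ν _ => ?_
      rw [dxs_succ, mul_smul_comm]
      congr 2
      congr 1
      funext i
      simp [Function.update_apply]

/-- The exterior forms are invariant under all linear transformations. -/
theorem rot_form (a : ι) (l : ℕ) (hl : l ≤ p a) : rot ω (form n a l hl) = 0 := by
  have h : ∑ μ : Fin l → Fin n, rot ω (fld a l hl μ 0) * dxs p μ =
      -∑ μ : Fin l → Fin n, fld a l hl μ 0 * rot ω (dxs p μ) := by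
    simp only [rot_fld, rot_dxs, Multiset.map_zero, Multiset.sum_zero, sub_zero, neg_mul,
      Finset.sum_neg_distrib, neg_inj, Finset.sum_mul, Finset.mul_sum]
    rw [Finset.sum_comm]
    conv_rhs => rw [Finset.sum_comm]
    refine Finset.sum_congr rfl fun j _ => ?_
    rw [← Fintype.sum_prod_type', ← Fintype.sum_prod_type']
    let g : (Fin l → Fin n) × Fin n → (Fin l → Fin n) × Fin n :=
      fun q => (Function.update q.1 j q.2, q.1 j)
    have hg : Function.Involutive g := by
      rintro ⟨μ, ν⟩
      simp [g]
    refine Fintype.sum_equiv hg.toPerm _ _ ?_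
    rintro ⟨μ, ν⟩
    simp [g]
  rw [form, map_smul, map_sum]
  simp only [rot_mul, Finset.sum_add_distrib]
  rw [h, neg_add_cancel, smul_zero]

/-- The Lorentz invariant local forms. -/
noncomputable def lorentzForm (n : ℕ) (p : ι → ℕ) : Submodule ℝ (LocalForm n p) :=
  ⨅ ω ∈ lorentzAlg n, LinearMap.ker (rot ω)

theorem mem_lorentzForm {x : LocalForm n p} :
    x ∈ lorentzForm n p ↔ ∀ ω ∈ lorentzAlg n, rot ω x = 0 := by
  simp [lorentzForm]

/-- The Lorentz invariant local forms with `γ` and `d`. -/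
noncomputable def lorentz (n : ℕ) (p : ι → ℕ) : Bidiff ↥(lorentzForm n p) :=
  (localForms n p).restrict _
    (fun x hx => mem_lorentzForm.2 fun ω hω => by
      change rot ω (brst x) = 0
      rw [rot_brst, mem_lorentzForm.1 hx ω hω, map_zero])
    (fun x hx => mem_lorentzForm.2 fun ω hω => by
      change rot ω (extD x) = 0
      rw [rot_extD, mem_lorentzForm.1 hx ω hω, map_zero])

theorem small_le_lorentz (n : ℕ) (p : ι → ℕ) :
    Subalgebra.toSubmodule (smallAlg n p) ≤ lorentzForm n p := by
  intro x hx
  rw [mem_lorentzForm]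
  intro ω _
  rw [Subalgebra.mem_toSubmodule] at hx
  induction hx using Algebra.adjoin_induction with
  | mem x h =>
    obtain ⟨a, l, hl, rfl | rfl⟩ := h
    · exact rot_form ω a l hl
    · rw [rot_extD, rot_form, map_zero]
  | algebraMap r => exact rot_algebraMap ω r
  | add x y hx hy h1 h2 => rw [map_add, h1, h2, add_zero]
  | mul x y hx hy h1 h2 => rw [rot_mul, h1, h2, zero_mul, mul_zero, add_zero]

/-- The inclusion of the small algebra in the Lorentz invariant local forms. -/
noncomputable def smallIncl (n : ℕ) (p : ι → ℕ) :
    ↥(Subalgebra.toSubmodule (smallAlg n p)) →ₗ[ℝ] ↥(lorentzForm n p) :=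
  Submodule.inclusion (small_le_lorentz n p)

theorem smallIncl_isHom (n : ℕ) (p : ι → ℕ) :
    (small n p).IsHom (lorentz n p) (smallIncl n p) :=
  ⟨fun _ => rfl, fun _ => rfl⟩

/-- The inclusion of the small algebra with constant forms as coefficients in the local forms. -/
noncomputable def smallConstIncl (n : ℕ) (p : ι → ℕ) :
    ↥(Subalgebra.toSubmodule (smallAlgConst n p)) →ₗ[ℝ] LocalForm n p :=
  Submodule.subtype _

theorem smallConstIncl_isHom (n : ℕ) (p : ι → ℕ) :
    (smallConst n p).IsHom (localForms n p) (smallConstIncl n p) :=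
  ⟨fun _ => rfl, fun _ => rfl⟩

end PForm

/-!
The comparison of the small algebra with an algebra of local forms has an abstract and a concrete
part.

The abstract part concerns a map `f : V → W` between graded spaces with two anticommuting
differentials, `γ` of degree `0` and `d` of degree `1`. Classes of `E_r` are represented by bottoms
of descents of length `r`, and `E_{r+1}` is the cohomology of `d_r` in `E_r`; hence, once the map on
`E_1` is bijective in all degrees smaller than `n` and injective in all degrees, an induction on `r`
gives the same for all `E_r`: `d_r` moves a bottom of degree `k` to degree `k + r + 1`, and the
comparison of `E_{r+1}` needs the injectivity at the target of `d_r` and the surjectivity at its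
source, the degree of which is smaller than `n`. The splitting of a solution follows by
correcting the bottom of its descent by a small one, which shortens the descent. Here it matters
that every descent can be continued: if `y` has degree smaller than `n` and `d γ y = 0`, then
`γ y` is `d`-exact. The surjectivity on `E_1` is proved by induction on the degree `K`; the known
part in degrees smaller than `K` shows that those `γ`-closed elements of degree `K` which are
`d`-exact are small up to elements that vanish in `E_1` (`exists_d_sub_mem_B_one`). The outcome is
`Bidiff.comparison`, which asks for three facts: the continuation of descents, the injectivity on
`E_1` and the inductive step for the surjectivity on `E_1`.

These facts come from explicit homotopies.

* `d` is exact in form degree smaller than `n`, up to constant forms (`exists_eq_add_extD`). The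
  homotopy is built from the derivation that removes a partial derivative, and it needs no
  coordinates, so that it acts on Lorentz invariant elements.
* The cohomology of `γ` is carried by functions of `dx^μ`, of the undifferentiated ghosts of form
  degree zero and of the derivatives of the field strengths (`exists_eq_retr_add`). On the linear
  span of the generators belonging to `B^a`, `γ` is a Koszul differential; its contraction `kos`
  turns a derivative into an antisymmetric index, and the anticommutator `lap` of the two is a
  diagonalizable derivation, onto whose kernel the homomorphism `retr` projects.

Injectivity on `E_1` (`IsSmallPair.exists_eq_brst`): the image under `retr` of a small element
contains the gauge potentials with at most one derivative, whereas the image of `d u`, `γ u = 0`,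
contains in each term a field strength that is differentiated. Surjectivity on `E_1`
(`IsSmallPair.mem_smallClosed_of_mem_bottoms`): consider a `γ`-closed element `x` such that `d x` is
`γ`-exact. Undifferentiated ghosts of form degree zero are removed by differentiating with respect to
them and multiplying by them, both of which preserve this property since the differential of such a
ghost is `γ`-exact. If there are none, then `x` is, up to a `γ`-exact term, a function of the field
strengths, so that `d x` is a `γ`-exact function of the field strengths and vanishes; hence `x` is a
constant form plus a `d`-exact form, which is the case covered by the induction on the degree.
Constant forms are small: without Lorentz invariance because the `dx^μ` belong to the small algebra,
and with Lorentz invariance because there are none in form degrees `0 < k < n`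
(`eq_zero_of_lorentz_const`).
-/

namespace PForm

/-! ### Comparison of the spaces `E_r` of two graded pairs of differentials -/

namespace Bidiff

variable {V W : Type*} [AddCommGroup V] [Module ℝ V] [AddCommGroup W] [Module ℝ W]

/-- `π k` are the projections onto the components of degree `k` of a grading of `V` by the degrees
`0, …, n`, such that `γ` preserves the degree and `d` raises it by one. -/
structure Grading (D : Bidiff V) (n : ℕ) (π : ℕ → V →ₗ[ℝ] V) : Prop where
  proj : ∀ j k x, π j (π k x) = if j = k then π k x else 0
  map_γ : ∀ k x, π k (D.γ x) = D.γ (π k x)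
  map_d : ∀ k x, π (k + 1) (D.d x) = D.d (π k x)
  map_d_zero : ∀ x, π 0 (D.d x) = 0
  sum : ∀ x, ∑ k ∈ Finset.range (n + 1), π k x = x

namespace Grading

variable {D : Bidiff V} {n : ℕ} {π : ℕ → V →ₗ[ℝ] V} (G : D.Grading n π)

include G in
theorem proj_self (k : ℕ) (x : V) : π k (π k x) = π k x := by simp [G.proj]

include G in
theorem eq_zero_of_lt {k : ℕ} (hk : n < k) (x : V) : π k x = 0 := by
  rw [← G.sum (π k x)]
  refine Finset.sum_eq_zero fun j hj => ?_
  rw [G.proj, if_neg]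
  have := Finset.mem_range.1 hj
  omega

include G in
theorem d_top (x : V) : D.d (π n x) = 0 := by
  rw [← G.map_d, G.eq_zero_of_lt (Nat.lt_succ_self n)]

include G in
/-- The component of degree `k` of a lift is a lift of a component of the bottom, or of `0`. -/
theorem lift_proj {r : ℕ} {X u : V} (h : (X, u) ∈ D.lift r) (k : ℕ) :
    ((if r ≤ k then π (k - r) X else 0), π k u) ∈ D.lift r := by
  obtain ⟨c, h0, h1, h2, h3⟩ := D.mem_lift.1 h
  refine D.mem_lift.2 ⟨fun i => if r ≤ k + i then π (k + i - r) (c i) else 0, by simp [h0],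
    by simp [h1], ?_, ?_⟩
  · split_ifs
    · rw [← G.map_γ, h2, map_zero]
    · simp
  · intro i hi
    rcases lt_trichotomy r (k + i + 1) with hlt | heq | hgt
    · have e := congrArg (π (k + i - r + 1)) (h3 i hi)
      rw [map_add, G.map_d, G.map_γ, map_zero] at e
      simpa [show r ≤ k + i by omega, show r ≤ k + (i + 1) by omega,
        show k + (i + 1) - r = k + i - r + 1 by omega] using e
    · have e := congrArg (π 0) (h3 i hi)
      rw [map_add, G.map_d_zero, G.map_γ, map_zero, zero_add] at e
      simpa [show ¬ r ≤ k + i by omega, show r ≤ k + (i + 1) by omega,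
        show k + (i + 1) - r = 0 by omega] using e
    · simp [show ¬ r ≤ k + i by omega, show ¬ r ≤ k + (i + 1) by omega]

include G in
theorem proj_mem_Z {r : ℕ} {X : V} (h : X ∈ D.Z r) (k : ℕ) : π k X ∈ D.Z r := by
  obtain ⟨u, hu⟩ := D.mem_Z_iff.1 h
  have := G.lift_proj hu (k + r)
  exact D.mem_Z_iff.2 ⟨π (k + r) u, by simpa using this⟩

include G in
theorem proj_mem_B {r : ℕ} {Y : V} (h : Y ∈ D.B r) (k : ℕ) : π k Y ∈ D.B r := by
  induction r generalizing Y k with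
  | zero =>
    obtain ⟨a, rfl⟩ := h
    exact ⟨π k a, (G.map_γ k a).symm⟩
  | succ r ih =>
    obtain ⟨X, u, hu, hB⟩ := D.mem_B_succ.1 h
    have e := ih hB k
    cases k with
    | zero =>
      rw [map_sub, G.map_d_zero, sub_zero] at e
      exact D.B_mono (Nat.le_succ r) e
    | succ k =>
      rw [map_sub, G.map_d] at e
      exact D.mem_B_succ.2 ⟨_, _, G.lift_proj hu k, e⟩

include G in
/-- The component of top degree of the bottom of a lift does not matter. -/
theorem lift_sub_top {r : ℕ} (hr : 1 ≤ r) {X u : V} (h : (X, u) ∈ D.lift r) :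
    (X - π n X, u) ∈ D.lift r := by
  obtain ⟨c, h0, h1, h2, h3⟩ := D.mem_lift.1 h
  refine D.mem_lift.2 ⟨fun i => if i = 0 then X - π n X else c i, by simp, ?_, ?_, ?_⟩
  · simp [h1, show r ≠ 0 by omega]
  · rw [map_sub, ← G.map_γ, h2, map_zero, sub_zero]
  · intro i hi
    rcases Nat.eq_zero_or_pos i with rfl | hi0
    · have e := h3 0 hi
      rw [h0] at e
      simpa [G.d_top] using e
    · simpa [hi0.ne'] using h3 i hi

include G in
theorem sub_top (X : V) : X - π n X = ∑ k ∈ Finset.range n, π k X := by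
  rw [sub_eq_iff_eq_add, ← Finset.sum_range_succ, G.sum]

end Grading

/-- In degree `k`, every class of `E'_r` is the image of a class of `E_r` of degree `k`. -/
def SurjAt (D : Bidiff V) (D' : Bidiff W) (f : V →ₗ[ℝ] W) (π : ℕ → V →ₗ[ℝ] V)
    (π' : ℕ → W →ₗ[ℝ] W) (r k : ℕ) : Prop :=
  ∀ X ∈ D'.Z r, π' k X = X → ∃ Y ∈ D.Z r, π k Y = Y ∧ X - f Y ∈ D'.B r

/-- In degree `k`, the map from `E_r` to `E'_r` is injective. -/
def InjAt (D : Bidiff V) (D' : Bidiff W) (f : V →ₗ[ℝ] W) (π : ℕ → V →ₗ[ℝ] V) (r k : ℕ) : Prop :=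
  ∀ x, π k x = x → f x ∈ D'.B r → x ∈ D.B r

section Comparison

variable {D : Bidiff V} {D' : Bidiff W} {f : V →ₗ[ℝ] W} (hf : D.IsHom D' f) {n : ℕ}
  {π : ℕ → V →ₗ[ℝ] V} {π' : ℕ → W →ₗ[ℝ] W} (G : D.Grading n π) (G' : D'.Grading n π')

include hf G in
/-- An element of `E'_{r+1}` is a class of `E'_r` in the kernel of `d_r`; whether its preimage in
`E_r` is in the kernel as well is decided by the injectivity at the target of `d_r`. -/
theorem SurjAt.succ {r k : ℕ} (hA : SurjAt D D' f π π' r k) (hB : InjAt D D' f π r (k + r + 1)) :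
    SurjAt D D' f π π' (r + 1) k := by
  intro X hX hk
  obtain ⟨hX, u, hu, hdu⟩ := D'.mem_Z_succ.1 hX
  obtain ⟨Y, hY, hYk, hXY⟩ := hA X hX hk
  obtain ⟨v, hv⟩ := D.mem_Z_iff.1 hY
  have hv' := G.lift_proj hv (k + r)
  rw [if_pos (Nat.le_add_left r k), Nat.add_sub_cancel, hYk] at hv'
  refine ⟨Y, D.mem_Z_succ.2 ⟨hY, _, hv', hB _ ?_ ?_⟩, hYk, D'.B_mono (Nat.le_succ r) hXY⟩
  · rw [G.map_d, G.proj_self]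
  · have := D'.d_lift_mem_B_of_mem_B ((D'.lift r).sub_mem hu (hf.lift hv')) hXY
    rw [map_sub, ← hf.2] at this
    simpa using (D'.B r).sub_mem hdu this

include hf G G' in
/-- An element of `E_r` that becomes a value of `d_r` in `E'_r` is a value of `d_r` if the comparison
is surjective at the source of `d_r`. -/
theorem InjAt.succ {r k : ℕ} (hff : ∀ k x, π' k (f x) = f (π k x)) (hB : InjAt D D' f π r k)
    (hA : ∀ j, j + r + 1 = k → SurjAt D D' f π π' r j) :
    InjAt D D' f π (r + 1) k := by
  intro x hx hfx
  obtain ⟨X, u, hu, hy⟩ := D'.mem_B_succ.1 hfx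
  have hy' := G'.proj_mem_B hy k
  rw [map_sub, hff, hx] at hy'
  cases k with
  | zero =>
    rw [G'.map_d_zero, sub_zero] at hy'
    exact D.B_mono (Nat.le_succ r) (hB x hx hy')
  | succ k =>
    rw [G'.map_d] at hy'
    have hu' := G'.lift_proj hu k
    split_ifs at hu' with hrk
    · obtain ⟨Y, hY, hYk, hXY⟩ := hA (k - r) (by omega) _ (D'.mem_Z_iff.2 ⟨_, hu'⟩)
        (G'.proj_self _ _)
      obtain ⟨v, hv⟩ := D.mem_Z_iff.1 hY
      have hv' := G.lift_proj hv k
      rw [if_pos hrk, hYk] at hv'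
      have h1 := D'.d_lift_mem_B_of_mem_B ((D'.lift r).sub_mem hu' (hf.lift hv')) hXY
      refine D.mem_B_succ.2 ⟨Y, _, hv', hB _ ?_ ?_⟩
      · rw [map_sub, G.map_d, G.proj_self, hx]
      · rw [map_sub, hf.2]
        have := (D'.B r).add_mem hy' h1
        rw [map_sub] at this
        simpa using this
    · have h1 := D'.d_lift_mem_B_of_mem_B hu' (D'.B r).zero_mem
      refine D.B_mono (Nat.le_succ r) (hB x hx ?_)
      simpa using (D'.B r).add_mem hy' h1

include hf G G' in
theorem surjAt_and_injAt (hff : ∀ k x, π' k (f x) = f (π k x))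
    (hA : ∀ j < n, SurjAt D D' f π π' 1 j) (hB : ∀ k, InjAt D D' f π 1 k) {r : ℕ} (hr : 1 ≤ r) :
    (∀ j < n, SurjAt D D' f π π' r j) ∧ ∀ k, InjAt D D' f π r k := by
  induction r, hr using Nat.le_induction with
  | base => exact ⟨hA, hB⟩
  | succ r hr ih =>
    refine ⟨fun j hj => (ih.1 j hj).succ hf G (ih.2 _), fun k => ?_⟩
    rcases le_or_gt k n with hk | hk
    · exact (ih.2 k).succ hf G G' hff fun j hj => ih.1 j (by omega)
    · intro x hx _
      rw [← hx, G.eq_zero_of_lt hk]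
      exact zero_mem _

include hf G G' in
/-- If the comparison of `E_1` is known to be surjective in degrees smaller than `K`, then the
spaces `E_r` agree in the range of degrees from which `d_r` ends in degree at most `K + 1`. -/
theorem surjAt_and_injAt_of_lt (hff : ∀ k x, π' k (f x) = f (π k x)) {K : ℕ}
    (hA : ∀ j < K, SurjAt D D' f π π' 1 j) (hB : ∀ k, InjAt D D' f π 1 k) {r : ℕ} (hr : 1 ≤ r) :
    (∀ j, j + r ≤ K → SurjAt D D' f π π' r j) ∧ ∀ k ≤ K, InjAt D D' f π r k := by
  induction r, hr using Nat.le_induction with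
  | base => exact ⟨fun j hj => hA j hj, fun k _ => hB k⟩
  | succ r hr ih =>
    exact ⟨fun j hj => (ih.1 j (by omega)).succ hf G (ih.2 _ (by omega)), fun k hk =>
      (ih.2 k hk).succ hf G G' hff fun j hj => ih.1 j (by omega)⟩

include G' in
/-- The descent: if closed elements of the form `γ y` are `d`-exact, then every `y` with
`d γ y = 0` is a lift of a `γ`-closed element. -/
theorem exists_lift_of_d_γ (hP : ∀ k < n, ∀ y, π' k y = y → D'.d (D'.γ y) = 0 →
      ∃ z, D'.γ y = D'.d z) {k : ℕ} (hk : k < n) {y : W} (hy : π' k y = y)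
    (hdy : D'.d (D'.γ y) = 0) : ∃ r X, (X, y) ∈ D'.lift r := by
  induction k generalizing y with
  | zero =>
    obtain ⟨z, hz⟩ := hP 0 hk y hy hdy
    refine ⟨0, y, D'.lift_zero.2 ⟨rfl, ?_⟩⟩
    rw [← hy, ← G'.map_γ, hz, G'.map_d_zero]
  | succ k ih =>
    obtain ⟨z, hz⟩ := hP _ hk y hy hdy
    have hz' : D'.γ y = D'.d (π' k z) := by
      rw [← G'.map_d, ← hz, G'.map_γ, hy]
    obtain ⟨r, X, h⟩ := ih (y := -π' k z) (by omega) (by rw [map_neg, G'.proj_self])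
      (by rw [D'.d_γ', map_neg, ← hz', map_neg, D'.γ_γ, neg_zero, neg_zero])
    exact ⟨r + 1, X, D'.lift_succ.2 ⟨_, h, by rw [map_neg, ← hz', neg_add_cancel]⟩⟩

include hf G G' in
/-- Elements that represent `0` in some `E'_r` represent, up to the image of `f`, already `0` in
`E'_1`. -/
theorem exists_sub_mem_B_one (hff : ∀ k x, π' k (f x) = f (π k x)) {K : ℕ}
    (hA : ∀ j < K, SurjAt D D' f π π' 1 j) (hB : ∀ k, InjAt D D' f π 1 k) {r : ℕ} {Y : W}
    (hY : Y ∈ D'.B (r + 1)) (hK : π' K Y = Y) : ∃ s, D.γ s = 0 ∧ Y - f s ∈ D'.B 1 := by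
  induction r generalizing Y with
  | zero => exact ⟨0, map_zero _, by simpa using hY⟩
  | succ r ih =>
    obtain ⟨X, u, hu, hy⟩ := D'.mem_B_succ.1 hY
    have hy' := G'.proj_mem_B hy K
    rw [map_sub, hK] at hy'
    cases K with
    | zero =>
      rw [G'.map_d_zero, sub_zero] at hy'
      exact ih hy' hK
    | succ K =>
      rw [G'.map_d] at hy'
      have hu' := G'.lift_proj hu K
      split_ifs at hu' with hrk
      · obtain ⟨Z, hZ, hZk, hXZ⟩ := (surjAt_and_injAt_of_lt hf G G' hff hA hB
          (Nat.le_add_left 1 r)).1 (K - (r + 1)) (by omega) _ (D'.mem_Z_iff.2 ⟨_, hu'⟩)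
          (G'.proj_self _ _)
        obtain ⟨v, hv⟩ := D.mem_Z_iff.1 hZ
        have hv' := G.lift_proj hv K
        rw [if_pos hrk, hZk] at hv'
        have h1 := D'.d_lift_mem_B_of_mem_B ((D'.lift _).sub_mem hu' (hf.lift hv')) hXZ
        obtain ⟨s, hs, hs'⟩ := ih (Y := Y - f (D.d (π K v))) (by
          have := (D'.B _).add_mem hy' h1
          rw [map_sub] at this
          rw [hf.2]
          simpa using this) (by rw [map_sub, hK, hff, G.map_d, G.proj_self])
        refine ⟨D.d (π K v) + s, ?_, ?_⟩
        · rw [map_add, hs, D.γ_d_of_lift hv', add_zero]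
        · rwa [map_add, ← sub_sub]
      · have h1 := D'.d_lift_mem_B_of_mem_B hu' (D'.B (r + 1)).zero_mem
        refine ih ?_ hK
        simpa using (D'.B (r + 1)).add_mem hy' h1

include hf G G' in
/-- The exact elements in the lowest degree in which the comparison of `E_1` is not yet known to be
surjective. -/
theorem exists_d_sub_mem_B_one (hff : ∀ k x, π' k (f x) = f (π k x))
    (hP : ∀ k < n, ∀ y, π' k y = y → D'.d (D'.γ y) = 0 → ∃ z, D'.γ y = D'.d z) {K : ℕ}
    (hKn : K ≤ n) (hA : ∀ j < K, SurjAt D D' f π π' 1 j) (hB : ∀ k, InjAt D D' f π 1 k) {β : W}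
    (hβ : D'.d (D'.γ β) = 0) : ∃ s, D.γ s = 0 ∧ π' K (D'.d β) - f s ∈ D'.B 1 := by
  cases K with
  | zero => exact ⟨0, map_zero _, by simp [G'.map_d_zero]⟩
  | succ K =>
    obtain ⟨r, X, h⟩ := exists_lift_of_d_γ G' hP hKn (G'.proj_self K β)
      (by rw [← G'.map_γ, ← G'.map_d, hβ, map_zero])
    refine exists_sub_mem_B_one hf G G' hff hA hB (r := r) ?_ (G'.proj_self _ _)
    rw [G'.map_d]
    exact D'.d_lift_mem_B h

/-- The elements that are the sum of a solution in the image of `f`, of an element that descends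
trivially and of a trivial solution. -/
def Splits (D : Bidiff V) (D' : Bidiff W) (f : V →ₗ[ℝ] W) (a : W) : Prop :=
  ∃ s, D.IsWZ s ∧ ∃ t, D'.DescendsTrivially t ∧ D'.IsTrivial (a - (f s + t))

theorem Splits.add {a b : W} (ha : Splits D D' f a) (hb : Splits D D' f b) :
    Splits D D' f (a + b) := by
  obtain ⟨s, ⟨x, hx⟩, t, ⟨t', ht', m, k, hm⟩, m', k', hm'⟩ := ha
  obtain ⟨s₁, ⟨x₁, hx₁⟩, t₁, ⟨t₁', ht₁', m₁, k₁, hm₁⟩, m₁', k₁', hm₁'⟩ := hb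
  refine ⟨s + s₁, ⟨x + x₁, ?_⟩, t + t₁, ⟨t' + t₁', ?_, m + m₁, k + k₁, ?_⟩, m' + m₁', k' + k₁', ?_⟩
  · rw [map_add, map_add, add_add_add_comm, hx, hx₁, add_zero]
  · rw [map_add, ht', ht₁', add_zero]
  · rw [add_sub_add_comm, hm, hm₁, map_add, map_add]
    abel
  · rw [map_add, map_add, map_add,
      show a + b - (f s + f s₁ + (t + t₁)) = a - (f s + t) + (b - (f s₁ + t₁)) by abel, hm', hm₁']
    abel

theorem Splits.of_γ_eq_zero {a : W} (ha : D'.γ a = 0) : Splits D D' f a :=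
  ⟨0, ⟨0, by simp⟩, a, ⟨a, ha, 0, 0, by simp⟩, 0, 0, by simp⟩

theorem Splits.of_sub {a : W} {s : V} (hs : D.IsWZ s) {m k : W}
    (h : Splits D D' f (a - f s - (D'.γ m + D'.d k))) : Splits D D' f a := by
  obtain ⟨s', ⟨x, hx⟩, t, ht, m', k', h'⟩ := h
  obtain ⟨y, hy⟩ := hs
  refine ⟨s + s', ⟨y + x, ?_⟩, t, ht, m + m', k + k', ?_⟩
  · rw [map_add, map_add, add_add_add_comm, hy, hx, add_zero]
  · rw [map_add, map_add, map_add, show a - (f s + f s' + t) =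
      a - f s - (D'.γ m + D'.d k) - (f s' + t) + (D'.γ m + D'.d k) by abel, h']
    abel

include hf G' in
/-- A lift can be corrected by a lift in the image of `f`, such that the remainder is a shorter
lift up to a trivial solution. -/
theorem Splits.of_lift (hA : ∀ r, 1 ≤ r → ∀ j < n, SurjAt D D' f π π' r j) {r : ℕ} {X a : W}
    (h : (X, a) ∈ D'.lift r) : Splits D D' f a := by
  induction r generalizing X a with
  | zero =>
    obtain ⟨rfl, h⟩ := D'.lift_zero.1 h
    exact .of_γ_eq_zero h
  | succ r ih =>
    have hY : ∃ Y ∈ D.Z (r + 1), (X - π' n X) - f Y ∈ D'.B (r + 1) := by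
      have hX := D'.mem_Z_iff.2 ⟨a, h⟩
      have : ∀ j ∈ Finset.range n, ∃ Y ∈ D.Z (r + 1), π' j X - f Y ∈ D'.B (r + 1) := by
        intro j hj
        obtain ⟨Y, hY, -, h⟩ := hA (r + 1) (by omega) j (Finset.mem_range.1 hj) _
          (G'.proj_mem_Z hX j) (G'.proj_self j X)
        exact ⟨Y, hY, h⟩
      choose! Y hY1 hY2 using this
      refine ⟨∑ j ∈ Finset.range n, Y j, Submodule.sum_mem _ hY1, ?_⟩
      rw [G'.sub_top, map_sum, ← Finset.sum_sub_distrib]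
      exact Submodule.sum_mem _ hY2
    obtain ⟨Y, hY, hXY⟩ := hY
    obtain ⟨v, hv⟩ := D.mem_Z_iff.1 hY
    have hl := (D'.lift _).sub_mem (G'.lift_sub_top (by omega) h) (hf.lift hv)
    obtain ⟨-, m, w, e⟩ := D'.exists_of_mem_B hXY
    have hv' : D.IsWZ v := by
      obtain ⟨u, -, hu⟩ := D.lift_succ.1 hv
      exact ⟨u, by rw [add_comm, hu]⟩
    obtain ⟨c, h0, h1, h2, h3⟩ := D'.mem_lift.1 hl
    have hc1 : D'.γ (c 1 - D'.d m) = 0 := by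
      have e1 := h3 0 (by omega)
      rw [h0] at e1
      simp only at e1
      rw [e, map_add, D'.d_d, add_zero, zero_add, D'.d_γ', add_comm, ← sub_eq_add_neg] at e1
      rw [map_sub, e1]
    simp only at h1
    -- shifting the chain by one step leaves a lift of length `r`
    have key : (c 1 - D'.d m, a - f v - if r = 0 then D'.d m else 0) ∈ D'.lift r := by
      refine D'.mem_lift.2 ⟨fun j => c (j + 1) - if j = 0 then D'.d m else 0, by simp, ?_, hc1, ?_⟩
      · simp only [h1]
      · intro i hi
        have e2 := h3 (i + 1) (by omega)
        rcases Nat.eq_zero_or_pos i with rfl | hi0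
        · simpa [D'.d_d] using e2
        · simpa [hi0.ne'] using e2
    refine Splits.of_sub hv' (m := 0) (k := if r = 0 then m else 0) ?_
    have := ih key
    split_ifs at this ⊢ <;> simpa using this

include hf G' in
/-- Every solution of the Wess-Zumino condition is, up to trivially descending and trivial
solutions, the image of a solution. -/
theorem IsWZ.splits (hA : ∀ r, 1 ≤ r → ∀ j < n, SurjAt D D' f π π' r j)
    (hP : ∀ k < n, ∀ y, π' k y = y → D'.d (D'.γ y) = 0 → ∃ z, D'.γ y = D'.d z) {a : W}
    (ha : D'.IsWZ a) : Splits D D' f a := by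
  obtain ⟨b, hb⟩ := ha
  have key : ∀ k ∈ Finset.range (n + 1), Splits D D' f (π' k a) := by
    intro k hk
    have hk := Finset.mem_range.1 hk
    have e := congrArg (π' k) hb
    cases k with
    | zero =>
      rw [map_add, G'.map_γ, G'.map_d_zero, map_zero, add_zero] at e
      exact .of_γ_eq_zero e
    | succ k =>
      rw [map_add, G'.map_γ, G'.map_d, map_zero, add_comm] at e
      obtain ⟨r, X, h⟩ := exists_lift_of_d_γ G' hP (k := k) (by omega) (G'.proj_self k b) (by
        rw [D'.d_γ', eq_neg_of_add_eq_zero_left e, map_neg, D'.γ_γ, neg_zero, neg_zero])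
      exact .of_lift hf G' hA (D'.lift_succ.2 ⟨_, h, e⟩)
  rw [← G'.sum a]
  generalize Finset.range (n + 1) = t at key
  classical
  induction t using Finset.induction_on with
  | empty => exact .of_γ_eq_zero (by simp)
  | insert j t hj ih =>
    rw [Finset.sum_insert hj]
    exact (key j (by simp)).add (ih fun k hk => key k (by simp [hk]))

theorem mapE_cls (hf : D.IsHom D' f) (r : ℕ) (x : V) (hx : x ∈ D.Z r) :
    mapE hf r (D.cls r ⟨x, hx⟩) = D'.cls r ⟨f x, hf.mem_Z hx⟩ := rfl

/-- The maps induced on the spaces `E_r` commute with the differentials `d_r`. -/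
theorem mapE_dE (hf : D.IsHom D' f) (r : ℕ) (x : D.E r) :
    mapE hf r (D.dE r x) = D'.dE r (mapE hf r x) := by
  obtain ⟨⟨X, hX⟩, rfl⟩ := D.cls_surjective r x
  obtain ⟨u, hu⟩ := D.mem_Z_iff.1 hX
  rw [D.dE_cls hu, mapE_cls, mapE_cls, D'.dE_cls (hf.lift hu)]
  congr 2
  exact hf.2 u

include G in
theorem mapE_injective (hf : D.IsHom D' f) (G' : D'.Grading n π')
    (hff : ∀ k x, π' k (f x) = f (π k x)) {r : ℕ} (hB : ∀ k, InjAt D D' f π r k) :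
    Function.Injective (mapE hf r) := by
  refine (injective_iff_map_eq_zero _).2 fun x hx => ?_
  obtain ⟨⟨X, hX⟩, rfl⟩ := D.cls_surjective r x
  rw [mapE_cls, cls_eq_zero] at hx
  rw [cls_eq_zero]
  change f X ∈ D'.B r at hx
  change X ∈ D.B r
  rw [← G.sum X]
  refine Submodule.sum_mem _ fun k _ => hB k _ (G.proj_self k X) ?_
  rw [← hff]
  exact G'.proj_mem_B hx k

theorem mapE_bijOn (hf : D.IsHom D' f) {r k : ℕ} (hinj : Function.Injective (mapE hf r))
    (hA : SurjAt D D' f π π' r k) {F : Submodule ℝ V} {F' : Submodule ℝ W}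
    (hF : ∀ x, x ∈ F ↔ π k x = x) (hF' : ∀ x, x ∈ F' ↔ π' k x = x)
    (hff : ∀ k x, π' k (f x) = f (π k x)) :
    Set.BijOn (mapE hf r) (D.classesIn F r) (D'.classesIn F' r) := by
  refine ⟨?_, hinj.injOn, ?_⟩
  · rintro _ ⟨⟨x, hx⟩, hxF, rfl⟩
    refine ⟨⟨f x, hf.mem_Z hx⟩, (hF' _).2 ?_, rfl⟩
    have : π k x = x := (hF _).1 hxF
    change π' k (f x) = f x
    rw [hff, this]
  · rintro _ ⟨⟨X, hX⟩, hXF, rfl⟩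
    obtain ⟨Y, hY, hYk, hXY⟩ := hA X hX ((hF' _).1 hXF)
    refine ⟨_, ⟨⟨Y, hY⟩, (hF _).2 hYk, rfl⟩, ?_⟩
    rw [mapE_cls, ← sub_eq_zero, ← map_sub, cls_eq_zero]
    simpa using (D'.B r).neg_mem hXY

include hf G G' in
/-- The comparison of the spaces `E_1`, reduced to elements of one degree `K`, of which the
`d`-exact ones may be taken to be known. -/
theorem surjAt_one (hff : ∀ k x, π' k (f x) = f (π k x))
    (hP : ∀ k < n, ∀ y, π' k y = y → D'.d (D'.γ y) = 0 → ∃ z, D'.γ y = D'.d z)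
    (hB : ∀ x, f x ∈ D'.B 1 → x ∈ LinearMap.range D.γ)
    (hA : ∀ K < n,
      (∀ β, D'.d (D'.γ β) = 0 → ∃ s, D.γ s = 0 ∧ π' K (D'.d β) - f s ∈ D'.B 1) →
      ∀ α, π' K α = α → D'.γ α = 0 → D'.d α ∈ LinearMap.range D'.γ →
        ∃ s, D.γ s = 0 ∧ α - f s ∈ D'.B 1) :
    ∀ K < n, SurjAt D D' f π π' 1 K := by
  intro K
  induction K using Nat.strong_induction_on with
  | _ K ih =>
    intro hK X hX hXK
    obtain ⟨hX0, u, hu, hdu⟩ := D'.mem_Z_succ.1 hX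
    obtain ⟨rfl, -⟩ := D'.lift_zero.1 hu
    obtain ⟨s, hs, h⟩ := hA K hK (fun β hβ => exists_d_sub_mem_B_one hf G G' hff hP hK.le
      (fun j hj => ih j hj (by omega)) (fun k x _ hx => D.B_mono (Nat.zero_le 1) (hB x hx)) hβ)
      _ hXK hX0 hdu
    have hs' : D.γ (π K s) = 0 := by rw [← G.map_γ, hs, map_zero]
    refine ⟨π K s, D.mem_Z_succ.2 ⟨hs', π K s, D.lift_zero.2 ⟨rfl, hs'⟩, hB _ ?_⟩,
      G.proj_self K s, ?_⟩
    · rw [hf.2]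
      exact D'.d_lift_mem_B (D'.lift_zero.2 ⟨rfl, by rw [← hf.1, hs', map_zero]⟩)
    · rw [← hff, ← hXK, ← map_sub]
      exact G'.proj_mem_B h K

include hf G G' in
/-- The comparison theorem. Its hypotheses `hP`, `hB` and `hA` are the continuation of descents, the
injectivity on `E_1` and the inductive step for the surjectivity on `E_1`. -/
theorem comparison (hff : ∀ k x, π' k (f x) = f (π k x))
    (hP : ∀ k < n, ∀ y, π' k y = y → D'.d (D'.γ y) = 0 → ∃ z, D'.γ y = D'.d z)
    (hB : ∀ x, f x ∈ D'.B 1 → x ∈ LinearMap.range D.γ)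
    (hA : ∀ K < n,
      (∀ β, D'.d (D'.γ β) = 0 → ∃ s, D.γ s = 0 ∧ π' K (D'.d β) - f s ∈ D'.B 1) →
      ∀ α, π' K α = α → D'.γ α = 0 → D'.d α ∈ LinearMap.range D'.γ →
        ∃ s, D.γ s = 0 ∧ α - f s ∈ D'.B 1)
    {F : ℕ → Submodule ℝ V} {F' : ℕ → Submodule ℝ W}
    (hF : ∀ k x, x ∈ F k ↔ π k x = x) (hF' : ∀ k x, x ∈ F' k ↔ π' k x = x) :
    (∀ a, D'.IsWZ a → ∃ s, D.IsWZ s ∧ ∃ t, D'.DescendsTrivially t ∧ D'.IsTrivial (a - (f s + t))) ∧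
      ∀ r, 1 ≤ r → (∀ x, mapE hf r (D.dE r x) = D'.dE r (mapE hf r x)) ∧
        Function.Injective (mapE hf r) ∧
        ∀ k < n, Set.BijOn (mapE hf r) (D.classesIn (F k) r) (D'.classesIn (F' k) r) := by
  have h1 := surjAt_one hf G G' hff hP hB hA
  have h2 : ∀ r, 1 ≤ r → (∀ j < n, SurjAt D D' f π π' r j) ∧ ∀ k, InjAt D D' f π r k := fun r hr =>
    surjAt_and_injAt hf G G' hff h1 (fun k x _ hx => D.B_mono (Nat.zero_le 1) (hB x hx)) hr
  refine ⟨fun a ha => ha.splits hf G' (fun r hr => (h2 r hr).1) hP, fun r hr => ?_⟩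
  have hinj := mapE_injective G hf G' hff (h2 r hr).2
  exact ⟨mapE_dE hf r, hinj, fun k hk => mapE_bijOn hf hinj ((h2 r hr).1 k hk) (hF k) (hF' k) hff⟩

end Comparison

end Bidiff

variable {ι : Type*} {n : ℕ} {p : ι → ℕ}

/-! ### Graded derivations and homomorphisms of the algebra of local forms -/

/-- Every local form is a linear combination of products of generators. -/
theorem LocalForm.list_induction {C : LocalForm n p → Prop} (hzero : C 0)
    (hadd : ∀ x y, C x → C y → C (x + y)) (hsmul : ∀ (t : ℝ) x, C x → C (t • x))
    (hone : C 1) (hmul : ∀ (L : List (Gen n p)) (x : Gen n p), C (L.map gen).prod →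
      C (gen x * (L.map gen).prod)) (a : LocalForm n p) : C a := by
  have hL : ∀ L : List (Gen n p), C (L.map gen).prod := by
    intro L
    induction L with
    | nil => simpa using hone
    | cons x L ih => simpa using hmul L x ih
  let M : Submodule ℝ (LocalForm n p) := Submodule.span ℝ (Set.range fun L : List (Gen n p) => (L.map gen).prod)
  have hM : a ∈ M := by
    induction a using LocalForm.induction with
    | halg r =>
      rw [Algebra.algebraMap_eq_smul_one]
      exact M.smul_mem r (Submodule.subset_span ⟨[], rfl⟩)
    | hgen x => exact Submodule.subset_span ⟨[x], by simp⟩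
    | hmul x y hx hy =>
      have h := Submodule.mul_mem_mul hx hy
      rw [Submodule.span_mul_span] at h
      refine Submodule.span_mono ?_ h
      rintro _ ⟨_, ⟨L, rfl⟩, _, ⟨L', rfl⟩, rfl⟩
      exact ⟨L ++ L', by simp⟩
    | hadd x y hx hy => exact M.add_mem hx hy
  induction hM using Submodule.span_induction with
  | mem x h => obtain ⟨L, rfl⟩ := h; exact hL L
  | zero => exact hzero
  | add x y _ _ hx hy => exact hadd x y hx hy
  | smul t x _ hx => exact hsmul t x hx

theorem tw_tw (i j : ℕ) (a : LocalForm n p) : tw i (tw j a) = tw (i + j) a := by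
  refine hom_ext (f := (tw i).comp (tw j)) (g := tw (i + j)) (fun x => ?_) a
  rw [AlgHom.comp_apply, tw_gen, map_smul, tw_gen, tw_gen, smul_smul, ← pow_add]
  congr 2
  ring

theorem tw_two_mul (i : ℕ) (a : LocalForm n p) : tw (2 * i) a = a := by
  refine hom_ext (f := tw (2 * i)) (g := AlgHom.id ℝ _) (fun x => ?_) a
  rw [tw_gen, mul_assoc, pow_mul]
  simp

/-- The parity of `a` is that of `i`. -/
def HasParity (i : ℕ) (a : LocalForm n p) : Prop := tw 1 a = (-1 : ℝ) ^ i • a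

theorem HasParity.tw {i : ℕ} {a : LocalForm n p} (h : HasParity i a) (e : ℕ) :
    tw e a = (-1 : ℝ) ^ (e * i) • a := by
  induction e with
  | zero => simp [tw_zero]
  | succ e ih => rw [← tw_tw, h, map_smul, ih, smul_smul, ← pow_add]; congr 2; ring

theorem HasParity.gen (x : Gen n p) : HasParity x.deg (gen x) := by
  rw [HasParity, tw_gen, one_mul]

theorem HasParity.zero (i : ℕ) : HasParity i (0 : LocalForm n p) := by simp [HasParity]

theorem HasParity.algebraMap {i : ℕ} (hi : Even i) (r : ℝ) :
    HasParity i (algebraMap ℝ (LocalForm n p) r) := by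
  simp [HasParity, hi.neg_one_pow]

theorem HasParity.smul {i : ℕ} {a : LocalForm n p} (t : ℝ) (ha : HasParity i a) :
    HasParity i (t • a) := by rw [HasParity, map_smul, ha, smul_comm]

theorem HasParity.sub {i : ℕ} {a b : LocalForm n p} (ha : HasParity i a) (hb : HasParity i b) :
    HasParity i (a - b) := by rw [HasParity, map_sub, ha, hb, smul_sub]

theorem HasParity.sum {i : ℕ} {J : Type*} (s : Finset J) {f : J → LocalForm n p}
    (h : ∀ j ∈ s, HasParity i (f j)) : HasParity i (∑ j ∈ s, f j) := by
  rw [HasParity, map_sum, Finset.smul_sum]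
  exact Finset.sum_congr rfl h

theorem HasParity.congr {i j : ℕ} {a : LocalForm n p} (h : HasParity i a) (hij : Even (i + j)) :
    HasParity j a := by
  rw [HasParity, h]
  congr 1
  rcases Nat.even_or_odd i with hi | hi
  · rw [hi.neg_one_pow, ((Nat.even_add.1 hij).1 hi).neg_one_pow]
  · have hj : Odd j := by
      rw [← Nat.not_even_iff_odd, ← Nat.even_add.1 hij, Nat.not_even_iff_odd]
      exact hi
    rw [hi.neg_one_pow, hj.neg_one_pow]

theorem HasParity.mul_comm {i : ℕ} {a : LocalForm n p} (h : HasParity i a) (b : LocalForm n p) :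
    a * b = PForm.tw i b * a := by
  induction b using LocalForm.induction with
  | halg r => rw [AlgHom.commutes, Algebra.commutes]
  | hgen y =>
    have key : ∀ c : LocalForm n p, PForm.gen y * c = PForm.tw y.deg c * PForm.gen y := by
      intro c
      induction c using LocalForm.induction with
      | halg r => rw [AlgHom.commutes, Algebra.commutes]
      | hgen x => rw [tw_gen, gen_comm, smul_mul_assoc]
      | hmul x y hx hy => rw [← mul_assoc, hx, mul_assoc, hy, map_mul, mul_assoc]
      | hadd x y hx hy => rw [mul_add, hx, hy, map_add, add_mul]
    rw [tw_gen, smul_mul_assoc, key, h.tw, smul_mul_assoc, smul_smul, ← pow_add,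
      Nat.mul_comm i, ← two_mul, pow_mul]
    simp
  | hmul x y hx hy => rw [← mul_assoc, hx, mul_assoc, hy, map_mul, mul_assoc]
  | hadd x y hx hy => rw [mul_add, hx, hy, map_add, add_mul]

theorem HasParity.sc {i : ℕ} {a : LocalForm n p} (h : HasParity i a) : SC i a := fun y => by
  rw [h.mul_comm, tw_gen, smul_mul_assoc]

/-- The homomorphism with given values, of the parities of the generators, on the generators. -/
def evenHom (f : Gen n p → LocalForm n p) (h1 : ∀ x, HasParity x.deg (f x))
    (h2 : ∀ a l hl μ α (σ : Equiv.Perm (Fin l)),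
      f (.fld a l hl (μ ∘ σ) α) = ((σ.sign : ℤ) : ℝ) • f (.fld a l hl μ α)) :
    LocalForm n p →ₐ[ℝ] LocalForm n p :=
  liftHom f (fun x y => by rw [(h1 x).mul_comm, (h1 y).tw, smul_mul_assoc]) h2

/-- A homomorphism of local forms that preserves the parity. -/
def IsEven (ρ : LocalForm n p →ₐ[ℝ] LocalForm n p) : Prop := ∀ e a, ρ (tw e a) = tw e (ρ a)

section evenHom

variable (f : Gen n p → LocalForm n p) (h1 : ∀ x, HasParity x.deg (f x))
    (h2 : ∀ a l hl μ α (σ : Equiv.Perm (Fin l)),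
      f (.fld a l hl (μ ∘ σ) α) = ((σ.sign : ℤ) : ℝ) • f (.fld a l hl μ α))

theorem evenHom_gen (x : Gen n p) : evenHom f h1 h2 (gen x) = f x := liftHom_gen _ _ _ _

theorem evenHom_isEven : IsEven (evenHom f h1 h2) := by
  intro e a
  refine hom_ext (f := (evenHom f h1 h2).comp (tw e)) (g := (tw e).comp (evenHom f h1 h2))
    (fun x => ?_) a
  rw [AlgHom.comp_apply, AlgHom.comp_apply, tw_gen, map_smul, evenHom_gen, (h1 x).tw]

end evenHom

/-- `D` is a derivation of parity `e` along the homomorphism `ρ`. -/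
structure IsDerAlong (ρ : LocalForm n p →ₐ[ℝ] LocalForm n p) (e : ℕ)
    (D : LocalForm n p →ₗ[ℝ] LocalForm n p) : Prop where
  mul : ∀ a b, D (a * b) = D a * ρ b + tw e (ρ a) * D b
  alg : ∀ r, D (algebraMap ℝ _ r) = 0

namespace IsDerAlong

variable {ρ ρ' : LocalForm n p →ₐ[ℝ] LocalForm n p} {e : ℕ}
  {D D' : LocalForm n p →ₗ[ℝ] LocalForm n p}

theorem add (h : IsDerAlong ρ e D) (h' : IsDerAlong ρ e D') : IsDerAlong ρ e (D + D') where
  mul a b := by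
    simp only [LinearMap.add_apply, h.mul, h'.mul, add_mul, mul_add]
    abel
  alg r := by simp [h.alg, h'.alg]

theorem smul (t : ℝ) (h : IsDerAlong ρ e D) : IsDerAlong ρ e (t • D) where
  mul a b := by simp only [LinearMap.smul_apply, h.mul, smul_add, smul_mul_assoc, mul_smul_comm]
  alg r := by simp [h.alg]

theorem zero : IsDerAlong ρ e 0 where
  mul a b := by simp
  alg r := by simp

theorem sum {J : Type*} {s : Finset J} {D : J → LocalForm n p →ₗ[ℝ] LocalForm n p}
    (h : ∀ j ∈ s, IsDerAlong ρ e (D j)) : IsDerAlong ρ e (∑ j ∈ s, D j) := by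
  classical
  induction s using Finset.induction_on with
  | empty => simpa using zero
  | insert j s hj ih =>
    rw [Finset.sum_insert hj]
    exact (h j (by simp)).add (ih fun k hk => h k (by simp [hk]))

theorem comp_left (h : IsDerAlong ρ e D) (hρ : IsEven ρ') :
    IsDerAlong (ρ'.comp ρ) e (ρ'.toLinearMap ∘ₗ D) where
  mul a b := by simp [h.mul, hρ e]
  alg r := by simp [h.alg]

theorem comp_right (h : IsDerAlong ρ e D) :
    IsDerAlong (ρ.comp ρ') e (D ∘ₗ ρ'.toLinearMap) where
  mul a b := by simp [h.mul]
  alg r := by simp [h.alg]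

/-- Derivations along the same homomorphism that agree on the generators are equal. -/
theorem ext (h : IsDerAlong ρ e D) (h' : IsDerAlong ρ e D') (hg : ∀ x, D (gen x) = D' (gen x))
    (a : LocalForm n p) : D a = D' a := by
  induction a using LocalForm.induction with
  | halg r => rw [h.alg, h'.alg]
  | hgen x => exact hg x
  | hmul x y hx hy => rw [h.mul, h'.mul, hx, hy]
  | hadd x y hx hy => rw [map_add, map_add, hx, hy]

end IsDerAlong

/-- `D` is a derivation of parity `e`. -/
structure IsDer (e : ℕ) (D : LocalForm n p →ₗ[ℝ] LocalForm n p) : Prop where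
  mul : ∀ a b, D (a * b) = D a * b + tw e a * D b
  alg : ∀ r, D (algebraMap ℝ _ r) = 0
  map_tw_one : ∀ a, D (tw 1 a) = (-1 : ℝ) ^ e • tw 1 (D a)

namespace IsDer

variable {e e' : ℕ} {D D' : LocalForm n p →ₗ[ℝ] LocalForm n p}

theorem along (h : IsDer e D) : IsDerAlong (AlgHom.id ℝ _) e D := ⟨h.mul, h.alg⟩

theorem mul_zero (h : IsDer 0 D) (a b : LocalForm n p) : D (a * b) = D a * b + a * D b := by
  rw [h.mul, tw_zero]

theorem one (h : IsDer e D) : D 1 = 0 := by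
  rw [← map_one (algebraMap ℝ (LocalForm n p)), h.alg]

theorem map_tw (h : IsDer e D) (i : ℕ) (a : LocalForm n p) :
    D (tw i a) = (-1 : ℝ) ^ (i * e) • tw i (D a) := by
  induction i with
  | zero => simp [tw_zero]
  | succ i ih =>
    rw [Nat.add_comm, ← tw_tw, h.map_tw_one, ih, map_smul, tw_tw, smul_smul, ← pow_add]
    congr 2
    ring

theorem parity (h : IsDer e D) {i : ℕ} {a : LocalForm n p} (ha : HasParity i a) :
    HasParity (i + e) (D a) := by
  have := h.map_tw_one a
  rw [ha, map_smul] at this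
  rw [HasParity, pow_add, mul_comm, mul_smul, this, smul_smul, ← pow_add, ← two_mul, pow_mul]
  simp

theorem zero (e : ℕ) : IsDer e (0 : LocalForm n p →ₗ[ℝ] LocalForm n p) :=
  ⟨by simp, by simp, by simp⟩

theorem smul (t : ℝ) (h : IsDer e D) : IsDer e (t • D) where
  mul := (h.along.smul t).mul
  alg := (h.along.smul t).alg
  map_tw_one a := by simp [h.map_tw_one, smul_comm t]

theorem sum {J : Type*} {s : Finset J} {D : J → LocalForm n p →ₗ[ℝ] LocalForm n p}
    (h : ∀ j ∈ s, IsDer e (D j)) : IsDer e (∑ j ∈ s, D j) where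
  mul := (IsDerAlong.sum fun j hj => (h j hj).along).mul
  alg := (IsDerAlong.sum fun j hj => (h j hj).along).alg
  map_tw_one a := by
    simp only [LinearMap.sum_apply, map_sum, Finset.smul_sum]
    exact Finset.sum_congr rfl fun j hj => (h j hj).map_tw_one a

theorem congr (h : IsDer e D) (hee : Even (e + e')) : IsDer e' D := by
  have htw : ∀ a : LocalForm n p, tw e a = tw e' a := by
    intro a
    obtain ⟨k, hk⟩ := hee
    rw [← tw_two_mul k (tw e' a), tw_tw, show 2 * k + e' = 2 * e' + e by omega, ← tw_tw,
      tw_two_mul]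
  refine ⟨fun a b => by rw [h.mul, htw], h.alg, fun a => ?_⟩
  rw [h.map_tw_one]
  congr 1
  rcases Nat.even_or_odd e with hi | hi
  · rw [hi.neg_one_pow, ((Nat.even_add.1 hee).1 hi).neg_one_pow]
  · have hj : Odd e' := by
      rw [← Nat.not_even_iff_odd, ← Nat.even_add.1 hee, Nat.not_even_iff_odd]
      exact hi
    rw [hi.neg_one_pow, hj.neg_one_pow]

/-- The graded commutator of two derivations. -/
theorem comm (h : IsDer e D) (h' : IsDer e' D') :
    IsDer (e + e') (D ∘ₗ D' - (-1 : ℝ) ^ (e * e') • D' ∘ₗ D) where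
  mul a b := by
    have hs : (-1 : ℝ) ^ (e * e') * (-1 : ℝ) ^ (e * e') = 1 := by
      rw [← pow_add, ← two_mul, pow_mul]; simp
    simp only [LinearMap.sub_apply, LinearMap.smul_apply, LinearMap.comp_apply, h.mul, h'.mul,
      map_add, h.map_tw, h'.map_tw, tw_tw, smul_add, smul_mul_assoc, smul_smul, sub_mul, mul_sub,
      mul_smul_comm, Nat.mul_comm e' e, hs, one_smul, Nat.add_comm e' e]
    abel
  alg r := by simp [h.alg, h'.alg]
  map_tw_one a := by
    simp only [LinearMap.sub_apply, LinearMap.smul_apply, LinearMap.comp_apply, h.map_tw_one,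
      h'.map_tw_one, map_smul, smul_sub, map_sub, smul_smul, pow_add]
    congr 2
    · ring
    · ring

theorem comm_even (h : IsDer 0 D) (h' : IsDer e D') : IsDer e (D ∘ₗ D' - D' ∘ₗ D) := by
  have := h.comm h'
  simpa using this

theorem comm_odd (h : IsDer 1 D) (h' : IsDer 1 D') : IsDer 0 (D ∘ₗ D' + D' ∘ₗ D) := by
  have := (h.comm h').congr (e' := 0) (by decide)
  have e : D ∘ₗ D' - (-1 : ℝ) ^ (1 * 1) • D' ∘ₗ D = D ∘ₗ D' + D' ∘ₗ D := by
    refine LinearMap.ext fun x => ?_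
    simp [sub_eq_add_neg]
  rwa [e] at this

theorem ext (h : IsDer e D) (h' : IsDer e D') (hg : ∀ x, D (gen x) = D' (gen x))
    (a : LocalForm n p) : D a = D' a := h.along.ext h'.along hg a

/-- An even derivation commutes with a derivation if it does so on the generators. -/
theorem commute (h : IsDer 0 D) (h' : IsDer e D') (hg : ∀ x, D (D' (gen x)) = D' (D (gen x)))
    (a : LocalForm n p) : D (D' a) = D' (D a) := by
  have := (h.comm_even h').ext (zero e) (fun x => by simp [hg]) a
  rwa [LinearMap.sub_apply, LinearMap.zero_apply, sub_eq_zero] at this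

/-- A derivation with given values on the generators. -/
theorem der {f : Gen n p → LocalForm n p} (h1 : ∀ x, SC (x.deg + e) (f x))
    (h2 : ∀ a l hl μ α (σ : Equiv.Perm (Fin l)),
      f (.fld a l hl (μ ∘ σ) α) = ((σ.sign : ℤ) : ℝ) • f (.fld a l hl μ α))
    (hf : ∀ x, HasParity (x.deg + e) (f x)) : IsDer e (der e f h1 h2) where
  mul := der_mul e f h1 h2
  alg := der_algebraMap e f h1 h2
  map_tw_one a := by
    have h : IsDerAlong (tw 1) e (PForm.der e f h1 h2 ∘ₗ (tw 1).toLinearMap) :=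
      ⟨fun a b => by simp [der_mul], fun r => by simp [der_algebraMap]⟩
    have h' : IsDerAlong (tw 1) e ((-1 : ℝ) ^ e • (tw 1).toLinearMap ∘ₗ PForm.der e f h1 h2) :=
      IsDerAlong.smul _ ⟨fun a b => by simp [der_mul, tw_tw, Nat.add_comm],
        fun r => by simp [der_algebraMap]⟩
    refine h.ext h' (fun x => ?_) a
    simp only [LinearMap.comp_apply, LinearMap.smul_apply, AlgHom.toLinearMap_apply, tw_gen,
      map_smul, der_gen]
    rw [hf x, smul_smul, one_mul, ← pow_add, show e + (x.deg + e) = 2 * e + x.deg by ring, pow_add,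
      pow_mul]
    simp

end IsDer

/-- The derivation of parity `e` with given values on the generators. -/
def derOf (e : ℕ) (f : Gen n p → LocalForm n p) (h1 : ∀ x, HasParity (x.deg + e) (f x))
    (h2 : ∀ a l hl μ α (σ : Equiv.Perm (Fin l)),
      f (.fld a l hl (μ ∘ σ) α) = ((σ.sign : ℤ) : ℝ) • f (.fld a l hl μ α)) :
    LocalForm n p →ₗ[ℝ] LocalForm n p := der e f (fun x => (h1 x).sc) h2

theorem derOf_isDer (e : ℕ) (f : Gen n p → LocalForm n p) (h1 : ∀ x, HasParity (x.deg + e) (f x))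
    (h2 : ∀ a l hl μ α (σ : Equiv.Perm (Fin l)),
      f (.fld a l hl (μ ∘ σ) α) = ((σ.sign : ℤ) : ℝ) • f (.fld a l hl μ α)) :
    IsDer e (derOf e f h1 h2) := IsDer.der _ _ h1

theorem derOf_gen (e : ℕ) (f : Gen n p → LocalForm n p) (h1 : ∀ x, HasParity (x.deg + e) (f x))
    (h2 : ∀ a l hl μ α (σ : Equiv.Perm (Fin l)),
      f (.fld a l hl (μ ∘ σ) α) = ((σ.sign : ℤ) : ℝ) • f (.fld a l hl μ α)) (x : Gen n p) :
    derOf e f h1 h2 (gen x) = f x := der_gen _ _ _ _ _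

theorem pd_isDer (ν : Fin n) : IsDer 0 (pd ν : LocalForm n p →ₗ[ℝ] LocalForm n p) :=
  ⟨fun a b => by rw [pd_mul, tw_zero], pd_algebraMap ν, fun a => by rw [pd_tw, pow_zero, one_smul]⟩

theorem brst_isDer : IsDer 1 (brst : LocalForm n p →ₗ[ℝ] LocalForm n p) :=
  ⟨brst_mul, brst_algebraMap, fun a => by rw [tw_brst]; simp⟩

theorem rot_isDer (ω : Matrix (Fin n) (Fin n) ℝ) :
    IsDer 0 (rot ω : LocalForm n p →ₗ[ℝ] LocalForm n p) :=
  ⟨fun a b => by rw [rot_mul, tw_zero], rot_algebraMap ω,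
    fun a => by rw [rot_tw, pow_zero, one_smul]⟩

theorem gen_dx (μ : Fin n) : (gen (.dx μ) : LocalForm n p) = dx n p μ := rfl

theorem gen_fld (a : ι) (l : ℕ) (hl : l ≤ p a) (μ : Fin l → Fin n) (α : Multiset (Fin n)) :
    (gen (.fld a l hl μ α) : LocalForm n p) = fld a l hl μ α := rfl

theorem HasParity.dx (μ : Fin n) : HasParity 1 (dx n p μ) := HasParity.gen (.dx μ)

theorem HasParity.fld (a : ι) (l : ℕ) (hl : l ≤ p a) (μ : Fin l → Fin n) (α : Multiset (Fin n)) :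
    HasParity (p a - l) (fld a l hl μ α : LocalForm n p) := HasParity.gen (.fld a l hl μ α)

/-! ### The grading by the form degree -/

theorem mul_mem_formsOfDegree {i j : ℕ} {x y : LocalForm n p} (hx : x ∈ formsOfDegree n p i)
    (hy : y ∈ formsOfDegree n p j) : x * y ∈ formsOfDegree n p (i + j) := by
  have h := Submodule.mul_mem_mul hx hy
  rw [formsOfDegree, formsOfDegree, Submodule.span_mul_span] at h
  refine Submodule.span_mono ?_ h
  rintro _ ⟨_, ⟨L, hL, rfl⟩, _, ⟨L', hL', rfl⟩, rfl⟩
  exact ⟨L ++ L', by simp [hL, hL'], by simp⟩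

theorem gen_mem_formsOfDegree (x : Gen n p) : gen x ∈ formsOfDegree n p x.formDeg :=
  Submodule.subset_span ⟨[x], by simp⟩

theorem dx_mem_formsOfDegree (μ : Fin n) : dx n p μ ∈ formsOfDegree n p 1 :=
  gen_mem_formsOfDegree (.dx μ)

theorem fld_mem_formsOfDegree (a : ι) (l : ℕ) (hl : l ≤ p a) (μ : Fin l → Fin n)
    (α : Multiset (Fin n)) : fld a l hl μ α ∈ formsOfDegree n p 0 :=
  gen_mem_formsOfDegree (.fld a l hl μ α)

theorem one_mem_formsOfDegree : (1 : LocalForm n p) ∈ formsOfDegree n p 0 :=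
  Submodule.subset_span ⟨[], by simp⟩

theorem dxs_mem_formsOfDegree {l : ℕ} (μ : Fin l → Fin n) :
    dxs p μ ∈ formsOfDegree n p l := by
  induction l with
  | zero => rw [dxs_zero]; exact one_mem_formsOfDegree
  | succ l ih =>
    have := mul_mem_formsOfDegree (dx_mem_formsOfDegree (μ 0)) (ih (fun i => μ i.succ))
    rwa [← dxs_succ, Nat.add_comm] at this

theorem dxs_eq_zero {l : ℕ} (hl : n < l) (μ : Fin l → Fin n) : dxs p μ = 0 := by
  obtain ⟨i, j, hij, h⟩ := Fintype.exists_ne_map_eq_of_card_lt μ (by simpa using hl)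
  refine eq_zero_of_eq_neg ?_
  have e := dxs_perm (p := p) μ (Equiv.swap i j)
  have hμ : μ ∘ Equiv.swap i j = μ := by
    funext k
    rcases eq_or_ne k i with rfl | hki
    · simp [h]
    · rcases eq_or_ne k j with rfl | hkj
      · simp [h]
      · simp [Equiv.swap_apply_of_ne_of_ne hki hkj]
  rw [hμ, Equiv.Perm.sign_swap hij] at e
  simpa using e

/-- Products of generators in normal order, the differentials `dx^μ` first. -/
theorem exists_prod_eq_dxs_mul (L : List (Gen n p)) :
    ∃ (l : ℕ) (μ : Fin l → Fin n) (y : LocalForm n p), l = (L.map Gen.formDeg).sum ∧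
      y ∈ formsOfDegree n p 0 ∧ (L.map gen).prod = dxs p μ * y := by
  induction L with
  | nil => exact ⟨0, Fin.elim0, 1, rfl, one_mem_formsOfDegree, by rw [dxs_zero]; simp⟩
  | cons x L ih =>
    obtain ⟨d, μ, y, hd, hy, h⟩ := ih
    cases x with
    | dx ν =>
      refine ⟨d + 1, Fin.cons ν μ, y, ?_, hy, ?_⟩
      · rw [List.map_cons, List.sum_cons, Gen.formDeg, hd, Nat.add_comm]
      · rw [List.map_cons, List.prod_cons, h, dxs_succ, mul_assoc]
        rfl
    | fld a l hl ρ α =>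
      refine ⟨d, μ, (-1 : ℝ) ^ ((p a - l) * d) • (fld a l hl ρ α * y), ?_, ?_, ?_⟩
      · rw [List.map_cons, List.sum_cons, Gen.formDeg, hd, Nat.zero_add]
      · have := mul_mem_formsOfDegree (fld_mem_formsOfDegree a l hl ρ α) hy
        exact Submodule.smul_mem _ _ this
      · have hd : HasParity d (dxs p μ) := tw_dxs μ
        rw [List.map_cons, List.prod_cons, h, ← mul_assoc, gen_fld,
          (HasParity.fld a l hl ρ α).mul_comm, hd.tw, smul_mul_assoc, smul_mul_assoc,
          mul_smul_comm, mul_assoc]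

/-- The homomorphism that multiplies the forms of degree `k` by the `k`-th power of a formal
parameter. -/
noncomputable def formDegHom (n : ℕ) (p : ι → ℕ) :
    LocalForm n p →ₐ[ℝ] Polynomial (LocalForm n p) :=
  liftHom (fun x => Polynomial.monomial x.formDeg (gen x))
    (fun x y => by
      rw [Polynomial.monomial_mul_monomial, Polynomial.monomial_mul_monomial, gen_comm,
        Nat.add_comm, Polynomial.smul_monomial])
    (fun a l hl μ α σ => by
      rw [gen_fld, fld_perm, Polynomial.smul_monomial]
      rfl)

/-- The component of form degree `k`. -/
noncomputable def formProj (k : ℕ) : LocalForm n p →ₗ[ℝ] LocalForm n p where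
  toFun a := (formDegHom n p a).coeff k
  map_add' a b := by simp
  map_smul' t a := by simp

theorem formDegHom_prod (L : List (Gen n p)) : formDegHom n p (L.map gen).prod =
    Polynomial.monomial (L.map Gen.formDeg).sum (L.map gen).prod := by
  induction L with
  | nil => simp
  | cons x L ih =>
    rw [List.map_cons, List.prod_cons, map_mul, ih, formDegHom, liftHom_gen,
      Polynomial.monomial_mul_monomial, List.map_cons, List.sum_cons]

theorem formProj_prod (k : ℕ) (L : List (Gen n p)) : formProj k (L.map gen).prod =
    if (L.map Gen.formDeg).sum = k then (L.map gen).prod else 0 := by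
  change (formDegHom n p _).coeff k = _
  rw [formDegHom_prod, Polynomial.coeff_monomial]

theorem formProj_of_mem {k : ℕ} {x : LocalForm n p} (hx : x ∈ formsOfDegree n p k) (j : ℕ) :
    formProj j x = if k = j then x else 0 := by
  induction hx using Submodule.span_induction with
  | mem x h => obtain ⟨L, rfl, rfl⟩ := h; exact formProj_prod j L
  | zero => simp
  | add x y _ _ hx hy => rw [map_add, hx, hy]; split_ifs <;> simp
  | smul t x _ hx => rw [map_smul, hx]; split_ifs <;> simp

theorem LocalForm.prod_induction {C : LocalForm n p → Prop} (hzero : C 0)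
    (hadd : ∀ x y, C x → C y → C (x + y)) (hsmul : ∀ (t : ℝ) x, C x → C (t • x))
    (hprod : ∀ L : List (Gen n p), C (L.map gen).prod) (a : LocalForm n p) : C a :=
  LocalForm.list_induction hzero hadd hsmul (by simpa using hprod [])
    (fun L x _ => by simpa using hprod (x :: L)) a

theorem formProj_mem (k : ℕ) (x : LocalForm n p) : formProj k x ∈ formsOfDegree n p k := by
  induction x using LocalForm.prod_induction with
  | hzero => rw [map_zero]; exact zero_mem _
  | hadd x y hx hy => rw [map_add]; exact add_mem hx hy
  | hsmul t x hx => rw [map_smul]; exact Submodule.smul_mem _ _ hx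
  | hprod L =>
    rw [formProj_prod]
    split_ifs with h
    · exact Submodule.subset_span ⟨L, h, rfl⟩
    · exact zero_mem _

theorem mem_formsOfDegree_iff {k : ℕ} {x : LocalForm n p} :
    x ∈ formsOfDegree n p k ↔ formProj k x = x :=
  ⟨fun h => by rw [formProj_of_mem h, if_pos rfl], fun h => h ▸ formProj_mem k x⟩

theorem formProj_formProj (j k : ℕ) (x : LocalForm n p) :
    formProj j (formProj k x) = if j = k then formProj k x else 0 := by
  rw [formProj_of_mem (formProj_mem k x)]
  simp only [eq_comm]

theorem sum_formProj (x : LocalForm n p) : ∑ k ∈ Finset.range (n + 1), formProj k x = x := by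
  induction x using LocalForm.prod_induction with
  | hzero => simp
  | hadd x y hx hy => simp only [map_add, Finset.sum_add_distrib, hx, hy]
  | hsmul t x hx => simp only [map_smul, ← Finset.smul_sum, hx]
  | hprod L =>
    simp only [formProj_prod]
    rw [Finset.sum_ite_eq]
    split_ifs with h
    · rfl
    · obtain ⟨l, μ, y, hl, -, e⟩ := exists_prod_eq_dxs_mul L
      rw [e, dxs_eq_zero (by rw [hl]; simpa using h), zero_mul]

/-- A linear map that raises the form degree by `e` commutes with the projections. -/
theorem formProj_map {T : LocalForm n p →ₗ[ℝ] LocalForm n p} {e : ℕ}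
    (hT : ∀ k, ∀ x ∈ formsOfDegree n p k, T x ∈ formsOfDegree n p (k + e)) (k : ℕ)
    (x : LocalForm n p) : formProj (k + e) (T x) = T (formProj k x) := by
  conv_lhs => rw [← sum_formProj x]
  conv_rhs => rw [← sum_formProj x]
  rw [map_sum, map_sum, map_sum, map_sum]
  refine Finset.sum_congr rfl fun j _ => ?_
  rw [formProj_of_mem (hT j _ (formProj_mem j x)), formProj_formProj]
  by_cases h : j = k
  · simp [h]
  · rw [if_neg (by omega), if_neg (by omega), map_zero]

theorem formProj_map_of_lt {T : LocalForm n p →ₗ[ℝ] LocalForm n p} {e : ℕ}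
    (hT : ∀ k, ∀ x ∈ formsOfDegree n p k, T x ∈ formsOfDegree n p (k + e)) {k : ℕ} (hk : k < e)
    (x : LocalForm n p) : formProj k (T x) = 0 := by
  conv_lhs => rw [← sum_formProj x]
  rw [map_sum, map_sum]
  refine Finset.sum_eq_zero fun j _ => ?_
  rw [formProj_of_mem (hT j _ (formProj_mem j x)), if_neg (by omega)]

theorem IsDer.map_formsOfDegree {e i : ℕ} {T : LocalForm n p →ₗ[ℝ] LocalForm n p} (h : IsDer i T)
    (hT : ∀ x, T (gen x) ∈ formsOfDegree n p (x.formDeg + e)) (k : ℕ) :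
    ∀ x ∈ formsOfDegree n p k, T x ∈ formsOfDegree n p (k + e) := by
  intro x hx
  induction hx using Submodule.span_induction with
  | mem x hL =>
    obtain ⟨L, rfl, rfl⟩ := hL
    induction L with
    | nil => simp [h.one]
    | cons x L ih =>
      rw [List.map_cons, List.map_cons, List.prod_cons, h.mul, List.sum_cons]
      have hL : (L.map gen).prod ∈ formsOfDegree n p (L.map Gen.formDeg).sum :=
        Submodule.subset_span ⟨L, rfl, rfl⟩
      refine add_mem ?_ ?_
      · rw [Nat.add_right_comm]
        exact mul_mem_formsOfDegree (hT x) hL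
      · rw [tw_gen, smul_mul_assoc, Nat.add_assoc]
        exact Submodule.smul_mem _ _ (mul_mem_formsOfDegree (gen_mem_formsOfDegree x) ih)
  | zero => simp
  | add x y _ _ hx hy => rw [map_add]; exact add_mem hx hy
  | smul t x _ hx => rw [map_smul]; exact Submodule.smul_mem _ _ hx

theorem brst_mem_formsOfDegree (k : ℕ) :
    ∀ x ∈ formsOfDegree n p k, brst x ∈ formsOfDegree n p (k + 0) := by
  refine brst_isDer.map_formsOfDegree (fun x => ?_) k
  cases x with
  | dx μ => rw [gen_dx, brst_dx]; exact zero_mem _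
  | fld a l hl μ α =>
    cases l with
    | zero => rw [gen_fld, brst_fld_zero]; exact zero_mem _
    | succ l =>
      rw [gen_fld, brst_fld_succ]
      exact Submodule.smul_mem _ _ (Submodule.sum_mem _ fun σ _ => Submodule.smul_mem _ _
        (fld_mem_formsOfDegree _ _ _ _ _))

theorem pd_mem_formsOfDegree (ν : Fin n) (k : ℕ) :
    ∀ x ∈ formsOfDegree n p k, pd ν x ∈ formsOfDegree n p (k + 0) := by
  refine (pd_isDer ν).map_formsOfDegree (fun x => ?_) k
  cases x with
  | dx μ => rw [gen_dx, pd_dx]; exact zero_mem _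
  | fld a l hl μ α => rw [gen_fld, pd_fld]; exact fld_mem_formsOfDegree _ _ _ _ _

theorem extD_mem_formsOfDegree (k : ℕ) :
    ∀ x ∈ formsOfDegree n p k, extD x ∈ formsOfDegree n p (k + 1) := by
  intro x hx
  rw [extD_apply]
  refine Submodule.sum_mem _ fun ν _ => ?_
  rw [Nat.add_comm]
  exact mul_mem_formsOfDegree (dx_mem_formsOfDegree ν) (pd_mem_formsOfDegree ν k x hx)

theorem rot_mem_formsOfDegree (ω : Matrix (Fin n) (Fin n) ℝ) (k : ℕ) :
    ∀ x ∈ formsOfDegree n p k, rot ω x ∈ formsOfDegree n p (k + 0) := by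
  refine (rot_isDer ω).map_formsOfDegree (fun x => ?_) k
  cases x with
  | dx μ =>
    rw [gen_dx, rot_dx]
    exact Submodule.sum_mem _ fun ν _ => Submodule.smul_mem _ _ (dx_mem_formsOfDegree ν)
  | fld a l hl μ α =>
    rw [gen_fld, rot_fld]
    refine sub_mem (neg_mem (Submodule.sum_mem _ fun j _ => Submodule.sum_mem _ fun ν _ =>
      Submodule.smul_mem _ _ (fld_mem_formsOfDegree _ _ _ _ _))) (multiset_sum_mem _ ?_)
    intro x hx
    obtain ⟨ρ, -, rfl⟩ := Multiset.mem_map.1 hx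
    exact Submodule.sum_mem _ fun ν _ => Submodule.smul_mem _ _ (fld_mem_formsOfDegree _ _ _ _ _)

theorem localForms_grading : (localForms n p).Grading n formProj where
  proj := formProj_formProj
  map_γ := fun k x => formProj_map brst_mem_formsOfDegree k x
  map_d := fun k x => formProj_map extD_mem_formsOfDegree k x
  map_d_zero := fun x => formProj_map_of_lt extD_mem_formsOfDegree Nat.zero_lt_one x
  sum := sum_formProj

/-- A subspace that is stable under `γ`, `d` and the projections is graded. -/
theorem Bidiff.Grading.restrict {V : Type*} [AddCommGroup V] [Module ℝ V] {D : Bidiff V}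
    {π : ℕ → V →ₗ[ℝ] V} (G : D.Grading n π) (Q : Submodule ℝ V) (hγ : ∀ x ∈ Q, D.γ x ∈ Q)
    (hd : ∀ x ∈ Q, D.d x ∈ Q) (hπ : ∀ k, ∀ x ∈ Q, π k x ∈ Q) :
    (D.restrict Q hγ hd).Grading n (fun k => (π k).restrict (hπ k)) where
  proj j k x := Subtype.ext (by
    have := G.proj j k x
    split_ifs at this ⊢ with h <;> simpa using this)
  map_γ k x := Subtype.ext (G.map_γ k x)
  map_d k x := Subtype.ext (G.map_d k x)
  map_d_zero x := Subtype.ext (G.map_d_zero x)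
  sum x := Subtype.ext (by simpa using G.sum x)

theorem formProj_adjoin {S : Set (LocalForm n p)}
    (hS : ∀ x ∈ S, ∃ k, x ∈ formsOfDegree n p k) (k : ℕ) :
    ∀ x ∈ Subalgebra.toSubmodule (Algebra.adjoin ℝ S),
      formProj k x ∈ Subalgebra.toSubmodule (Algebra.adjoin ℝ S) := by
  intro x hx
  rw [Subalgebra.mem_toSubmodule] at hx ⊢
  induction hx using Algebra.adjoin_induction generalizing k with
  | mem x h =>
    obtain ⟨j, hj⟩ := hS x h
    rw [formProj_of_mem hj]
    split_ifs
    · exact Algebra.subset_adjoin h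
    · exact zero_mem _
  | algebraMap r =>
    rw [Algebra.algebraMap_eq_smul_one, formProj_of_mem (Submodule.smul_mem _ r
      one_mem_formsOfDegree)]
    split_ifs
    · exact Subalgebra.smul_mem _ (one_mem _) r
    · exact zero_mem _
  | add x y hx hy h1 h2 => rw [map_add]; exact add_mem (h1 k) (h2 k)
  | mul x y hx hy h1 h2 =>
    have : formProj k (x * y) =
        ∑ q ∈ Finset.HasAntidiagonal.antidiagonal k, formProj q.1 x * formProj q.2 y := by
      change (formDegHom n p (x * y)).coeff k = _
      rw [map_mul, Polynomial.coeff_mul]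
      rfl
    rw [this]
    exact sum_mem fun q _ => mul_mem (h1 _) (h2 _)

theorem form_mem_formsOfDegree (a : ι) (l : ℕ) (hl : l ≤ p a) :
    form n a l hl ∈ formsOfDegree n p l := by
  rw [form]
  refine Submodule.smul_mem _ _ (Submodule.sum_mem _ fun μ _ => ?_)
  have := mul_mem_formsOfDegree (fld_mem_formsOfDegree a l hl μ 0) (dxs_mem_formsOfDegree μ)
  rwa [Nat.zero_add] at this

theorem smallGens_mem_formsOfDegree : ∀ x ∈ smallGens n p, ∃ k, x ∈ formsOfDegree n p k := by
  rintro x ⟨a, l, hl, rfl | rfl⟩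
  · exact ⟨l, form_mem_formsOfDegree a l hl⟩
  · exact ⟨l + 1, extD_mem_formsOfDegree l _ (form_mem_formsOfDegree a l hl)⟩

theorem formProj_smallAlg (k : ℕ) : ∀ x ∈ Subalgebra.toSubmodule (smallAlg n p),
    formProj k x ∈ Subalgebra.toSubmodule (smallAlg n p) :=
  formProj_adjoin smallGens_mem_formsOfDegree k

theorem formProj_smallAlgConst (k : ℕ) : ∀ x ∈ Subalgebra.toSubmodule (smallAlgConst n p),
    formProj k x ∈ Subalgebra.toSubmodule (smallAlgConst n p) := by
  refine formProj_adjoin ?_ k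
  rintro x (hx | ⟨μ, rfl⟩)
  · exact smallGens_mem_formsOfDegree x hx
  · exact ⟨1, dx_mem_formsOfDegree μ⟩

theorem formProj_lorentzForm (k : ℕ) : ∀ x ∈ lorentzForm n p, formProj k x ∈ lorentzForm n p := by
  intro x hx
  refine mem_lorentzForm.2 fun ω hω => ?_
  have := formProj_map (rot_mem_formsOfDegree ω) k x
  rw [mem_lorentzForm.1 hx ω hω, map_zero] at this
  exact this.symm

/-! ### Counting derivations -/

/-- If a sum of eigenvectors with distinct eigenvalues lies in a stable subspace, then so does every
term. -/
theorem eigenvector_mem {V : Type*} [AddCommGroup V] [Module ℝ V] {T : V →ₗ[ℝ] V}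
    {Q : Submodule ℝ V} (hQ : ∀ x ∈ Q, T x ∈ Q) {J : ℕ} {y : ℕ → V}
    (hy : ∀ j < J, T (y j) = (j : ℝ) • y j) (h : ∑ j ∈ Finset.range J, y j ∈ Q) :
    ∀ j < J, y j ∈ Q := by
  induction J generalizing y with
  | zero => intro j hj; omega
  | succ J ih =>
    have h1 : ∑ j ∈ Finset.range J, ((j : ℝ) - J) • y j ∈ Q := by
      have e := Q.sub_mem (hQ _ h) (Q.smul_mem (J : ℝ) h)
      rw [map_sum, Finset.smul_sum, ← Finset.sum_sub_distrib, Finset.sum_range_succ,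
        hy J (by omega), sub_self, add_zero] at e
      convert e using 2 with j hj
      rw [hy j (by have := Finset.mem_range.1 hj; omega), sub_smul]
    have h2 : ∀ j < J, y j ∈ Q := by
      intro j hj
      have e := ih (y := fun j => ((j : ℝ) - J) • y j)
        (fun j hj => by rw [map_smul, hy j (by omega), smul_comm]) h1 j hj
      have hne : (j : ℝ) - J ≠ 0 := sub_ne_zero.2 (by exact_mod_cast hj.ne)
      simpa [smul_smul, inv_mul_cancel₀ hne] using Q.smul_mem ((j : ℝ) - J)⁻¹ e
    intro j hj
    rcases Nat.lt_succ_iff_lt_or_eq.1 hj with hj | rfl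
    · exact h2 j hj
    · rw [Finset.sum_range_succ] at h
      exact (Q.add_mem_iff_right (Q.sum_mem fun i hi => h2 i (Finset.mem_range.1 hi))).1 h

/-- The eigenvectors of `T` with eigenvalue `j` that `ρ` fixes, for `j = 0`, or annihilates,
for `j ≠ 0`. -/
def countSpace (T : LocalForm n p →ₗ[ℝ] LocalForm n p) (ρ : LocalForm n p →ₐ[ℝ] LocalForm n p)
    (j : ℕ) : Submodule ℝ (LocalForm n p) where
  carrier := {x | T x = (j : ℝ) • x ∧ ρ x = if j = 0 then x else 0}
  zero_mem' := by simp
  add_mem' := by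
    rintro x y ⟨h1, h2⟩ ⟨h3, h4⟩
    refine ⟨by rw [map_add, h1, h3, smul_add], ?_⟩
    rw [map_add, h2, h4]
    split_ifs <;> simp
  smul_mem' := by
    rintro t x ⟨h1, h2⟩
    refine ⟨by rw [map_smul, h1, smul_comm], ?_⟩
    rw [map_smul, h2]
    split_ifs <;> simp

/-- `T` is diagonalizable with eigenvalues in `ℕ`, and the homomorphism `ρ` is the projection onto
its kernel. -/
def IsCounting (T : LocalForm n p →ₗ[ℝ] LocalForm n p)
    (ρ : LocalForm n p →ₐ[ℝ] LocalForm n p) : Prop := ⨆ j, countSpace T ρ j = ⊤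

section counting

variable {T : LocalForm n p →ₗ[ℝ] LocalForm n p} {ρ : LocalForm n p →ₐ[ℝ] LocalForm n p}

theorem isCounting_of_gen (hT : IsDer 0 T) (h : ∀ x, gen x ∈ ⨆ j, countSpace T ρ j) :
    IsCounting T ρ := by
  have hmul : (⨆ j, countSpace T ρ j) * (⨆ j, countSpace T ρ j) ≤ ⨆ j, countSpace T ρ j := by
    rw [Submodule.iSup_mul]
    refine iSup_le fun i => ?_
    rw [Submodule.mul_iSup]
    refine iSup_le fun j => le_trans (Submodule.mul_le.2 ?_) (le_iSup _ (i + j))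
    rintro x ⟨h1, h2⟩ y ⟨h3, h4⟩
    refine ⟨?_, ?_⟩
    · rw [hT.mul_zero, h1, h3, smul_mul_assoc, mul_smul_comm, ← add_smul, Nat.cast_add]
    · rw [map_mul, h2, h4]
      by_cases hi : i = 0 <;> by_cases hj : j = 0 <;> simp [hi, hj]
  rw [IsCounting, eq_top_iff]
  intro x _
  induction x using LocalForm.induction with
  | halg r =>
    refine Submodule.mem_iSup_of_mem 0 ⟨?_, ?_⟩
    · simp [hT.alg]
    · simp
  | hgen x => exact h x
  | hmul x y hx hy => exact hmul (Submodule.mul_mem_mul (hx trivial) (hy trivial))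
  | hadd x y hx hy => exact add_mem (hx trivial) (hy trivial)

theorem mem_countSpace_zero {x : LocalForm n p} (h1 : T x = 0) (h2 : ρ x = x) :
    x ∈ ⨆ j, countSpace T ρ j :=
  Submodule.mem_iSup_of_mem 0 ⟨by simp [h1], by simp [h2]⟩

theorem mem_countSpace_pos {x : LocalForm n p} {j : ℕ} (hj : j ≠ 0) (h1 : T x = (j : ℝ) • x)
    (h2 : ρ x = 0) : x ∈ ⨆ j, countSpace T ρ j :=
  Submodule.mem_iSup_of_mem j ⟨h1, by simp [h2, hj]⟩

/-- A stable subspace is spanned by eigenvectors. -/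
theorem IsCounting.exists_sum (h : IsCounting T ρ) {Q : Submodule ℝ (LocalForm n p)}
    (hQ : ∀ x ∈ Q, T x ∈ Q) {x : LocalForm n p} (hx : x ∈ Q) :
    ∃ (J : ℕ) (y : ℕ → LocalForm n p), (∀ j < J, y j ∈ Q ∧ y j ∈ countSpace T ρ j) ∧
      x = ∑ j ∈ Finset.range J, y j := by
  have hx' : x ∈ ⨆ j, countSpace T ρ j := by rw [h]; trivial
  obtain ⟨f, hf, hs⟩ := (Submodule.mem_iSup_iff_exists_finsupp _ _).1 hx'
  have hs' : x = ∑ j ∈ Finset.range (f.support.sup id + 1), f j := by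
    rw [← hs, Finsupp.sum]
    refine Finset.sum_subset (fun j hj => Finset.mem_range.2 ?_) (fun j _ hj => by simpa using hj)
    exact Nat.lt_succ_of_le (Finset.le_sup (f := id) hj)
  refine ⟨_, f, fun j hj => ⟨?_, hf j⟩, hs'⟩
  exact eigenvector_mem hQ (fun j _ => (hf j).1) (hs' ▸ hx) j hj

/-- `ρ` fixes the kernel of `T`. -/
theorem IsCounting.eq_of_eq_zero (h : IsCounting T ρ) {x : LocalForm n p} (hx : T x = 0) :
    ρ x = x := by
  obtain ⟨J, y, hy, rfl⟩ := h.exists_sum (Q := LinearMap.ker T)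
    (fun x hx => by rw [LinearMap.mem_ker] at hx ⊢; rw [hx, map_zero]) hx
  rw [map_sum]
  refine Finset.sum_congr rfl fun j hj => ?_
  obtain ⟨h1, h2, h3⟩ := hy j (Finset.mem_range.1 hj)
  rcases eq_or_ne j 0 with rfl | hj0
  · simpa using h3
  · rw [LinearMap.mem_ker.1 h1] at h2
    rw [(smul_eq_zero.1 h2.symm).resolve_left (by exact_mod_cast hj0), map_zero]

end counting

/-! ### The algebraic Poincaré lemma -/

/-- The antiderivation `∂ / ∂(dx^ν)`. -/
noncomputable def iota (ν : Fin n) : LocalForm n p →ₗ[ℝ] LocalForm n p :=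
  derOf 1 (fun x => match x with
    | .dx μ => if μ = ν then 1 else 0
    | .fld _ _ _ _ _ => 0)
    (fun x => by
      cases x with
      | dx μ =>
        dsimp only
        split_ifs
        · rw [← map_one (algebraMap ℝ (LocalForm n p))]
          exact HasParity.algebraMap (show Even (1 + 1) by decide) 1
        · exact HasParity.zero _
      | fld a l hl μ α => exact HasParity.zero _)
    (fun a l hl μ α σ => by simp)

theorem iota_isDer (ν : Fin n) : IsDer 1 (iota ν : LocalForm n p →ₗ[ℝ] LocalForm n p) :=
  derOf_isDer _ _ _ _

theorem iota_dx (ν μ : Fin n) : iota ν (dx n p μ) = if μ = ν then 1 else 0 := derOf_gen _ _ _ _ _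

theorem iota_fld (ν : Fin n) (a : ι) (l : ℕ) (hl : l ≤ p a) (μ : Fin l → Fin n)
    (α : Multiset (Fin n)) : iota ν (fld a l hl μ α) = 0 := derOf_gen _ _ _ _ _

/-- The derivation `∂ / ∂(∂_ν)`, which removes a derivative. -/
noncomputable def unpd (ν : Fin n) : LocalForm n p →ₗ[ℝ] LocalForm n p :=
  derOf 0 (fun x => match x with
    | .dx _ => 0
    | .fld a l hl μ α => (α.count ν : ℝ) • fld a l hl μ (α.erase ν))
    (fun x => by
      cases x with
      | dx μ => exact HasParity.zero _
      | fld a l hl μ α => exact (HasParity.fld a l hl μ (α.erase ν)).smul _)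
    (fun a l hl μ α σ => by
      dsimp only
      rw [fld_perm, smul_comm])

theorem unpd_isDer (ν : Fin n) : IsDer 0 (unpd ν : LocalForm n p →ₗ[ℝ] LocalForm n p) :=
  derOf_isDer _ _ _ _

theorem unpd_dx (ν μ : Fin n) : unpd ν (dx n p μ) = 0 := derOf_gen _ _ _ _ _

theorem unpd_fld (ν : Fin n) (a : ι) (l : ℕ) (hl : l ≤ p a) (μ : Fin l → Fin n)
    (α : Multiset (Fin n)) :
    unpd ν (fld a l hl μ α) = (α.count ν : ℝ) • (fld a l hl μ (α.erase ν) : LocalForm n p) :=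
  derOf_gen _ _ _ _ _

/-- The derivation that counts the fields and ghosts. -/
noncomputable def num : LocalForm n p →ₗ[ℝ] LocalForm n p :=
  derOf 0 (fun x => match x with
    | .dx _ => 0
    | .fld a l hl μ α => fld a l hl μ α)
    (fun x => by
      cases x with
      | dx μ => exact HasParity.zero _
      | fld a l hl μ α => exact HasParity.fld a l hl μ α)
    (fun a l hl μ α σ => fld_perm a l hl μ α σ)

theorem num_isDer : IsDer 0 (num : LocalForm n p →ₗ[ℝ] LocalForm n p) := derOf_isDer _ _ _ _

theorem num_dx (μ : Fin n) : num (dx n p μ) = 0 := derOf_gen _ _ _ _ _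

theorem num_fld (a : ι) (l : ℕ) (hl : l ≤ p a) (μ : Fin l → Fin n)
    (α : Multiset (Fin n)) : num (fld a l hl μ α) = (fld a l hl μ α : LocalForm n p) :=
  derOf_gen _ _ _ _ _

/-- The homomorphism that sets all fields and ghosts to zero. -/
noncomputable def constPart : LocalForm n p →ₐ[ℝ] LocalForm n p :=
  evenHom (fun x => match x with
    | .dx μ => dx n p μ
    | .fld _ _ _ _ _ => 0)
    (fun x => by
      cases x with
      | dx μ => exact HasParity.dx μ
      | fld a l hl μ α => exact HasParity.zero _)
    (fun a l hl μ α σ => by simp)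

theorem constPart_dx (μ : Fin n) : constPart (dx n p μ) = dx n p μ := evenHom_gen _ _ _ _

theorem constPart_fld (a : ι) (l : ℕ) (hl : l ≤ p a) (μ : Fin l → Fin n)
    (α : Multiset (Fin n)) : constPart (fld a l hl μ α : LocalForm n p) = 0 := evenHom_gen _ _ _ _

theorem isCounting_num : IsCounting (num : LocalForm n p →ₗ[ℝ] LocalForm n p) constPart := by
  refine isCounting_of_gen num_isDer fun x => ?_
  cases x with
  | dx μ => exact mem_countSpace_zero (num_dx μ) (constPart_dx μ)
  | fld a l hl μ α =>
    exact mem_countSpace_pos one_ne_zero (by rw [gen_fld, num_fld]; simp) (constPart_fld a l hl μ α)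

theorem dx_mul_isDer (ν : Fin n) {e : ℕ} {D : LocalForm n p →ₗ[ℝ] LocalForm n p}
    (h : IsDer (e + 1) D) : IsDer e (LinearMap.mulLeft ℝ (dx n p ν) ∘ₗ D) where
  mul a b := by
    simp only [LinearMap.comp_apply, LinearMap.mulLeft_apply, h.mul, mul_add, ← mul_assoc]
    rw [dx_mul ν (tw (e + 1) a), tw_tw, show 1 + (e + 1) = 2 * 1 + e by ring, ← tw_tw, tw_two_mul]
  alg r := by simp [h.alg]
  map_tw_one a := by
    simp only [LinearMap.comp_apply, LinearMap.mulLeft_apply, h.map_tw_one, map_mul, tw_dx]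
    simp [pow_succ]

/-- `dx^μ ∂ / ∂(dx^μ)` counts the form degree. -/
theorem sum_dx_iota {k : ℕ} {x : LocalForm n p} (hx : x ∈ formsOfDegree n p k) :
    ∑ ν, dx n p ν * iota ν x = (k : ℝ) • x := by
  have hder : IsDer 0 (∑ ν, LinearMap.mulLeft ℝ (dx n p ν) ∘ₗ iota ν) :=
    IsDer.sum fun ν _ => dx_mul_isDer ν (iota_isDer ν)
  have key : (∑ ν, LinearMap.mulLeft ℝ (dx n p ν) ∘ₗ iota ν) x = (k : ℝ) • x := by
    induction hx using Submodule.span_induction with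
    | mem x hL =>
      obtain ⟨L, rfl, rfl⟩ := hL
      induction L with
      | nil => simp [hder.one]
      | cons x L ih =>
        have hx : (∑ ν, LinearMap.mulLeft ℝ (dx n p ν) ∘ₗ iota ν) (gen x) =
            (x.formDeg : ℝ) • gen x := by
          cases x with
          | dx μ => simp [gen_dx, iota_dx, Gen.formDeg]
          | fld a l hl μ α => simp [gen_fld, iota_fld, Gen.formDeg]
        rw [List.map_cons, List.map_cons, List.prod_cons, hder.mul_zero, List.sum_cons, ih, hx]
        simp [add_smul]
    | zero => simp
    | add x y _ _ hx hy => rw [map_add, hx, hy, smul_add]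
    | smul t x _ hx => rw [map_smul, hx, smul_comm]
  simpa using key

theorem iota_dx_mul (ν μ : Fin n) (x : LocalForm n p) :
    iota ν (dx n p μ * x) = (if μ = ν then x else 0) - dx n p μ * iota ν x := by
  rw [(iota_isDer ν).mul, iota_dx, tw_dx, neg_mul, sub_eq_add_neg]
  split_ifs <;> simp

theorem num_pd (ν : Fin n) (x : LocalForm n p) : num (pd ν x) = pd ν (num x) := by
  refine num_isDer.commute (pd_isDer ν) (fun x => ?_) x
  cases x with
  | dx μ => simp [gen_dx, num_dx, pd_dx]
  | fld a l hl μ α => simp [gen_fld, num_fld, pd_fld]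

theorem num_unpd (ν : Fin n) (x : LocalForm n p) : num (unpd ν x) = unpd ν (num x) := by
  refine num_isDer.commute (unpd_isDer ν) (fun x => ?_) x
  cases x with
  | dx μ => simp [gen_dx, num_dx, unpd_dx]
  | fld a l hl μ α => simp [gen_fld, num_fld, unpd_fld]

theorem num_brst (x : LocalForm n p) : num (brst x) = brst (num x) := by
  refine num_isDer.commute brst_isDer (fun x => ?_) x
  cases x with
  | dx μ => simp [gen_dx, num_dx, brst_dx]
  | fld a l hl μ α =>
    cases l with
    | zero => simp [gen_fld, num_fld, brst_fld_zero]
    | succ l => simp [gen_fld, num_fld, brst_fld_succ]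

theorem num_extD (x : LocalForm n p) : num (extD x) = extD (num x) := by
  simp [extD_apply, num_isDer.mul_zero, num_dx, num_pd]

theorem iota_pd (ν ρ : Fin n) (x : LocalForm n p) : pd ρ (iota ν x) = iota ν (pd ρ x) := by
  refine (pd_isDer ρ).commute (iota_isDer ν) (fun x => ?_) x
  cases x with
  | dx μ =>
    rw [gen_dx, iota_dx, pd_dx, map_zero]
    split_ifs
    · exact (pd_isDer ρ).one
    · simp
  | fld a l hl μ α => simp [gen_fld, iota_fld, pd_fld]

/-- The derivations `∂_ρ` and `∂ / ∂(∂_ν)` satisfy the Heisenberg relations. -/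
theorem unpd_pd (ν ρ : Fin n) (x : LocalForm n p) :
    unpd ν (pd ρ x) = pd ρ (unpd ν x) + if ν = ρ then num x else 0 := by
  have h := ((unpd_isDer ν).comm_even (pd_isDer ρ)).ext (num_isDer.smul (if ν = ρ then 1 else 0))
    (fun x => by
      cases x with
      | dx μ => split_ifs <;> simp [gen_dx, unpd_dx, pd_dx, num_dx]
      | fld a l hl μ α =>
        simp only [LinearMap.sub_apply, LinearMap.comp_apply, LinearMap.smul_apply, gen_fld,
          pd_fld, unpd_fld, num_fld, map_smul]
        by_cases h : ν = ρ
        · subst h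
          rw [Multiset.count_cons_self, Multiset.erase_cons_head, if_pos rfl]
          by_cases hm : ν ∈ α
          · rw [Multiset.cons_erase hm]
            push_cast
            rw [add_smul, add_sub_cancel_left]
          · rw [Multiset.count_eq_zero.2 hm]
            simp
        · rw [Multiset.count_cons_of_ne h, if_neg h, Multiset.erase_cons_tail _ (Ne.symm h)]
          simp) x
  simp only [LinearMap.sub_apply, LinearMap.comp_apply, LinearMap.smul_apply] at h
  rw [sub_eq_iff_eq_add'] at h
  rw [h]
  split_ifs <;> simp

/-- The homotopy `∂ / ∂(dx^ν) ∘ ∂ / ∂(∂_ν)` of the algebraic Poincaré lemma. -/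
noncomputable def htpy : LocalForm n p →ₗ[ℝ] LocalForm n p := ∑ ν, iota ν ∘ₗ unpd ν

/-- The operator `∂_ν ∘ ∂ / ∂(∂_ν)`. -/
noncomputable def dil : LocalForm n p →ₗ[ℝ] LocalForm n p := ∑ ν, pd ν ∘ₗ unpd ν

theorem htpy_apply (x : LocalForm n p) : htpy x = ∑ ν, iota ν (unpd ν x) := by simp [htpy]

theorem dil_apply (x : LocalForm n p) : dil x = ∑ ν, pd ν (unpd ν x) := by simp [dil]

theorem extD_htpy {k : ℕ} {x : LocalForm n p} (hx : x ∈ formsOfDegree n p k) {c : ℝ}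
    (hc : num x = c • x) :
    extD (htpy x) + htpy (extD x) = dil x + (c * ((n : ℝ) - k)) • x := by
  have h1 : extD (htpy x) = ∑ ν, ∑ ρ, dx n p ρ * iota ν (pd ρ (unpd ν x)) := by
    rw [extD_apply, htpy_apply, Finset.sum_comm]
    refine Finset.sum_congr rfl fun ρ _ => ?_
    rw [map_sum, Finset.mul_sum]
    simp only [iota_pd]
  have h2 : htpy (extD x) = ∑ ν, (pd ν (unpd ν x) + num x) -
      ∑ ν, ∑ ρ, dx n p ρ * iota ν (pd ρ (unpd ν x)) - ∑ ν, dx n p ν * iota ν (num x) := by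
    rw [htpy_apply, ← Finset.sum_sub_distrib, ← Finset.sum_sub_distrib]
    refine Finset.sum_congr rfl fun ν _ => ?_
    rw [extD_apply, map_sum, map_sum]
    simp only [(unpd_isDer ν).mul_zero, unpd_dx, zero_mul, zero_add, iota_dx_mul,
      Finset.sum_sub_distrib, Finset.sum_ite_eq', Finset.mem_univ, if_true]
    simp only [unpd_pd, if_true, map_add, mul_add, Finset.sum_add_distrib]
    rw [sub_sub]
    congr 2
    rw [Finset.sum_eq_single ν]
    · simp
    · intro ρ _ hρ
      simp [Ne.symm hρ]
    · simp
  have h3 : ∑ ν, dx n p ν * iota ν (num x) = (c * k) • x := by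
    simp only [hc, map_smul, mul_smul_comm]
    rw [← Finset.smul_sum, sum_dx_iota hx, smul_smul]
  rw [h1, h2, h3, Finset.sum_add_distrib, ← dil_apply, Finset.sum_const, Finset.card_univ,
    Fintype.card_fin, hc, mul_sub, sub_smul, ← Nat.cast_smul_eq_nsmul ℝ, smul_smul, mul_comm c n]
  abel

/-- `x` is annihilated by all products of `M` of the derivations `∂ / ∂(∂_ν)`. -/
def UnpdNilpotent : ℕ → LocalForm n p → Prop
  | 0, x => x = 0
  | M + 1, x => ∀ ν, UnpdNilpotent M (unpd ν x)

theorem UnpdNilpotent.zero (M : ℕ) : UnpdNilpotent M (0 : LocalForm n p) := by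
  induction M with
  | zero => rfl
  | succ M ih => intro ν; rwa [map_zero]

theorem UnpdNilpotent.succ {M : ℕ} {x : LocalForm n p} (h : UnpdNilpotent M x) :
    UnpdNilpotent (M + 1) x := by
  induction M generalizing x with
  | zero => intro ν; rw [show x = 0 from h, map_zero]; rfl
  | succ M ih => intro ν; exact ih (h ν)

theorem UnpdNilpotent.mono {M M' : ℕ} (hM : M ≤ M') {x : LocalForm n p} (h : UnpdNilpotent M x) :
    UnpdNilpotent M' x := by
  induction M', hM using Nat.le_induction with
  | base => exact h
  | succ M' _ ih => exact ih.succ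

theorem UnpdNilpotent.add {M : ℕ} {x y : LocalForm n p} (hx : UnpdNilpotent M x)
    (hy : UnpdNilpotent M y) : UnpdNilpotent M (x + y) := by
  induction M generalizing x y with
  | zero => rw [show x = 0 from hx, show y = 0 from hy, add_zero]; rfl
  | succ M ih => intro ν; rw [map_add]; exact ih (hx ν) (hy ν)

theorem UnpdNilpotent.smul {M : ℕ} {x : LocalForm n p} (t : ℝ) (hx : UnpdNilpotent M x) :
    UnpdNilpotent M (t • x) := by
  induction M generalizing x with
  | zero => rw [show x = 0 from hx, smul_zero]; rfl
  | succ M ih => intro ν; rw [map_smul]; exact ih (hx ν)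

theorem UnpdNilpotent.mul {M M' : ℕ} {x y : LocalForm n p} (hx : UnpdNilpotent M x)
    (hy : UnpdNilpotent M' y) : UnpdNilpotent (M + M') (x * y) := by
  induction hN : M + M' generalizing M M' x y with
  | zero =>
    obtain rfl : M = 0 := by omega
    rw [show x = 0 from hx, zero_mul]
    rfl
  | succ N ih =>
    cases M with
    | zero => rw [show x = 0 from hx, zero_mul]; exact UnpdNilpotent.zero _
    | succ M =>
      cases M' with
      | zero => rw [show y = 0 from hy, mul_zero]; exact UnpdNilpotent.zero _
      | succ M' =>
        intro ν
        rw [(unpd_isDer ν).mul_zero]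
        exact (ih (hx ν) hy (by omega)).add (ih hx (hy ν) (by omega))

theorem exists_unpdNilpotent (x : LocalForm n p) : ∃ M, UnpdNilpotent M x := by
  induction x using LocalForm.induction with
  | halg r => exact ⟨1, fun ν => (unpd_isDer ν).alg r⟩
  | hgen x =>
    cases x with
    | dx μ => exact ⟨1, fun ν => unpd_dx ν μ⟩
    | fld a l hl μ α =>
      have key : ∀ M α, α.card ≤ M → UnpdNilpotent (M + 1) (fld a l hl μ α : LocalForm n p) := by
        intro M
        induction M with
        | zero =>
          intro α hα ν
          rw [Multiset.card_eq_zero.1 (Nat.le_zero.1 hα), unpd_fld]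
          simp [UnpdNilpotent]
        | succ M ih =>
          intro α hα ν
          rw [unpd_fld]
          by_cases hm : ν ∈ α
          · refine UnpdNilpotent.smul _ (ih _ ?_)
            rw [Multiset.card_erase_of_mem hm, Nat.pred_eq_sub_one]
            omega
          · rw [Multiset.count_eq_zero.2 hm, Nat.cast_zero, zero_smul]
            exact UnpdNilpotent.zero _
      exact ⟨_, key _ α le_rfl⟩
  | hmul x y hx hy =>
    obtain ⟨M, hM⟩ := hx
    obtain ⟨M', hM'⟩ := hy
    exact ⟨_, hM.mul hM'⟩
  | hadd x y hx hy =>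
    obtain ⟨M, hM⟩ := hx
    obtain ⟨M', hM'⟩ := hy
    exact ⟨max M M', (hM.mono (le_max_left _ _)).add (hM'.mono (le_max_right _ _))⟩

theorem num_dil (x : LocalForm n p) : num (dil x) = dil (num x) := by
  simp [dil_apply, num_pd, num_unpd]

theorem dil_pd (ν : Fin n) {x : LocalForm n p} {c : ℝ} (hc : num x = c • x) :
    dil (pd ν x) = pd ν (dil x) + c • pd ν x := by
  rw [dil_apply, dil_apply, map_sum]
  simp only [unpd_pd, map_add, Finset.sum_add_distrib]
  congr 1
  · exact Finset.sum_congr rfl fun ρ _ => pd_pd ρ ν _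
  · rw [Finset.sum_eq_single ν]
    · simp [hc]
    · intro ρ _ hρ
      simp [hρ]
    · simp

/-- The product of the operators `dil - c (m + i)` for `i < M`. -/
noncomputable def dilProd (c : ℝ) : ℕ → ℕ → LocalForm n p →ₗ[ℝ] LocalForm n p
  | 0, _ => LinearMap.id
  | M + 1, m => dilProd c M (m + 1) ∘ₗ (dil - (c * m) • LinearMap.id)

theorem dilProd_succ (c : ℝ) (M m : ℕ) (x : LocalForm n p) :
    dilProd c (M + 1) m x = dilProd c M (m + 1) (dil x - (c * m) • x) := rfl

theorem dilProd_pd (c : ℝ) (M m : ℕ) (ν : Fin n) {x : LocalForm n p} (hc : num x = c • x) :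
    dilProd c M (m + 1) (pd ν x) = pd ν (dilProd c M m x) := by
  induction M generalizing m x with
  | zero => rfl
  | succ M ih =>
    rw [dilProd_succ, dilProd_succ, dil_pd ν hc, ← ih]
    · congr 1
      rw [map_sub, map_smul]
      push_cast
      rw [mul_add, mul_one, add_smul]
      abel
    · rw [map_sub, num_dil, hc, map_smul, map_smul, hc, smul_sub, smul_comm]

/-- On the elements of field number `c`, the eigenvalues of `dil` are multiples of `c`. -/
theorem dilProd_eq_zero {c : ℝ} {M : ℕ} {x : LocalForm n p} (h : UnpdNilpotent M x)
    (hc : num x = c • x) : dilProd c M 0 x = 0 := by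
  induction M generalizing x with
  | zero => exact h
  | succ M ih =>
    rw [dilProd_succ, Nat.cast_zero, mul_zero, zero_smul, sub_zero, dil_apply, map_sum]
    refine Finset.sum_eq_zero fun ν _ => ?_
    have hν : num (unpd ν x) = c • unpd ν x := by rw [num_unpd, hc, map_smul]
    rw [dilProd_pd c M 0 ν hν, ih (h ν) hν, map_zero]

theorem unpd_mem_formsOfDegree (ν : Fin n) (k : ℕ) :
    ∀ x ∈ formsOfDegree n p k, unpd ν x ∈ formsOfDegree n p (k + 0) := by
  refine (unpd_isDer ν).map_formsOfDegree (fun x => ?_) k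
  cases x with
  | dx μ => rw [gen_dx, unpd_dx]; exact zero_mem _
  | fld a l hl μ α =>
    rw [gen_fld, unpd_fld]
    exact Submodule.smul_mem _ _ (fld_mem_formsOfDegree _ _ _ _ _)

theorem num_mem_formsOfDegree (k : ℕ) :
    ∀ x ∈ formsOfDegree n p k, num x ∈ formsOfDegree n p (k + 0) := by
  refine num_isDer.map_formsOfDegree (fun x => ?_) k
  cases x with
  | dx μ => rw [gen_dx, num_dx]; exact zero_mem _
  | fld a l hl μ α => rw [gen_fld, num_fld]; exact fld_mem_formsOfDegree _ _ _ _ _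

theorem dil_mem_formsOfDegree {k : ℕ} {x : LocalForm n p} (hx : x ∈ formsOfDegree n p k) :
    dil x ∈ formsOfDegree n p k := by
  rw [dil_apply]
  exact Submodule.sum_mem _ fun ν _ => pd_mem_formsOfDegree ν k _ (unpd_mem_formsOfDegree ν k x hx)

/-- A closed form of degree smaller than `n` that contains fields or ghosts is exact. -/
theorem exists_eq_extD {Q : Submodule ℝ (LocalForm n p)} (hQd : ∀ x ∈ Q, extD x ∈ Q)
    (hQh : ∀ x ∈ Q, htpy x ∈ Q) {k : ℕ} (hk : k < n) {c : ℝ} (hc : 0 < c) {x : LocalForm n p}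
    (hx : x ∈ Q) (hxk : x ∈ formsOfDegree n p k) (hxc : num x = c • x) (hdx : extD x = 0) :
    ∃ y ∈ Q, x = extD y := by
  have key : ∀ M m, ∀ x ∈ Q, x ∈ formsOfDegree n p k → num x = c • x → extD x = 0 →
      dilProd c M m x = 0 → ∃ y ∈ Q, x = extD y := by
    intro M
    induction M with
    | zero =>
      intro m x _ _ _ _ h
      exact ⟨0, zero_mem _, by rw [map_zero]; exact h⟩
    | succ M ih =>
      intro m x hx hxk hxc hdx h
      have e := extD_htpy hxk hxc
      rw [hdx, map_zero, add_zero] at e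
      have e' : dil x = extD (htpy x) - (c * ((n : ℝ) - k)) • x := by rw [e, add_sub_cancel_right]
      obtain ⟨y, hy, hxy⟩ := ih (m + 1) (dil x - (c * m) • x)
        (Q.sub_mem (by rw [e']; exact Q.sub_mem (hQd _ (hQh _ hx)) (Q.smul_mem _ hx))
          (Q.smul_mem _ hx))
        (sub_mem (dil_mem_formsOfDegree hxk) (Submodule.smul_mem _ _ hxk))
        (by rw [map_sub, num_dil, hxc, map_smul, map_smul, hxc, smul_sub, smul_comm])
        (by rw [e', map_sub, map_sub, extD_extD, map_smul, map_smul, hdx]; simp) h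
      have hpos : c * ((n : ℝ) - k) + c * m ≠ 0 := by
        have h1 : (0 : ℝ) < (n : ℝ) - k := sub_pos.2 (by exact_mod_cast hk)
        positivity
      refine ⟨(c * ((n : ℝ) - k) + c * m)⁻¹ • (htpy x - y), Q.smul_mem _ (Q.sub_mem (hQh _ hx) hy),
        ?_⟩
      have e2 : extD (htpy x - y) = (c * ((n : ℝ) - k) + c * m) • x := by
        rw [map_sub, ← hxy, e, add_smul]
        abel
      rw [map_smul, e2, smul_smul, inv_mul_cancel₀ hpos, one_smul]
  obtain ⟨M, hM⟩ := exists_unpdNilpotent x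
  exact key M 0 x hx hxk hxc hdx (dilProd_eq_zero hM hxc)

/-- The algebraic Poincaré lemma: a closed form of degree smaller than `n` is the sum of a form
with constant coefficients and of an exact form. -/
theorem exists_eq_add_extD {Q : Submodule ℝ (LocalForm n p)} (hQd : ∀ x ∈ Q, extD x ∈ Q)
    (hQh : ∀ x ∈ Q, htpy x ∈ Q) (hQn : ∀ x ∈ Q, num x ∈ Q) {k : ℕ} (hk : k < n)
    {x : LocalForm n p} (hx : x ∈ Q) (hxk : x ∈ formsOfDegree n p k) (hdx : extD x = 0) :
    ∃ x₀ ∈ Q, ∃ y ∈ Q, x₀ ∈ formsOfDegree n p k ∧ num x₀ = 0 ∧ x = x₀ + extD y := by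
  obtain ⟨J, y, hy, rfl⟩ := isCounting_num.exists_sum
    (Q := Q ⊓ formsOfDegree n p k ⊓ LinearMap.ker extD)
    (fun x hx => ⟨⟨hQn x hx.1.1, num_mem_formsOfDegree k x hx.1.2⟩, by
      change extD (num x) = 0
      rw [← num_extD, LinearMap.mem_ker.1 hx.2, map_zero]⟩)
    (x := x) ⟨⟨hx, hxk⟩, hdx⟩
  have key : ∀ j ∈ Finset.range J, ∃ z ∈ Q, y j = (if j = 0 then y j else 0) + extD z := by
    intro j hj
    obtain ⟨⟨⟨h1, h2⟩, h3⟩, h4, -⟩ := hy j (Finset.mem_range.1 hj)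
    split_ifs with hj0
    · exact ⟨0, zero_mem _, by simp⟩
    · obtain ⟨z, hz, h⟩ := exists_eq_extD hQd hQh hk (c := j)
        (by exact_mod_cast Nat.pos_of_ne_zero hj0) h1 h2 h4 h3
      exact ⟨z, hz, by rw [zero_add, h]⟩
  choose! z hz hyz using key
  refine ⟨∑ j ∈ Finset.range J, if j = 0 then y j else 0, ?_, ∑ j ∈ Finset.range J, z j,
    Q.sum_mem hz, ?_, ?_, ?_⟩
  · refine Q.sum_mem fun j hj => ?_
    split_ifs
    · exact (hy j (Finset.mem_range.1 hj)).1.1.1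
    · exact zero_mem _
  · refine Submodule.sum_mem _ fun j hj => ?_
    split_ifs
    · exact (hy j (Finset.mem_range.1 hj)).1.1.2
    · exact zero_mem _
  · rw [map_sum]
    refine Finset.sum_eq_zero fun j hj => ?_
    split_ifs with h
    · rw [(hy j (Finset.mem_range.1 hj)).2.1, h]
      simp
    · exact map_zero _
  · rw [map_sum, ← Finset.sum_add_distrib]
    exact Finset.sum_congr rfl hyz

/-! ### The cohomology of `γ` -/

/-- The linear span of the components of form degree `l` of the fields and ghosts `B^a` with `m`
derivatives. -/
def fldSpan (n : ℕ) (p : ι → ℕ) (a : ι) (l m : ℕ) : Submodule ℝ (LocalForm n p) :=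
  Submodule.span ℝ {x | ∃ (hl : l ≤ p a) (μ : Fin l → Fin n) (α : Multiset (Fin n)),
    α.card = m ∧ x = fld a l hl μ α}

theorem fld_mem_fldSpan (a : ι) (l : ℕ) (hl : l ≤ p a) (μ : Fin l → Fin n)
    {α : Multiset (Fin n)} {m : ℕ} (hα : α.card = m) : fld a l hl μ α ∈ fldSpan n p a l m :=
  Submodule.subset_span ⟨hl, μ, α, hα, rfl⟩

/-- The derivation `γ`, with the `l!` permutations that give the same term collected. -/
theorem brst_fld_eq_sum (a : ι) (l : ℕ) (hl : l + 1 ≤ p a) (μ : Fin (l + 1) → Fin n)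
    (α : Multiset (Fin n)) :
    brst (fld a (l + 1) hl μ α : LocalForm n p) = ((-1 : ℝ) ^ (p a - (l + 1))) •
      ∑ j : Fin (l + 1), (if j = 0 then (1 : ℝ) else -1) •
        fld a l (Nat.le_of_succ_le hl) (fun i => μ (Equiv.swap 0 j i.succ)) (μ j ::ₘ α) := by
  rw [brst_fld_succ, div_eq_mul_inv, mul_smul]
  congr 1
  rw [← Equiv.sum_comp (Equiv.Perm.decomposeFin (n := l)).symm, Fintype.sum_prod_type,
    Finset.smul_sum]
  refine Finset.sum_congr rfl fun j _ => ?_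
  have h : ∀ τ : Equiv.Perm (Fin l),
      (((Equiv.Perm.decomposeFin.symm (j, τ)).sign : ℤ) : ℝ) •
        (fld a l (Nat.le_of_succ_le hl)
          (fun i => μ (Equiv.Perm.decomposeFin.symm (j, τ) i.succ))
          (μ (Equiv.Perm.decomposeFin.symm (j, τ) 0) ::ₘ α) : LocalForm n p) =
      (if j = 0 then (1 : ℝ) else -1) •
        fld a l (Nat.le_of_succ_le hl) (fun i => μ (Equiv.swap 0 j i.succ)) (μ j ::ₘ α) := by
    intro τ
    have e := fld_perm (p := p) a l (Nat.le_of_succ_le hl) (fun i => μ (Equiv.swap 0 j i.succ))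
      (μ j ::ₘ α) τ
    have e' : (fun i => μ (Equiv.Perm.decomposeFin.symm (j, τ) i.succ)) =
        (fun i => μ (Equiv.swap 0 j i.succ)) ∘ τ := by
      funext i
      simp
    rw [e', Equiv.Perm.decomposeFin_symm_apply_zero, e, smul_smul,
      Equiv.Perm.decomposeFin.symm_sign]
    congr 1
    rcases Int.units_eq_one_or τ.sign with h | h <;> split_ifs <;> simp [h]
  rw [Finset.sum_congr rfl fun τ _ => h τ, Finset.sum_const, Finset.card_univ, Fintype.card_perm,
    Fintype.card_fin, ← Nat.cast_smul_eq_nsmul ℝ, smul_smul,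
    inv_mul_cancel₀ (by exact_mod_cast Nat.factorial_ne_zero l), one_smul]

theorem sum_smul_smul_comm {J M : Type*} [AddCommGroup M] [Module ℝ M] (s : Finset J) (c : ℝ)
    (t : J → ℝ) (f : J → M) : ∑ j ∈ s, t j • c • f j = c • ∑ j ∈ s, t j • f j := by
  rw [Finset.smul_sum]
  exact Finset.sum_congr rfl fun j _ => smul_comm _ _ _

/-- Values of the homotopy `σ` on the generators: it turns a derivative into a further antisymmetric
index. -/
noncomputable def kosGen : Gen n p → LocalForm n p
  | .dx _ => 0
  | .fld a l _ μ α => if h : l < p a then (-1 : ℝ) ^ (p a - (l + 1)) •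
      ∑ ν, (α.count ν : ℝ) • fld a (l + 1) h (Fin.cons ν μ : Fin (l + 1) → Fin n) (α.erase ν)
    else 0

/-- The homotopy `σ` for `γ`. On the linear span of the derivatives of the components, `γ` and `σ`
are the two differentials of the Koszul complex. -/
noncomputable def kos : LocalForm n p →ₗ[ℝ] LocalForm n p :=
  derOf 1 kosGen
    (fun x => by
      cases x with
      | dx μ => exact HasParity.zero _
      | fld a l hl μ α =>
        simp only [kosGen, Gen.deg]
        split_ifs with h
        · refine HasParity.smul _ (HasParity.sum _ fun ν _ => HasParity.smul _ ?_)
          exact (HasParity.fld a (l + 1) h _ _).congr ⟨p a - l, by omega⟩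
        · exact HasParity.zero _)
    (fun a l hl μ α σ => by
      simp only [kosGen]
      split_ifs with h
      · rw [smul_comm ((σ.sign : ℤ) : ℝ)]
        congr 1
        rw [← sum_smul_smul_comm]
        refine Finset.sum_congr rfl fun ν _ => ?_
        congr 1
        have e := fld_perm (p := p) a (l + 1) h (Fin.cons ν μ : Fin (l + 1) → Fin n) (α.erase ν)
          (Equiv.Perm.decomposeFin.symm (0, σ))
        have e' : (Fin.cons ν μ : Fin (l + 1) → Fin n) ∘ Equiv.Perm.decomposeFin.symm (0, σ) =
            Fin.cons ν (μ ∘ σ) := by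
          funext i
          refine Fin.cases ?_ (fun i => ?_) i <;> simp
        rw [e'] at e
        rw [e]
        simp
      · simp)

theorem kos_isDer : IsDer 1 (kos : LocalForm n p →ₗ[ℝ] LocalForm n p) := derOf_isDer _ _ _ _

theorem kos_dx (μ : Fin n) : kos (dx n p μ) = 0 := derOf_gen _ _ _ _ _

theorem kos_fld (a : ι) (l : ℕ) (hl : l ≤ p a) (h : l < p a) (μ : Fin l → Fin n)
    (α : Multiset (Fin n)) :
    kos (fld a l hl μ α : LocalForm n p) = (-1 : ℝ) ^ (p a - (l + 1)) •
      ∑ ν, (α.count ν : ℝ) •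
        fld a (l + 1) h (Fin.cons ν μ : Fin (l + 1) → Fin n) (α.erase ν) :=
  (derOf_gen _ _ _ _ _).trans (dif_pos h)

theorem kos_fld_top (a : ι) (l : ℕ) (hl : l ≤ p a) (h : ¬ l < p a) (μ : Fin l → Fin n)
    (α : Multiset (Fin n)) : kos (fld a l hl μ α : LocalForm n p) = 0 :=
  (derOf_gen _ _ _ _ _).trans (dif_neg h)

/-- The anticommutator of `γ` and `σ`. -/
noncomputable def lap : LocalForm n p →ₗ[ℝ] LocalForm n p := brst ∘ₗ kos + kos ∘ₗ brst

theorem lap_apply (x : LocalForm n p) : lap x = brst (kos x) + kos (brst x) := rfl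

theorem lap_isDer : IsDer 0 (lap : LocalForm n p →ₗ[ℝ] LocalForm n p) :=
  brst_isDer.comm_odd kos_isDer

theorem lap_brst (x : LocalForm n p) : lap (brst x) = brst (lap x) := by
  simp [lap_apply, brst_brst]

/-- `∂_ν` with the Leibniz rule: the derivative `ρ` is removed first, or one of the others. -/
theorem sum_count_cons {M : Type*} [AddCommGroup M] [Module ℝ M] (ρ : Fin n)
    (α : Multiset (Fin n)) (G : Fin n → Multiset (Fin n) → M) :
    ∑ ν, ((ρ ::ₘ α).count ν : ℝ) • G ν ((ρ ::ₘ α).erase ν) =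
      G ρ α + ∑ ν, (α.count ν : ℝ) • G ν (ρ ::ₘ α.erase ν) := by
  have h : ∀ ν, ((ρ ::ₘ α).count ν : ℝ) • G ν ((ρ ::ₘ α).erase ν) =
      (if ν = ρ then G ν α else 0) + (α.count ν : ℝ) • G ν (ρ ::ₘ α.erase ν) := by
    intro ν
    by_cases h : ν = ρ
    · subst h
      rw [Multiset.count_cons_self, Multiset.erase_cons_head, if_pos rfl]
      by_cases hm : ν ∈ α
      · rw [Multiset.cons_erase hm]
        push_cast
        rw [add_smul, one_smul, add_comm]
      · rw [Multiset.count_eq_zero.2 hm]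
        simp
    · rw [Multiset.count_cons_of_ne h, if_neg h, Multiset.erase_cons_tail _ (Ne.symm h), zero_add]
  simp only [h, Finset.sum_add_distrib, Finset.sum_ite_eq', Finset.mem_univ, if_true]

theorem neg_one_pow_smul_smul {M : Type*} [AddCommGroup M] [Module ℝ M] (k : ℕ) (x : M) :
    (-1 : ℝ) ^ k • (-1 : ℝ) ^ k • x = x := by
  rw [smul_smul, ← pow_add, ← two_mul, pow_mul]
  simp

/-- The exchange of an antisymmetric index with a derivative. -/
noncomputable def exch (a : ι) (l : ℕ) (hl : l ≤ p a) (μ : Fin l → Fin n) (α : Multiset (Fin n)) :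
    LocalForm n p :=
  ∑ ν, (α.count ν : ℝ) • ∑ j, fld a l hl (Function.update μ j ν) (μ j ::ₘ α.erase ν)

theorem brst_kos_fld (a : ι) (l : ℕ) (hl : l ≤ p a) (h : l < p a) (μ : Fin l → Fin n)
    (α : Multiset (Fin n)) :
    brst (kos (fld a l hl μ α : LocalForm n p)) =
      (α.card : ℝ) • fld a l hl μ α - exch a l hl μ α := by
  rw [kos_fld a l hl h, map_smul, map_sum]
  simp only [map_smul, brst_fld_eq_sum]
  rw [sum_smul_smul_comm, neg_one_pow_smul_smul]
  have h1 : ∀ ν : Fin n, (α.count ν : ℝ) • ∑ j : Fin (l + 1), (if j = 0 then (1 : ℝ) else -1) •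
      (fld a l hl (fun i => (Fin.cons ν μ : Fin (l + 1) → Fin n) (Equiv.swap 0 j i.succ))
        ((Fin.cons ν μ : Fin (l + 1) → Fin n) j ::ₘ α.erase ν) : LocalForm n p) =
      (α.count ν : ℝ) • fld a l hl μ α - (α.count ν : ℝ) •
        ∑ j, fld a l hl (Function.update μ j ν) (μ j ::ₘ α.erase ν) := by
    intro ν
    by_cases hν : ν ∈ α
    · rw [← smul_sub]
      congr 1
      rw [Fin.sum_univ_succ, sub_eq_add_neg, ← Finset.sum_neg_distrib]
      congr 1
      · simp [Multiset.cons_erase hν]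
      · refine Finset.sum_congr rfl fun j _ => ?_
        rw [if_neg (Fin.succ_ne_zero j), neg_smul, one_smul]
        congr 2
        funext i
        rcases eq_or_ne i j with rfl | hij
        · simp
        · rw [Equiv.swap_apply_of_ne_of_ne (Fin.succ_ne_zero i)
            (fun h => hij (Fin.succ_injective _ h))]
          simp [hij]
    · rw [Multiset.count_eq_zero.2 hν]
      simp
  rw [Finset.sum_congr rfl fun ν _ => h1 ν, Finset.sum_sub_distrib, ← Finset.sum_smul, exch]
  congr 2
  rw [← Nat.cast_sum, Multiset.sum_count_eq_card fun _ _ => Finset.mem_univ _]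

theorem kos_brst_fld (a : ι) (l : ℕ) (hl : l ≤ p a) (μ : Fin l → Fin n)
    (α : Multiset (Fin n)) :
    kos (brst (fld a l hl μ α : LocalForm n p)) =
      (l : ℝ) • fld a l hl μ α + exch a l hl μ α := by
  cases l with
  | zero => simp [brst_fld_zero, exch]
  | succ l =>
    have h1 : ∀ (j : Fin (l + 1)) (ν : Fin n) (β : Multiset (Fin n)),
        (fld a (l + 1) hl (Fin.cons ν fun i => μ (Equiv.swap 0 j i.succ) : Fin (l + 1) → Fin n) β :
          LocalForm n p) =
        (if j = 0 then (1 : ℝ) else -1) • fld a (l + 1) hl (Function.update μ j ν) β := by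
      intro j ν β
      have e : (Fin.cons ν fun i => μ (Equiv.swap 0 j i.succ) : Fin (l + 1) → Fin n) =
          Function.update μ j ν ∘ Equiv.swap 0 j := by
        funext i
        refine Fin.cases ?_ (fun i => ?_) i
        · simp
        · have : Equiv.swap 0 j i.succ ≠ j := by
            intro h
            rw [Equiv.swap_apply_eq_iff, Equiv.swap_apply_right] at h
            exact Fin.succ_ne_zero i h
          simp [this]
      rw [e, fld_perm]
      congr 1
      by_cases hj : j = 0
      · simp [hj]
      · rw [Equiv.Perm.sign_swap (Ne.symm hj), if_neg hj]
        simp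
    rw [brst_fld_eq_sum, map_smul, map_sum]
    simp only [map_smul, kos_fld _ _ _ (show l < p a by omega)]
    rw [sum_smul_smul_comm, neg_one_pow_smul_smul]
    have h2 : ∀ j : Fin (l + 1), (if j = 0 then (1 : ℝ) else -1) •
        ∑ ν, ((μ j ::ₘ α).count ν : ℝ) • (fld a (l + 1) hl
          (Fin.cons ν fun i => μ (Equiv.swap 0 j i.succ) : Fin (l + 1) → Fin n)
          ((μ j ::ₘ α).erase ν) : LocalForm n p) =
        fld a (l + 1) hl μ α + ∑ ν, (α.count ν : ℝ) •
          fld a (l + 1) hl (Function.update μ j ν) (μ j ::ₘ α.erase ν) := by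
      intro j
      rw [sum_count_cons (μ j) α fun ν β => (fld a (l + 1) hl
          (Fin.cons ν fun i => μ (Equiv.swap 0 j i.succ) : Fin (l + 1) → Fin n) β :
          LocalForm n p)]
      simp only [h1]
      have hs : ∀ x : LocalForm n p, (if j = 0 then (1 : ℝ) else -1) •
          (if j = 0 then (1 : ℝ) else -1) • x = x := by
        intro x
        split_ifs <;> simp
      rw [sum_smul_smul_comm, smul_add, hs, hs, Function.update_eq_self]
    rw [Finset.sum_congr rfl fun j _ => h2 j, Finset.sum_add_distrib, Finset.sum_const,
      Finset.card_univ, Fintype.card_fin, ← Nat.cast_smul_eq_nsmul ℝ, Finset.sum_comm]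
    simp only [exch, Finset.smul_sum]

/-- The Koszul identity: the exchange terms of the two orders cancel. -/
theorem lap_fld (a : ι) (l : ℕ) (hl : l ≤ p a) (h : l < p a) (μ : Fin l → Fin n)
    (α : Multiset (Fin n)) :
    lap (fld a l hl μ α : LocalForm n p) = ((l + α.card : ℕ) : ℝ) • fld a l hl μ α := by
  rw [lap_apply, brst_kos_fld a l hl h, kos_brst_fld, Nat.cast_add, add_smul]
  abel

theorem lap_dx (μ : Fin n) : lap (dx n p μ) = 0 := by simp [lap_apply, kos_dx, brst_dx]

theorem lap_of_mem_fldSpan {a : ι} {l m : ℕ} (h : l < p a) {x : LocalForm n p}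
    (hx : x ∈ fldSpan n p a l m) : lap x = ((l + m : ℕ) : ℝ) • x := by
  induction hx using Submodule.span_induction with
  | mem x hx => obtain ⟨hl, μ, α, rfl, rfl⟩ := hx; exact lap_fld a l hl h μ α
  | zero => simp
  | add x y _ _ hx hy => rw [map_add, hx, hy, smul_add]
  | smul t x _ hx => rw [map_smul, hx, smul_comm]

theorem kos_of_mem_fldSpan {a : ι} {m : ℕ} {x : LocalForm n p}
    (hx : x ∈ fldSpan n p a (p a) m) : kos x = 0 := by
  induction hx using Submodule.span_induction with
  | mem x hx => obtain ⟨hl, μ, α, rfl, rfl⟩ := hx; exact kos_fld_top a _ hl (lt_irrefl _) μ α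
  | zero => simp
  | add x y _ _ hx hy => rw [map_add, hx, hy, add_zero]
  | smul t x _ hx => rw [map_smul, hx, smul_zero]

theorem brst_mem_fldSpan {a : ι} {l m : ℕ} {x : LocalForm n p}
    (hx : x ∈ fldSpan n p a (l + 1) m) : brst x ∈ fldSpan n p a l (m + 1) := by
  induction hx using Submodule.span_induction with
  | mem x hx =>
    obtain ⟨hl, μ, α, rfl, rfl⟩ := hx
    rw [brst_fld_succ]
    exact Submodule.smul_mem _ _ (Submodule.sum_mem _ fun σ _ => Submodule.smul_mem _ _
      (fld_mem_fldSpan _ _ _ _ (by simp)))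
  | zero => simp
  | add x y _ _ hx hy => rw [map_add]; exact add_mem hx hy
  | smul t x _ hx => rw [map_smul]; exact Submodule.smul_mem _ _ hx

theorem kos_mem_fldSpan {a : ι} {l m : ℕ} (h : l < p a) {x : LocalForm n p}
    (hx : x ∈ fldSpan n p a l (m + 1)) : kos x ∈ fldSpan n p a (l + 1) m := by
  induction hx using Submodule.span_induction with
  | mem x hx =>
    obtain ⟨hl, μ, α, hα, rfl⟩ := hx
    rw [kos_fld a l hl h]
    refine Submodule.smul_mem _ _ (Submodule.sum_mem _ fun ν _ => ?_)
    by_cases hν : ν ∈ α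
    · refine Submodule.smul_mem _ _ (fld_mem_fldSpan _ _ _ _ ?_)
      rw [Multiset.card_erase_of_mem hν, hα, Nat.pred_succ]
    · rw [Multiset.count_eq_zero.2 hν, Nat.cast_zero, zero_smul]
      exact zero_mem _
  | zero => simp
  | add x y _ _ hx hy => rw [map_add]; exact add_mem hx hy
  | smul t x _ hx => rw [map_smul]; exact Submodule.smul_mem _ _ hx

theorem pd_mem_fldSpan (ν : Fin n) {a : ι} {l m : ℕ} {x : LocalForm n p}
    (hx : x ∈ fldSpan n p a l m) : pd ν x ∈ fldSpan n p a l (m + 1) := by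
  induction hx using Submodule.span_induction with
  | mem x hx =>
    obtain ⟨hl, μ, α, rfl, rfl⟩ := hx
    rw [pd_fld]
    exact fld_mem_fldSpan _ _ _ _ (by simp)
  | zero => simp
  | add x y _ _ hx hy => rw [map_add]; exact add_mem hx hy
  | smul t x _ hx => rw [map_smul]; exact Submodule.smul_mem _ _ hx

/-- On the components of the gauge potentials themselves, `lap` has only the eigenvalues `0` and
`p a + m`. -/
theorem lap_top {a : ι} (ha : 1 ≤ p a) {m : ℕ} {x : LocalForm n p}
    (hx : x ∈ fldSpan n p a (p a) m) :
    lap x ∈ fldSpan n p a (p a) m ∧ lap (lap x) = ((p a + m : ℕ) : ℝ) • lap x ∧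
      brst (lap x) = ((p a + m : ℕ) : ℝ) • brst x := by
  obtain ⟨q, hq⟩ : ∃ q, p a = q + 1 := ⟨p a - 1, by omega⟩
  rw [hq] at hx
  have hg := brst_mem_fldSpan hx
  have hk := kos_mem_fldSpan (by omega) hg
  rw [← hq] at hx hk
  have e : lap x = kos (brst x) := by rw [lap_apply, kos_of_mem_fldSpan hx, map_zero, zero_add]
  have hl := lap_of_mem_fldSpan (by omega) hg
  rw [show q + (m + 1) = p a + m by omega] at hl
  have hb : brst (lap x) = ((p a + m : ℕ) : ℝ) • brst x := by rw [← lap_brst, hl]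
  refine ⟨e ▸ hk, ?_, hb⟩
  rw [lap_apply, hb, map_smul, ← e, e, kos_of_mem_fldSpan hk, map_zero, zero_add]

/-- The projection onto the kernel of `lap`: it fixes the undifferentiated ghosts of form degree
`0` and the linear combinations of derivatives of the field strengths. -/
noncomputable def retr : LocalForm n p →ₐ[ℝ] LocalForm n p :=
  evenHom (fun x => match x with
    | .dx μ => dx n p μ
    | .fld a l hl μ α => if l < p a then if l = 0 ∧ α = 0 then fld a l hl μ α else 0
      else fld a l hl μ α - ((p a + α.card : ℕ) : ℝ)⁻¹ • lap (fld a l hl μ α))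
    (fun x => by
      cases x with
      | dx μ => exact HasParity.dx μ
      | fld a l hl μ α =>
        dsimp only
        split_ifs
        · exact HasParity.fld a l hl μ α
        · exact HasParity.zero _
        · exact (HasParity.fld a l hl μ α).sub
            ((lap_isDer.parity (HasParity.fld a l hl μ α)).smul _))
    (fun a l hl μ α σ => by
      dsimp only
      rw [fld_perm]
      split_ifs
      · rfl
      · simp
      · rw [map_smul, smul_sub, smul_comm])

theorem retr_isEven : IsEven (retr : LocalForm n p →ₐ[ℝ] LocalForm n p) := evenHom_isEven _ _ _

theorem retr_dx (μ : Fin n) : retr (dx n p μ) = dx n p μ := evenHom_gen _ _ _ _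

theorem retr_fld (a : ι) (l : ℕ) (hl : l ≤ p a) (h : l < p a) (μ : Fin l → Fin n)
    (α : Multiset (Fin n)) : retr (fld a l hl μ α : LocalForm n p) =
      if l = 0 ∧ α = 0 then fld a l hl μ α else 0 :=
  (evenHom_gen _ _ _ _).trans (if_pos h)

theorem retr_of_mem_fldSpan {a : ι} {l m : ℕ} (h : l < p a) (h0 : l + m ≠ 0) {x : LocalForm n p}
    (hx : x ∈ fldSpan n p a l m) : retr x = 0 := by
  induction hx using Submodule.span_induction with
  | mem x hx =>
    obtain ⟨hl, μ, α, rfl, rfl⟩ := hx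
    rw [retr_fld a l hl h, if_neg]
    rintro ⟨rfl, rfl⟩
    simp at h0
  | zero => simp
  | add x y _ _ hx hy => rw [map_add, hx, hy, add_zero]
  | smul t x _ hx => rw [map_smul, hx, smul_zero]

theorem retr_top {a : ι} {m : ℕ} {x : LocalForm n p} (hx : x ∈ fldSpan n p a (p a) m) :
    retr x = x - ((p a + m : ℕ) : ℝ)⁻¹ • lap x := by
  induction hx using Submodule.span_induction with
  | mem x hx =>
    obtain ⟨hl, μ, α, rfl, rfl⟩ := hx
    exact (evenHom_gen _ _ _ _).trans (if_neg (lt_irrefl _))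
  | zero => simp
  | add x y _ _ hx hy => rw [map_add, hx, hy, map_add, smul_add]; abel
  | smul t x _ hx => rw [map_smul, hx, map_smul, smul_sub, smul_comm]

theorem retr_top_mem {a : ι} (ha : 1 ≤ p a) {m : ℕ} {x : LocalForm n p}
    (hx : x ∈ fldSpan n p a (p a) m) : retr x ∈ fldSpan n p a (p a) m ∧ lap (retr x) = 0 ∧
      brst (retr x) = 0 ∧ retr (lap x) = 0 := by
  obtain ⟨h1, h2, h3⟩ := lap_top ha hx
  have h0 : ((p a + m : ℕ) : ℝ) ≠ 0 := by exact_mod_cast (show p a + m ≠ 0 by omega)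
  rw [retr_top hx]
  refine ⟨sub_mem hx (Submodule.smul_mem _ _ h1), ?_, ?_, ?_⟩
  · rw [map_sub, map_smul, h2, smul_smul, inv_mul_cancel₀ h0, one_smul, sub_self]
  · rw [map_sub, map_smul, h3, smul_smul, inv_mul_cancel₀ h0, one_smul, sub_self]
  · rw [retr_top h1, h2, smul_smul, inv_mul_cancel₀ h0, one_smul, sub_self]

/-- The linear combinations of the components of the gauge potentials that are annihilated by `γ`
are fixed. -/
theorem retr_top_of_brst {a : ι} {m : ℕ} {x : LocalForm n p} (hx : x ∈ fldSpan n p a (p a) m)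
    (h : brst x = 0) : retr x = x := by
  rw [retr_top hx, lap_apply, kos_of_mem_fldSpan hx, h]
  simp

section

variable (hp : ∀ a, 1 ≤ p a)

theorem Gen.cases_top {C : Gen n p → Prop} (hdx : ∀ μ, C (.dx μ))
    (hlow : ∀ a l hl μ α, l < p a → C (.fld a l hl μ α))
    (htop : ∀ a μ α, C (.fld a (p a) le_rfl μ α)) (x : Gen n p) : C x := by
  cases x with
  | dx μ => exact hdx μ
  | fld a l hl μ α =>
    rcases lt_or_eq_of_le hl with h | rfl
    · exact hlow a l hl μ α h
    · exact htop a μ α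

theorem top_mem (a : ι) (μ : Fin (p a) → Fin n) (α : Multiset (Fin n)) :
    fld a (p a) le_rfl μ α ∈ fldSpan n p a (p a) α.card := fld_mem_fldSpan _ _ _ _ rfl

include hp

theorem isCounting_lap : IsCounting (lap : LocalForm n p →ₗ[ℝ] LocalForm n p) retr := by
  refine isCounting_of_gen lap_isDer fun x => ?_
  cases x using Gen.cases_top with
  | hdx μ => exact mem_countSpace_zero (lap_dx μ) (retr_dx μ)
  | hlow a l hl μ α h =>
    have h1 := lap_fld a l hl h μ α
    have h2 := retr_fld a l hl h μ α
    by_cases h0 : l = 0 ∧ α = 0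
    · rw [if_pos h0] at h2
      obtain ⟨rfl, rfl⟩ := h0
      exact mem_countSpace_zero (by rw [gen_fld, h1]; simp) h2
    · rw [if_neg h0] at h2
      refine mem_countSpace_pos ?_ h1 h2
      intro h
      exact h0 ⟨by omega, Multiset.card_eq_zero.1 (by omega)⟩
  | htop a μ α =>
    have hx := top_mem (p := p) a μ α
    obtain ⟨h1, h2, h3⟩ := lap_top (hp a) hx
    obtain ⟨h4, h5, h6, h7⟩ := retr_top_mem (hp a) hx
    have e : gen (.fld a (p a) le_rfl μ α) = retr (fld a (p a) le_rfl μ α : LocalForm n p) +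
        ((p a + α.card : ℕ) : ℝ)⁻¹ • lap (fld a (p a) le_rfl μ α) := by
      rw [retr_top hx, gen_fld]
      abel
    rw [e]
    refine add_mem (mem_countSpace_zero h5 (retr_top_of_brst h4 h6)) (Submodule.smul_mem _ _ ?_)
    refine mem_countSpace_pos ?_ h2 h7
    have := hp a
    omega

theorem brst_retr (x : LocalForm n p) : brst (retr x) = 0 := by
  refine (brst_isDer.along.comp_right (ρ' := retr)).ext IsDerAlong.zero (fun x => ?_) x
  change brst (retr (gen x)) = 0
  cases x using Gen.cases_top with
  | hdx μ => rw [gen_dx, retr_dx, brst_dx]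
  | hlow a l hl μ α h =>
    rw [gen_fld, retr_fld a l hl h]
    split_ifs with h0
    · obtain ⟨rfl, rfl⟩ := h0
      exact brst_fld_zero _ _ _ _
    · exact map_zero _
  | htop a μ α => exact (retr_top_mem (hp a) (top_mem a μ α)).2.2.1

omit hp in
theorem retr_brst (x : LocalForm n p) : retr (brst x) = 0 := by
  refine (brst_isDer.along.comp_left retr_isEven).ext IsDerAlong.zero (fun x => ?_) x
  change retr (brst (gen x)) = 0
  cases x with
  | dx μ => rw [gen_dx, brst_dx, map_zero]
  | fld a l hl μ α =>
    cases l with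
    | zero => rw [gen_fld, brst_fld_zero, map_zero]
    | succ l =>
      exact retr_of_mem_fldSpan (by omega) (by omega)
        (brst_mem_fldSpan (fld_mem_fldSpan a (l + 1) hl μ rfl))

/-- A `γ`-closed element is cohomologous to its projection. -/
theorem exists_eq_retr_add {Q : Submodule ℝ (LocalForm n p)} (hQγ : ∀ x ∈ Q, brst x ∈ Q)
    (hQσ : ∀ x ∈ Q, kos x ∈ Q) {x : LocalForm n p} (hx : x ∈ Q) (hγ : brst x = 0) :
    ∃ y ∈ Q, x = retr x + brst y := by
  obtain ⟨J, y, hy, rfl⟩ := (isCounting_lap hp).exists_sum (Q := Q ⊓ LinearMap.ker brst)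
    (fun x hx => ⟨Q.add_mem (hQγ _ (hQσ _ hx.1)) (hQσ _ (hQγ _ hx.1)), by
      change brst (lap x) = 0
      rw [← lap_brst, LinearMap.mem_ker.1 hx.2, map_zero]⟩) ⟨hx, hγ⟩
  have key : ∀ j ∈ Finset.range J, ∃ z ∈ Q, y j = retr (y j) + brst z := by
    intro j hj
    obtain ⟨⟨h1, h2⟩, h3, h4⟩ := hy j (Finset.mem_range.1 hj)
    rcases eq_or_ne j 0 with rfl | hj0
    · exact ⟨0, zero_mem _, by rw [h4]; simp⟩
    · refine ⟨(j : ℝ)⁻¹ • kos (y j), Q.smul_mem _ (hQσ _ h1), ?_⟩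
      rw [lap_apply, LinearMap.mem_ker.1 h2, map_zero, add_zero] at h3
      rw [h4, if_neg hj0, map_smul, h3, smul_smul, inv_mul_cancel₀ (by exact_mod_cast hj0),
        one_smul, zero_add]
  choose! z hz hyz using key
  refine ⟨∑ j ∈ Finset.range J, z j, Q.sum_mem hz, ?_⟩
  rw [map_sum, map_sum, ← Finset.sum_add_distrib]
  exact Finset.sum_congr rfl hyz

end

/-! ### The undifferentiated ghosts of form degree zero -/

theorem form_zero_eq (a : ι) (hl : 0 ≤ p a) (μ : Fin 0 → Fin n) :
    form n a 0 hl = (fld a 0 hl μ 0 : LocalForm n p) := by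
  simp [form, dxs_zero, Subsingleton.elim μ default]

/-- The derivation that counts the undifferentiated ghosts of form degree zero. -/
noncomputable def ghostNum : LocalForm n p →ₗ[ℝ] LocalForm n p :=
  derOf 0 (fun x => match x with
    | .dx _ => 0
    | .fld a l hl μ α => if l = 0 ∧ α = 0 then fld a l hl μ α else 0)
    (fun x => by
      cases x with
      | dx μ => exact HasParity.zero _
      | fld a l hl μ α =>
        dsimp only
        split_ifs
        · exact HasParity.fld a l hl μ α
        · exact HasParity.zero _)
    (fun a l hl μ α σ => by
      dsimp only
      rw [fld_perm]
      split_ifs <;> simp)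

theorem ghostNum_isDer : IsDer 0 (ghostNum : LocalForm n p →ₗ[ℝ] LocalForm n p) :=
  derOf_isDer _ _ _ _

theorem ghostNum_dx (μ : Fin n) : ghostNum (dx n p μ) = 0 := derOf_gen _ _ _ _ _

theorem ghostNum_fld (a : ι) (l : ℕ) (hl : l ≤ p a) (μ : Fin l → Fin n) (α : Multiset (Fin n)) :
    ghostNum (fld a l hl μ α : LocalForm n p) = if l = 0 ∧ α = 0 then fld a l hl μ α else 0 :=
  derOf_gen _ _ _ _ _

/-- The homomorphism that sets the undifferentiated ghosts of form degree zero to zero. -/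
noncomputable def ghostFree : LocalForm n p →ₐ[ℝ] LocalForm n p :=
  evenHom (fun x => match x with
    | .dx μ => dx n p μ
    | .fld a l hl μ α => if l = 0 ∧ α = 0 then 0 else fld a l hl μ α)
    (fun x => by
      cases x with
      | dx μ => exact HasParity.dx μ
      | fld a l hl μ α =>
        dsimp only
        split_ifs
        · exact HasParity.zero _
        · exact HasParity.fld a l hl μ α)
    (fun a l hl μ α σ => by
      dsimp only
      rw [fld_perm]
      split_ifs <;> simp)

theorem ghostFree_dx (μ : Fin n) : ghostFree (dx n p μ) = dx n p μ := evenHom_gen _ _ _ _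

theorem ghostFree_fld (a : ι) (l : ℕ) (hl : l ≤ p a) (μ : Fin l → Fin n)
    (α : Multiset (Fin n)) :
    ghostFree (fld a l hl μ α : LocalForm n p) = if l = 0 ∧ α = 0 then 0 else fld a l hl μ α :=
  evenHom_gen _ _ _ _

theorem isCounting_ghostNum :
    IsCounting (ghostNum : LocalForm n p →ₗ[ℝ] LocalForm n p) ghostFree := by
  refine isCounting_of_gen ghostNum_isDer fun x => ?_
  cases x with
  | dx μ => exact mem_countSpace_zero (ghostNum_dx μ) (ghostFree_dx μ)
  | fld a l hl μ α =>
    have h1 := ghostNum_fld a l hl μ α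
    have h2 := ghostFree_fld a l hl μ α
    by_cases h : l = 0 ∧ α = 0
    · rw [if_pos h] at h1 h2
      exact mem_countSpace_pos one_ne_zero (by rw [gen_fld, h1]; simp) h2
    · rw [if_neg h] at h1 h2
      exact mem_countSpace_zero h1 h2

/-- The derivative with respect to the undifferentiated ghost of form degree zero of `B^a`. -/
noncomputable def ghostDer (a : ι) : LocalForm n p →ₗ[ℝ] LocalForm n p :=
  open Classical in
  derOf (p a) (fun x => match x with
    | .dx _ => 0
    | .fld b l _ _ α => if b = a ∧ l = 0 ∧ α = 0 then 1 else 0)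
    (fun x => by
      cases x with
      | dx μ => exact HasParity.zero _
      | fld b l hl μ α =>
        dsimp only
        split_ifs with h
        · obtain ⟨rfl, rfl, rfl⟩ := h
          rw [← map_one (algebraMap ℝ (LocalForm n p))]
          exact HasParity.algebraMap ⟨p b, by simp [Gen.deg]⟩ _
        · exact HasParity.zero _)
    (fun b l hl μ α σ => by
      dsimp only
      split_ifs with h
      · obtain ⟨rfl, rfl, rfl⟩ := h
        simp [Subsingleton.elim σ 1]
      · simp)

theorem ghostDer_isDer (a : ι) :
    IsDer (p a) (ghostDer a : LocalForm n p →ₗ[ℝ] LocalForm n p) := derOf_isDer _ _ _ _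

theorem ghostDer_dx (a : ι) (μ : Fin n) : ghostDer a (dx n p μ) = 0 := derOf_gen _ _ _ _ _

open Classical in
theorem ghostDer_fld (a b : ι) (l : ℕ) (hl : l ≤ p b) (μ : Fin l → Fin n)
    (α : Multiset (Fin n)) :
    ghostDer a (fld b l hl μ α : LocalForm n p) = if b = a ∧ l = 0 ∧ α = 0 then 1 else 0 :=
  derOf_gen _ _ _ _ _

theorem ghostDer_of_mem_fldSpan (a : ι) {b : ι} {l m : ℕ} (h : l + m ≠ 0) {x : LocalForm n p}
    (hx : x ∈ fldSpan n p b l m) : ghostDer a x = 0 := by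
  induction hx using Submodule.span_induction with
  | mem x hx =>
    obtain ⟨hl, μ, α, rfl, rfl⟩ := hx
    rw [ghostDer_fld, if_neg]
    rintro ⟨-, rfl, rfl⟩
    simp at h
  | zero => simp
  | add x y _ _ hx hy => rw [map_add, hx, hy, add_zero]
  | smul t x _ hx => rw [map_smul, hx, smul_zero]

theorem ghostNum_of_mem_fldSpan {b : ι} {l m : ℕ} (h : l + m ≠ 0) {x : LocalForm n p}
    (hx : x ∈ fldSpan n p b l m) : ghostNum x = 0 := by
  induction hx using Submodule.span_induction with
  | mem x hx =>
    obtain ⟨hl, μ, α, rfl, rfl⟩ := hx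
    rw [ghostNum_fld, if_neg]
    rintro ⟨rfl, rfl⟩
    simp at h
  | zero => simp
  | add x y _ _ hx hy => rw [map_add, hx, hy, add_zero]
  | smul t x _ hx => rw [map_smul, hx, smul_zero]

theorem ghostFree_of_mem_fldSpan {b : ι} {l m : ℕ} (h : l + m ≠ 0) {x : LocalForm n p}
    (hx : x ∈ fldSpan n p b l m) : ghostFree x = x := by
  induction hx using Submodule.span_induction with
  | mem x hx =>
    obtain ⟨hl, μ, α, rfl, rfl⟩ := hx
    rw [ghostFree_fld, if_neg]
    rintro ⟨rfl, rfl⟩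
    simp at h
  | zero => simp
  | add x y _ _ hx hy => rw [map_add, hx, hy]
  | smul t x _ hx => rw [map_smul, hx]

theorem ghostDer_pd (a : ι) (ν : Fin n) (x : LocalForm n p) :
    ghostDer a (pd ν x) = pd ν (ghostDer a x) := by
  refine ((pd_isDer ν).commute (ghostDer_isDer a) (fun x => ?_) x).symm
  cases x with
  | dx μ => rw [gen_dx, ghostDer_dx, pd_dx, map_zero, map_zero]
  | fld b l hl μ α =>
    have h : ghostDer a (pd ν (fld b l hl μ α : LocalForm n p)) = 0 :=
      ghostDer_of_mem_fldSpan a (Nat.succ_ne_zero (l + α.card))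
        (pd_mem_fldSpan ν (fld_mem_fldSpan b l hl μ rfl))
    rw [gen_fld, h, ghostDer_fld]
    split_ifs
    · exact (pd_isDer ν).one
    · exact map_zero _

theorem ghostDer_brst (a : ι) (x : LocalForm n p) :
    ghostDer a (brst x) = (-1 : ℝ) ^ p a • brst (ghostDer a x) := by
  have h := ((ghostDer_isDer a).comm brst_isDer).ext (IsDer.zero _) (fun x => ?_) x
  · rw [LinearMap.sub_apply, LinearMap.zero_apply, sub_eq_zero] at h
    simpa using h
  · cases x with
    | dx μ => simp [gen_dx, ghostDer_dx, brst_dx]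
    | fld b l hl μ α =>
      have h1 : ghostDer a (brst (fld b l hl μ α : LocalForm n p)) = 0 := by
        cases l with
        | zero => rw [brst_fld_zero, map_zero]
        | succ l =>
          exact ghostDer_of_mem_fldSpan a (Nat.succ_ne_zero (l + α.card))
            (brst_mem_fldSpan (fld_mem_fldSpan b (l + 1) hl μ rfl))
      have h2 : brst (ghostDer a (fld b l hl μ α : LocalForm n p)) = 0 := by
        rw [ghostDer_fld]
        split_ifs
        · exact brst_isDer.one
        · exact map_zero _
      simp [gen_fld, h1, h2]

theorem ghostDer_extD (a : ι) (x : LocalForm n p) :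
    ghostDer a (extD x) = (-1 : ℝ) ^ p a • extD (ghostDer a x) := by
  rw [extD_apply, extD_apply, map_sum, Finset.smul_sum]
  refine Finset.sum_congr rfl fun ν _ => ?_
  rw [(ghostDer_isDer a).mul, ghostDer_dx, zero_mul, zero_add, (HasParity.dx ν).tw, mul_one,
    ghostDer_pd, smul_mul_assoc]

theorem ghostNum_ghostDer (a : ι) (x : LocalForm n p) :
    ghostNum (ghostDer a x) = ghostDer a (ghostNum x) - ghostDer a x := by
  have h := ((ghostNum_isDer (n := n) (p := p)).comm_even (ghostDer_isDer a)).ext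
    ((ghostDer_isDer a).smul (-1)) (fun x => ?_) x
  · simp only [LinearMap.sub_apply, LinearMap.comp_apply, LinearMap.smul_apply, neg_smul,
      one_smul] at h
    rw [← sub_eq_zero] at h ⊢
    rw [← h]
    abel
  · cases x with
    | dx μ => simp [gen_dx, ghostDer_dx, ghostNum_dx]
    | fld b l hl μ α =>
      have h2 : ghostNum (ghostDer a (fld b l hl μ α : LocalForm n p)) = 0 := by
        rw [ghostDer_fld]
        split_ifs
        · exact ghostNum_isDer.one
        · exact map_zero _
      have h3 : ghostDer a (ghostNum (fld b l hl μ α : LocalForm n p)) =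
          ghostDer a (fld b l hl μ α) := by
        rw [ghostNum_fld]
        split_ifs with h
        · rfl
        · rw [ghostDer_fld, if_neg (fun h' => h h'.2), map_zero]
      simp [gen_fld, h2, h3]

theorem form_zero_mul (a : ι) (x : LocalForm n p) :
    form n a 0 (Nat.zero_le _) * tw (p a) x = x * form n a 0 (Nat.zero_le _) := by
  rw [form_zero_eq a (Nat.zero_le _) Fin.elim0,
    (HasParity.fld a 0 (Nat.zero_le _) Fin.elim0 0).mul_comm, tw_tw, Nat.sub_zero, ← two_mul,
    tw_two_mul]

/-- Euler's formula for the undifferentiated ghosts of form degree zero. -/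
theorem exists_ghostNum_eq (x : LocalForm n p) : ∃ F₀ : Finset ι, ∀ F, F₀ ⊆ F →
    ghostNum x = ∑ a ∈ F, form n a 0 (Nat.zero_le _) * ghostDer a x := by
  classical
  induction x using LocalForm.induction with
  | halg r =>
    refine ⟨∅, fun F _ => ?_⟩
    rw [ghostNum_isDer.alg, Finset.sum_eq_zero]
    intro a _
    rw [(ghostDer_isDer a).alg, mul_zero]
  | hgen x =>
    cases x with
    | dx μ => exact ⟨∅, fun F _ => by simp [gen_dx, ghostNum_dx, ghostDer_dx]⟩
    | fld b l hl μ α =>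
      refine ⟨{b}, fun F hF => ?_⟩
      rw [Finset.singleton_subset_iff] at hF
      simp only [gen_fld, ghostDer_fld]
      rw [ghostNum_fld]
      by_cases h : l = 0 ∧ α = 0
      · rw [if_pos h]
        obtain ⟨rfl, rfl⟩ := h
        rw [Finset.sum_eq_single b]
        · simp [form_zero_eq b hl μ]
        · intro c _ hc
          rw [if_neg (fun h => hc h.1.symm), mul_zero]
        · intro h
          exact absurd hF h
      · rw [if_neg h, Finset.sum_eq_zero]
        intro c _
        rw [if_neg (fun h' => h h'.2), mul_zero]
  | hmul x y hx hy =>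
    obtain ⟨F₁, h1⟩ := hx
    obtain ⟨F₂, h2⟩ := hy
    refine ⟨F₁ ∪ F₂, fun F hF => ?_⟩
    rw [ghostNum_isDer.mul_zero, h1 F (Finset.union_subset_left hF),
      h2 F (Finset.union_subset_right hF), Finset.sum_mul, Finset.mul_sum,
      ← Finset.sum_add_distrib]
    refine Finset.sum_congr rfl fun a _ => ?_
    rw [(ghostDer_isDer a).mul, mul_add, ← mul_assoc, ← mul_assoc, ← mul_assoc, form_zero_mul]
  | hadd x y hx hy =>
    obtain ⟨F₁, h1⟩ := hx
    obtain ⟨F₂, h2⟩ := hy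
    refine ⟨F₁ ∪ F₂, fun F hF => ?_⟩
    rw [map_add, h1 F (Finset.union_subset_left hF), h2 F (Finset.union_subset_right hF),
      ← Finset.sum_add_distrib]
    refine Finset.sum_congr rfl fun a _ => ?_
    rw [map_add, mul_add]

section

variable (hp : ∀ a, 1 ≤ p a)
include hp

theorem ghostNum_retr (x : LocalForm n p) : ghostNum (retr x) = retr (ghostNum x) := by
  refine (ghostNum_isDer.along.comp_right (ρ' := retr)).ext
    (ghostNum_isDer.along.comp_left retr_isEven) (fun x => ?_) x
  change ghostNum (retr (gen x)) = retr (ghostNum (gen x))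
  cases x using Gen.cases_top with
  | hdx μ => rw [gen_dx, retr_dx, ghostNum_dx, map_zero]
  | hlow a l hl μ α h =>
    rw [gen_fld, retr_fld a l hl h, ghostNum_fld]
    split_ifs with h0
    · rw [ghostNum_fld, if_pos h0, retr_fld a l hl h, if_pos h0]
    · rw [map_zero, map_zero]
  | htop a μ α =>
    have := hp a
    rw [gen_fld, ghostNum_of_mem_fldSpan (by omega) (retr_top_mem (hp a) (top_mem a μ α)).1,
      ghostNum_of_mem_fldSpan (by omega) (top_mem a μ α), map_zero]

/-- The homomorphism `ghostFree ∘ retr` kills all ghosts and projects the derivatives of the gauge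
potentials onto those of the field strengths. -/
theorem retr_ghostFree_retr :
    (retr (n := n) (p := p)).comp (ghostFree.comp retr) = ghostFree.comp retr := by
  refine AlgHom.ext fun x => hom_ext (fun x => ?_) x
  change retr (ghostFree (retr (gen x))) = ghostFree (retr (gen x))
  cases x using Gen.cases_top with
  | hdx μ => rw [gen_dx, retr_dx, ghostFree_dx, retr_dx]
  | hlow a l hl μ α h =>
    have : ghostFree (retr (fld a l hl μ α : LocalForm n p)) = 0 := by
      rw [retr_fld a l hl h]
      split_ifs with h0
      · rw [ghostFree_fld, if_pos h0]
      · exact map_zero _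
    rw [gen_fld, this, map_zero]
  | htop a μ α =>
    have := hp a
    obtain ⟨h4, h5, h6, h7⟩ := retr_top_mem (hp a) (top_mem a μ α)
    rw [gen_fld, ghostFree_of_mem_fldSpan (by omega) h4, retr_top_of_brst h4 h6]

/-- Derivatives of a function of the field strengths are functions of the field strengths. -/
theorem retr_pd_ghostFree_retr (ν : Fin n) (x : LocalForm n p) :
    retr (pd ν (ghostFree (retr x))) = pd ν (ghostFree (retr x)) := by
  have h1 := (pd_isDer ν).along.comp_right (ρ' := (ghostFree (n := n) (p := p)).comp retr)
  have h2 := h1.comp_left (retr_isEven (n := n) (p := p))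
  rw [AlgHom.id_comp] at h1 h2
  rw [retr_ghostFree_retr hp] at h2
  refine h2.ext h1 (fun x => ?_) x
  change retr (pd ν (ghostFree (retr (gen x)))) = pd ν (ghostFree (retr (gen x)))
  cases x using Gen.cases_top with
  | hdx μ => rw [gen_dx, retr_dx, ghostFree_dx, pd_dx, map_zero]
  | hlow a l hl μ α h =>
    have : ghostFree (retr (fld a l hl μ α : LocalForm n p)) = 0 := by
      rw [retr_fld a l hl h]
      split_ifs with h0
      · rw [ghostFree_fld, if_pos h0]
      · exact map_zero _
    rw [gen_fld, this, map_zero, map_zero]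
  | htop a μ α =>
    have := hp a
    obtain ⟨h4, h5, h6, h7⟩ := retr_top_mem (hp a) (top_mem a μ α)
    rw [gen_fld, ghostFree_of_mem_fldSpan (by omega) h4]
    refine retr_top_of_brst (pd_mem_fldSpan ν h4) ?_
    rw [← pd_brst, h6, map_zero]

end

/-! ### Bottoms of descents -/

theorem kos_mem_formsOfDegree (k : ℕ) :
    ∀ x ∈ formsOfDegree n p k, kos x ∈ formsOfDegree n p (k + 0) := by
  refine kos_isDer.map_formsOfDegree (fun x => ?_) k
  cases x with
  | dx μ => rw [gen_dx, kos_dx]; exact zero_mem _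
  | fld a l hl μ α =>
    rw [gen_fld]
    by_cases h : l < p a
    · rw [kos_fld a l hl h]
      exact Submodule.smul_mem _ _ (Submodule.sum_mem _ fun ν _ => Submodule.smul_mem _ _
        (fld_mem_formsOfDegree _ _ _ _ _))
    · rw [kos_fld_top a l hl h]
      exact zero_mem _

theorem ghostDer_mem_formsOfDegree (a : ι) (k : ℕ) :
    ∀ x ∈ formsOfDegree n p k, ghostDer a x ∈ formsOfDegree n p (k + 0) := by
  refine (ghostDer_isDer a).map_formsOfDegree (fun x => ?_) k
  cases x with
  | dx μ => rw [gen_dx, ghostDer_dx]; exact zero_mem _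
  | fld b l hl μ α =>
    rw [gen_fld, ghostDer_fld]
    split_ifs
    · exact one_mem_formsOfDegree
    · exact zero_mem _

theorem form_mul_mem_formsOfDegree (a : ι) {k : ℕ} {x : LocalForm n p}
    (hx : x ∈ formsOfDegree n p k) :
    form n a 0 (Nat.zero_le _) * x ∈ formsOfDegree n p k := by
  have := mul_mem_formsOfDegree (form_mem_formsOfDegree a 0 (Nat.zero_le _)) hx
  rwa [zero_add] at this

theorem brst_form_mul (a : ι) (x : LocalForm n p) :
    brst (form n a 0 (Nat.zero_le _) * x) =
      (-1 : ℝ) ^ p a • (form n a 0 (Nat.zero_le _) * brst x) := by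
  rw [brst_mul, brst_form_zero, zero_mul, zero_add, tw_form, smul_mul_assoc]

/-- The differential of an undifferentiated ghost of form degree zero is `γ`-exact; this is the
form of the statement needed for products with a `γ`-closed element. -/
theorem extD_form_mul (a : ι) (ha : 1 ≤ p a) {x : LocalForm n p} (hx : brst x = 0) :
    extD (form n a 0 (Nat.zero_le _) * x) = -brst (form n a 1 ha * x) +
      (-1 : ℝ) ^ p a • (form n a 0 (Nat.zero_le _) * extD x) := by
  rw [extD_mul, tw_form, smul_mul_assoc, brst_mul, hx, mul_zero, add_zero,
    eq_neg_of_add_eq_zero_left (brst_form_succ a 0 ha), neg_mul, neg_neg]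

/-- A space `S` of small forms in a space `Q` of local forms, with the stability properties on which
the comparison of the two rests: the homotopies for `γ` and `d` act on them, and so do the
undifferentiated ghosts of form degree zero and the derivatives with respect to them; the constant
forms of `Q` are small, except possibly in form degree `n`. -/
structure IsSmallPair (S Q : Submodule ℝ (LocalForm n p)) : Prop where
  le_const : S ≤ Subalgebra.toSubmodule (smallAlgConst n p)
  small_brst : ∀ x ∈ S, brst x ∈ S
  small_kos : ∀ x ∈ S, kos x ∈ S
  small_form_mul : ∀ a l hl, ∀ x ∈ S, form n a l hl * x ∈ S
  brst : ∀ x ∈ Q, brst x ∈ Q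
  extD : ∀ x ∈ Q, extD x ∈ Q
  num : ∀ x ∈ Q, num x ∈ Q
  htpy : ∀ x ∈ Q, htpy x ∈ Q
  kos : ∀ x ∈ Q, kos x ∈ Q
  ghostDer : ∀ a, ∀ x ∈ Q, ghostDer a x ∈ Q
  form_mul : ∀ a l hl, ∀ x ∈ Q, form n a l hl * x ∈ Q
  const_mem : ∀ k < n, ∀ x ∈ Q, x ∈ formsOfDegree n p k → PForm.num x = 0 → x ∈ S

/-- The elements of `Q` that represent a class of `E_1(Q)` coming from a `γ`-closed element
of `S`. -/
noncomputable def smallClosed (S Q : Submodule ℝ (LocalForm n p)) :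
    Submodule ℝ (LocalForm n p) :=
  (S ⊓ LinearMap.ker brst) ⊔ (Q.map brst ⊔ (Q ⊓ LinearMap.ker brst).map extD)

theorem mem_smallClosed {S Q : Submodule ℝ (LocalForm n p)} {x : LocalForm n p} :
    x ∈ smallClosed S Q ↔ ∃ s ∈ S, brst s = 0 ∧ ∃ m ∈ Q, ∃ u ∈ Q, brst u = 0 ∧
      x = s + (brst m + extD u) := by
  simp only [smallClosed, Submodule.mem_sup, Submodule.mem_inf, Submodule.mem_map,
    LinearMap.mem_ker]
  constructor
  · rintro ⟨s, ⟨h1, h2⟩, _, ⟨_, ⟨m, h3, rfl⟩, _, ⟨u, ⟨h4, h5⟩, rfl⟩, rfl⟩, rfl⟩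
    exact ⟨s, h1, h2, m, h3, u, h4, h5, rfl⟩
  · rintro ⟨s, h1, h2, m, h3, u, h4, h5, rfl⟩
    exact ⟨s, ⟨h1, h2⟩, _, ⟨_, ⟨m, h3, rfl⟩, _, ⟨u, ⟨h4, h5⟩, rfl⟩, rfl⟩, rfl⟩

/-- The `γ`-closed elements of form degree `k` of `Q` that can be lifted once. -/
noncomputable def bottoms (Q : Submodule ℝ (LocalForm n p)) (k : ℕ) :
    Submodule ℝ (LocalForm n p) :=
  (Q ⊓ formsOfDegree n p k) ⊓ (LinearMap.ker brst ⊓ (Q.map brst).comap extD)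

theorem mem_bottoms {Q : Submodule ℝ (LocalForm n p)} {k : ℕ} {x : LocalForm n p} :
    x ∈ bottoms Q k ↔ x ∈ Q ∧ x ∈ formsOfDegree n p k ∧ brst x = 0 ∧
      ∃ m ∈ Q, brst m = extD x := by
  simp only [bottoms, Submodule.mem_inf, LinearMap.mem_ker, Submodule.mem_comap,
    Submodule.mem_map, and_assoc]

/-- Constants are `γ`-closed. -/
theorem brst_eq_zero_of_num {x : LocalForm n p} (hx : num x = 0) : brst x = 0 := by
  rw [← isCounting_num.eq_of_eq_zero hx]
  refine (brst_isDer.along.comp_right (ρ' := constPart)).ext IsDerAlong.zero (fun x => ?_) x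
  change brst (constPart (gen x)) = 0
  cases x with
  | dx μ => rw [gen_dx, constPart_dx, brst_dx]
  | fld a l hl μ α => rw [gen_fld, constPart_fld, map_zero]

namespace IsSmallPair

variable {S Q : Submodule ℝ (LocalForm n p)} (h : IsSmallPair S Q)
include h

theorem form_mul_mem_smallClosed (a : ι) (ha : 1 ≤ p a) {x : LocalForm n p}
    (hx : x ∈ smallClosed S Q) : PForm.form n a 0 (Nat.zero_le _) * x ∈ smallClosed S Q := by
  obtain ⟨s, hs, hγs, m, hm, u, hu, hγu, rfl⟩ := mem_smallClosed.1 hx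
  refine mem_smallClosed.2 ⟨form n a 0 (Nat.zero_le _) * s, h.small_form_mul _ _ _ _ hs,
    by rw [brst_form_mul, hγs, mul_zero, smul_zero],
    (-1 : ℝ) ^ p a • (form n a 0 (Nat.zero_le _) * m + form n a 1 ha * u),
    Q.smul_mem _ (Q.add_mem (h.form_mul _ _ _ _ hm) (h.form_mul _ _ _ _ hu)),
    (-1 : ℝ) ^ p a • (form n a 0 (Nat.zero_le _) * u), Q.smul_mem _ (h.form_mul _ _ _ _ hu),
    by rw [map_smul, brst_form_mul, hγu, mul_zero, smul_zero, smul_zero], ?_⟩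
  rw [map_smul, map_smul, map_add, extD_form_mul a ha hγu, brst_form_mul, mul_add, mul_add,
    smul_add, smul_add, neg_one_pow_smul_smul, neg_one_pow_smul_smul, smul_neg]
  abel

theorem form_mul_mem_bottoms (a : ι) (ha : 1 ≤ p a) {k : ℕ} {x : LocalForm n p}
    (hx : x ∈ bottoms Q k) : PForm.form n a 0 (Nat.zero_le _) * x ∈ bottoms Q k := by
  obtain ⟨h1, h2, h3, m, hm, h4⟩ := mem_bottoms.1 hx
  refine mem_bottoms.2 ⟨h.form_mul _ _ _ _ h1, form_mul_mem_formsOfDegree a h2,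
    by rw [brst_form_mul, h3, mul_zero, smul_zero],
    -(form n a 1 ha * x) + form n a 0 (Nat.zero_le _) * m,
    Q.add_mem (Q.neg_mem (h.form_mul _ _ _ _ h1)) (h.form_mul _ _ _ _ hm), ?_⟩
  rw [extD_form_mul a ha h3, map_add, map_neg, brst_form_mul, h4]

theorem ghostDer_mem_bottoms (a : ι) {k : ℕ} {x : LocalForm n p}
    (hx : x ∈ bottoms Q k) : PForm.ghostDer a x ∈ bottoms Q k := by
  obtain ⟨h1, h2, h3, m, hm, h4⟩ := mem_bottoms.1 hx
  have e : PForm.brst (PForm.ghostDer a x) = 0 := by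
    have := ghostDer_brst a x
    rw [h3, map_zero] at this
    rw [← neg_one_pow_smul_smul (p a) (PForm.brst _), ← this, smul_zero]
  refine mem_bottoms.2 ⟨h.ghostDer a _ h1, ghostDer_mem_formsOfDegree a k x h2, e,
    PForm.ghostDer a m, h.ghostDer a _ hm, ?_⟩
  have := ghostDer_brst a m
  rw [h4, ghostDer_extD] at this
  rw [← neg_one_pow_smul_smul (p a) (PForm.brst _), ← this, neg_one_pow_smul_smul]

/-- A bottom without undifferentiated ghosts of form degree zero. It is a function of the field
strengths up to `γ`-exact terms, so that it is not only `γ`- but also `d`-closed; the algebraic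
Poincaré lemma makes it a constant up to a `d`-exact form. -/
theorem mem_smallClosed_of_ghostNum_eq_zero (hp : ∀ a, 1 ≤ p a) {k : ℕ} (hk : k < n)
    (hβ : ∀ β ∈ Q, PForm.extD (PForm.brst β) = 0 →
      formProj k (PForm.extD β) ∈ smallClosed S Q)
    {x : LocalForm n p} (hx : x ∈ bottoms Q k) (hgx : ghostNum x = 0) : x ∈ smallClosed S Q := by
  obtain ⟨h1, h2, h3, m, hm, h4⟩ := mem_bottoms.1 hx
  obtain ⟨y, ⟨hyQ, hyk⟩, hxy⟩ := exists_eq_retr_add (Q := Q ⊓ formsOfDegree n p k) hp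
    (fun z hz => ⟨h.brst z hz.1, brst_mem_formsOfDegree k z hz.2⟩)
    (fun z hz => ⟨h.kos z hz.1, kos_mem_formsOfDegree k z hz.2⟩) ⟨h1, h2⟩ h3
  have e1 : retr x = x - PForm.brst y := by rw [← sub_eq_iff_eq_add.2 hxy]
  have hrQ : retr x ∈ Q := e1 ▸ Q.sub_mem h1 (h.brst _ hyQ)
  have hrk : retr x ∈ formsOfDegree n p k := e1 ▸ sub_mem h2 (brst_mem_formsOfDegree k y hyk)
  have e2 : ghostFree (retr x) = retr x :=
    isCounting_ghostNum.eq_of_eq_zero (by rw [ghostNum_retr hp, hgx, map_zero])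
  have e3 : PForm.extD (retr x) = 0 := by
    have e4 : retr (PForm.extD (retr x)) = PForm.extD (retr x) := by
      rw [← e2, extD_apply, map_sum]
      refine Finset.sum_congr rfl fun ν _ => ?_
      rw [map_mul, retr_dx, retr_pd_ghostFree_retr hp]
    rw [← e4, e1, map_sub, ← h4, eq_neg_of_add_eq_zero_right (brst_extD y), sub_neg_eq_add,
      ← map_add, retr_brst]
  obtain ⟨x₀, h5, β, h6, h7, h8, h9⟩ :=
    exists_eq_add_extD h.extD h.htpy h.num hk hrQ hrk e3
  have h10 : PForm.brst x₀ = 0 := brst_eq_zero_of_num h8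
  have h11 : formProj k (PForm.extD β) = PForm.extD β := by
    rw [← mem_formsOfDegree_iff, ← sub_eq_iff_eq_add'.2 h9]
    exact sub_mem hrk h7
  have h12 : PForm.extD (PForm.brst β) = 0 := by
    have := brst_retr hp x
    rw [h9, map_add, h10, zero_add] at this
    rw [eq_neg_of_add_eq_zero_right (brst_extD β), this, neg_zero]
  rw [hxy, h9]
  refine add_mem (add_mem ?_ (h11 ▸ hβ β h6 h12)) ?_
  · exact mem_smallClosed.2 ⟨x₀, h.const_mem k hk x₀ h5 h7 h8, h10, 0, zero_mem _, 0, zero_mem _,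
      map_zero _, by simp⟩
  · exact mem_smallClosed.2 ⟨0, zero_mem _, map_zero _, y, hyQ, 0, zero_mem _,
      map_zero _, by simp⟩

/-- Bottoms of descents can be chosen small. The undifferentiated ghosts of form degree zero are
removed one after the other. -/
theorem mem_smallClosed_of_mem_bottoms (hp : ∀ a, 1 ≤ p a) {k : ℕ} (hk : k < n)
    (hβ : ∀ β ∈ Q, PForm.extD (PForm.brst β) = 0 →
      formProj k (PForm.extD β) ∈ smallClosed S Q)
    {x : LocalForm n p} (hx : x ∈ bottoms Q k) : x ∈ smallClosed S Q := by
  have key : ∀ (j : ℕ), ∀ x ∈ bottoms Q k, ghostNum x = (j : ℝ) • x → x ∈ smallClosed S Q := by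
    intro j
    induction j with
    | zero =>
      intro x hx hj
      exact h.mem_smallClosed_of_ghostNum_eq_zero hp hk hβ hx (by simpa using hj)
    | succ j ih =>
      intro x hx hj
      obtain ⟨F, hF⟩ := exists_ghostNum_eq x
      have e : x = ((j + 1 : ℕ) : ℝ)⁻¹ •
          ∑ a ∈ F, form n a 0 (Nat.zero_le _) * PForm.ghostDer a x := by
        rw [← hF F subset_rfl, hj, smul_smul, inv_mul_cancel₀ (Nat.cast_ne_zero.2 j.succ_ne_zero),
          one_smul]
      rw [e]
      refine Submodule.smul_mem _ _ (Submodule.sum_mem _ fun a _ =>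
        h.form_mul_mem_smallClosed a (hp a) (ih _ (h.ghostDer_mem_bottoms a hx) ?_))
      rw [ghostNum_ghostDer, hj, map_smul, Nat.cast_succ, add_smul, one_smul, add_sub_cancel_right]
  have hstable : ∀ x ∈ bottoms Q k, ghostNum x ∈ bottoms Q k := by
    intro x hx
    obtain ⟨F, hF⟩ := exists_ghostNum_eq x
    rw [hF F subset_rfl]
    exact Submodule.sum_mem _ fun a _ =>
      h.form_mul_mem_bottoms a (hp a) (h.ghostDer_mem_bottoms a hx)
  obtain ⟨J, y, hy, rfl⟩ := isCounting_ghostNum.exists_sum hstable hx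
  exact Submodule.sum_mem _ fun j hj =>
    have hj' := hy j (Finset.mem_range.1 hj)
    key j _ hj'.1 hj'.2.1

/-- If `γ y` is `d`-closed, then it is `d`-exact. -/
theorem exists_brst_eq_extD {k : ℕ} (hk : k < n) {x : LocalForm n p} (hx : x ∈ Q)
    (hxk : x ∈ formsOfDegree n p k) (hd : PForm.extD (PForm.brst x) = 0) :
    ∃ z ∈ Q, PForm.brst x = PForm.extD z := by
  have hstable : ∀ x ∈ (Q ⊓ formsOfDegree n p k) ⊓ LinearMap.ker (PForm.extD ∘ₗ PForm.brst),
      PForm.num x ∈ (Q ⊓ formsOfDegree n p k) ⊓ LinearMap.ker (PForm.extD ∘ₗ PForm.brst) := by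
    rintro x ⟨⟨h1, h2⟩, h3⟩
    have h3 : PForm.extD (PForm.brst x) = 0 := h3
    refine ⟨⟨h.num x h1, num_mem_formsOfDegree k x h2⟩, ?_⟩
    change PForm.extD (PForm.brst (PForm.num x)) = 0
    rw [← num_brst, ← num_extD, h3, map_zero]
  obtain ⟨J, y, hy, rfl⟩ := isCounting_num.exists_sum hstable (x := x) ⟨⟨hx, hxk⟩, hd⟩
  have key : ∀ j ∈ Finset.range J, ∃ z ∈ Q, PForm.brst (y j) = PForm.extD z := by
    intro j hj
    obtain ⟨⟨⟨h1, h2⟩, h3⟩, h4, -⟩ := hy j (Finset.mem_range.1 hj)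
    rcases eq_or_ne j 0 with rfl | hj0
    · refine ⟨0, zero_mem _, ?_⟩
      rw [map_zero]
      exact brst_eq_zero_of_num (by simpa using h4)
    · exact exists_eq_extD h.extD h.htpy hk (c := j) (by exact_mod_cast Nat.pos_of_ne_zero hj0)
        (h.brst _ h1) (brst_mem_formsOfDegree k _ h2) (by rw [num_brst, h4, map_smul]) h3
  choose! z hz hyz using key
  refine ⟨∑ j ∈ Finset.range J, z j, Q.sum_mem hz, ?_⟩
  rw [map_sum, map_sum]
  exact Finset.sum_congr rfl hyz

end IsSmallPair

/-! ### Injectivity -/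

/-- The homomorphism that sets the second and higher derivatives of the gauge potentials to
zero. -/
noncomputable def jetOne : LocalForm n p →ₐ[ℝ] LocalForm n p :=
  evenHom (fun x => match x with
    | .dx μ => dx n p μ
    | .fld a l hl μ α => if l = p a ∧ 1 < α.card then 0 else fld a l hl μ α)
    (fun x => by
      cases x with
      | dx μ => exact HasParity.dx μ
      | fld a l hl μ α =>
        dsimp only
        split_ifs
        · exact HasParity.zero _
        · exact HasParity.fld a l hl μ α)
    (fun a l hl μ α σ => by
      dsimp only
      rw [fld_perm]
      split_ifs <;> simp)

theorem jetOne_isEven : IsEven (jetOne : LocalForm n p →ₐ[ℝ] LocalForm n p) :=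
  evenHom_isEven _ _ _

theorem jetOne_dx (μ : Fin n) : jetOne (dx n p μ) = dx n p μ := evenHom_gen _ _ _ _

theorem jetOne_fld (a : ι) (l : ℕ) (hl : l ≤ p a) (μ : Fin l → Fin n) (α : Multiset (Fin n)) :
    jetOne (fld a l hl μ α : LocalForm n p) =
      if l = p a ∧ 1 < α.card then 0 else fld a l hl μ α :=
  evenHom_gen _ _ _ _

theorem jetOne_of_mem_fldSpan {a : ι} {m : ℕ} {x : LocalForm n p}
    (hx : x ∈ fldSpan n p a (p a) m) : jetOne x = if 1 < m then 0 else x := by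
  induction hx using Submodule.span_induction with
  | mem x hx =>
    obtain ⟨hl, μ, α, rfl, rfl⟩ := hx
    rw [jetOne_fld]
    simp
  | zero => simp
  | add x y _ _ hx hy =>
    rw [map_add, hx, hy]
    split_ifs <;> simp
  | smul t x _ hx =>
    rw [map_smul, hx]
    split_ifs <;> simp

theorem retr_top_zero {a : ι} (ha : 1 ≤ p a) (μ : Fin (p a) → Fin n) :
    retr (fld a (p a) le_rfl μ 0 : LocalForm n p) = 0 := by
  have h0 : ((p a + 0 : ℕ) : ℝ) ≠ 0 := by exact_mod_cast (show p a + 0 ≠ 0 by omega)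
  rw [retr_top (fld_mem_fldSpan a (p a) le_rfl μ (α := 0) (m := 0) rfl), lap_apply,
    kos_fld_top a _ _ (lt_irrefl _), kos_brst_fld, exch]
  simp only [Multiset.count_zero, Nat.cast_zero, zero_smul, Finset.sum_const_zero, map_zero,
    add_zero, zero_add]
  rw [add_zero] at h0
  rw [smul_smul, inv_mul_cancel₀ h0, one_smul, sub_self]

section

variable (hp : ∀ a, 1 ≤ p a)
include hp

/-- The derivative of a function of the field strengths and of the undifferentiated ghosts is, up
to `γ`-exact terms, a combination of derivatives of the field strengths. -/
theorem jetOne_retr_pd_retr (ν : Fin n) (x : LocalForm n p) :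
    jetOne (retr (pd ν (retr x))) = 0 := by
  refine ((((pd_isDer ν).along.comp_right (ρ' := retr)).comp_left
    (retr_isEven (n := n) (p := p))).comp_left jetOne_isEven).ext IsDerAlong.zero (fun x => ?_) x
  change jetOne (retr (pd ν (retr (gen x)))) = 0
  cases x using Gen.cases_top with
  | hdx μ => rw [gen_dx, retr_dx, pd_dx, map_zero, map_zero]
  | hlow a l hl μ α h =>
    rw [gen_fld, retr_fld a l hl h]
    split_ifs
    · rw [pd_fld, retr_fld a l hl h, if_neg (fun h => Multiset.cons_ne_zero h.2), map_zero]
    · rw [map_zero, map_zero, map_zero]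
  | htop a μ α =>
    rcases eq_or_ne α 0 with rfl | h0
    · rw [gen_fld, retr_top_zero (hp a), map_zero, map_zero, map_zero]
    · have h1 := (retr_top_mem (hp a) (top_mem (p := p) a μ α)).1
      have h2 := (retr_top_mem (hp a) (pd_mem_fldSpan ν h1)).1
      have h3 := Multiset.card_pos.2 h0
      rw [gen_fld, jetOne_of_mem_fldSpan h2, if_pos (by omega)]

theorem jetOne_retr_fld (a : ι) (l : ℕ) (hl : l ≤ p a) (μ : Fin l → Fin n)
    {α : Multiset (Fin n)} (hα : α.card ≤ 1) :
    jetOne (retr (fld a l hl μ α : LocalForm n p)) = retr (fld a l hl μ α) := by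
  rcases lt_or_eq_of_le hl with h | rfl
  · rw [retr_fld a l hl h]
    split_ifs
    · rw [jetOne_fld, if_neg (fun h' => h.ne h'.1)]
    · rw [map_zero]
  · rw [jetOne_of_mem_fldSpan (retr_top_mem (hp a) (top_mem a μ α)).1, if_neg (by omega)]

theorem jetOne_retr_smallAlgConst {x : LocalForm n p} (hx : x ∈ smallAlgConst n p) :
    jetOne (retr x) = retr x := by
  have hdx : ∀ {l : ℕ} (μ : Fin l → Fin n), jetOne (retr (dxs p μ)) = retr (dxs p μ) := by
    intro l μ
    induction l with
    | zero => rw [dxs_zero, map_one, map_one]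
    | succ l ih => rw [dxs_succ, map_mul, map_mul, ih, retr_dx, jetOne_dx]
  induction hx using Algebra.adjoin_induction with
  | mem x hx =>
    rcases hx with ⟨a, l, hl, rfl | rfl⟩ | ⟨μ, rfl⟩
    · simp only [form, map_smul, map_sum, map_mul, hdx, jetOne_retr_fld hp _ _ _ _
        (show Multiset.card 0 ≤ 1 by simp)]
    · have h1 : ∀ (μ : Fin l → Fin n) (ν : Fin n), jetOne (retr (fld a l hl μ (ν ::ₘ 0))) =
          (retr (fld a l hl μ (ν ::ₘ 0)) : LocalForm n p) :=
        fun μ ν => jetOne_retr_fld hp a l hl μ (by simp)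
      simp only [form, extD_apply, map_smul, map_sum, pd_mul, pd_dxs, mul_zero, add_zero, pd_fld,
        map_mul, hdx, retr_dx, jetOne_dx, h1]
    · rw [retr_dx, jetOne_dx]
  | algebraMap r => simp
  | add x y _ _ hx hy => simp only [map_add, hx, hy]
  | mul x y _ _ hx hy => simp only [map_mul, hx, hy]

/-- A small element that is trivial in `E_1` of the local forms is `γ`-exact in the small
algebra: modulo `γ`-exact terms the total derivatives contain derivatives of the field strengths,
which do not occur in small elements. -/
theorem IsSmallPair.exists_eq_brst {S Q : Submodule ℝ (LocalForm n p)} (h : IsSmallPair S Q)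
    {x m u : LocalForm n p} (hx : x ∈ S) (hu : PForm.brst u = 0)
    (e : x = PForm.brst m + PForm.extD u) : ∃ y ∈ S, x = PForm.brst y := by
  have hγ : PForm.brst x = 0 := by
    rw [e, map_add, brst_brst, eq_neg_of_add_eq_zero_left (brst_extD u), hu, map_zero, neg_zero,
      add_zero]
  have h1 : retr x = retr (PForm.extD (retr u)) := by
    obtain ⟨y, -, hy⟩ := exists_eq_retr_add (Q := ⊤) hp (fun _ _ => trivial)
      (fun _ _ => trivial) (x := u) trivial hu
    rw [e, map_add, retr_brst, zero_add]
    conv_lhs => rw [hy]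
    rw [map_add, map_add, eq_neg_of_add_eq_zero_right (brst_extD y), map_neg, retr_brst, neg_zero,
      add_zero]
  have h2 : jetOne (retr (PForm.extD (retr u))) = 0 := by
    rw [extD_apply, map_sum, map_sum]
    refine Finset.sum_eq_zero fun ν _ => ?_
    rw [map_mul, map_mul, jetOne_retr_pd_retr hp, mul_zero]
  obtain ⟨y, hyS, hy⟩ := exists_eq_retr_add hp h.small_brst h.small_kos hx hγ
  refine ⟨y, hyS, ?_⟩
  rw [← jetOne_retr_smallAlgConst hp (h.le_const hx), h1, h2, zero_add] at hy
  exact hy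

end

/-! ### Lorentz covariance of the homotopies -/

theorem map_eq_zero_of_mem_fldSpan {T : LocalForm n p →ₗ[ℝ] LocalForm n p} {a : ι} {l m : ℕ}
    (hT : ∀ (hl : l ≤ p a) (μ : Fin l → Fin n) (α : Multiset (Fin n)), α.card = m →
      T (fld a l hl μ α) = 0) {x : LocalForm n p} (hx : x ∈ fldSpan n p a l m) : T x = 0 := by
  have : fldSpan n p a l m ≤ LinearMap.ker T := by
    rw [fldSpan, Submodule.span_le]
    rintro x ⟨hl, μ, α, hα, rfl⟩
    exact hT hl μ α hα
  exact this hx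

theorem rot_fld_mem_fldSpan (ω : Matrix (Fin n) (Fin n) ℝ) (a : ι) (l : ℕ) (hl : l ≤ p a)
    (μ : Fin l → Fin n) (α : Multiset (Fin n)) :
    rot ω (fld a l hl μ α) ∈ fldSpan n p a l α.card := by
  rw [rot_fld]
  refine sub_mem (neg_mem (Submodule.sum_mem _ fun j _ => Submodule.sum_mem _ fun ν _ =>
    Submodule.smul_mem _ _ (fld_mem_fldSpan _ _ _ _ rfl))) (multiset_sum_mem _ fun x hx => ?_)
  obtain ⟨ρ, hρ, rfl⟩ := Multiset.mem_map.1 hx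
  refine Submodule.sum_mem _ fun ν _ => Submodule.smul_mem _ _ (fld_mem_fldSpan _ _ _ _ ?_)
  rw [Multiset.card_cons, Multiset.card_erase_add_one hρ]

theorem rot_fld_zero (ω : Matrix (Fin n) (Fin n) ℝ) (a : ι) (hl : 0 ≤ p a)
    (μ : Fin 0 → Fin n) : rot ω (fld a 0 hl μ 0 : LocalForm n p) = 0 := by
  simp [rot_fld]

theorem num_rot (ω : Matrix (Fin n) (Fin n) ℝ) (x : LocalForm n p) :
    num (rot ω x) = rot ω (num x) := by
  refine num_isDer.commute (rot_isDer ω) (fun x => ?_) x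
  cases x with
  | dx μ => simp [gen_dx, rot_dx, num_dx]
  | fld a l hl μ α =>
    rw [gen_fld, num_fld]
    exact sub_eq_zero.1 (map_eq_zero_of_mem_fldSpan (T := num - LinearMap.id)
      (fun hl μ α _ => by simp [num_fld]) (rot_fld_mem_fldSpan ω a l hl μ α))

theorem rot_ghostDer (ω : Matrix (Fin n) (Fin n) ℝ) (a : ι) (x : LocalForm n p) :
    rot ω (ghostDer a x) = ghostDer a (rot ω x) := by
  refine (rot_isDer ω).commute (ghostDer_isDer a) (fun x => ?_) x
  cases x with
  | dx μ => simp [gen_dx, rot_dx, ghostDer_dx]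
  | fld b l hl μ α =>
    have h1 : rot ω (ghostDer a (fld b l hl μ α : LocalForm n p)) = 0 := by
      rw [ghostDer_fld]
      split_ifs
      · exact (rot_isDer ω).one
      · exact map_zero _
    rw [gen_fld, h1]
    by_cases h : l = 0 ∧ α = 0
    · obtain ⟨rfl, rfl⟩ := h
      rw [rot_fld_zero, map_zero]
    · refine (ghostDer_of_mem_fldSpan a (m := α.card) ?_ (rot_fld_mem_fldSpan ω b l hl μ α)).symm
      intro h'
      exact h ⟨by omega, Multiset.card_eq_zero.1 (by omega)⟩

theorem rot_iota (ω : Matrix (Fin n) (Fin n) ℝ) (ν : Fin n) (x : LocalForm n p) :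
    rot ω (iota ν x) = iota ν (rot ω x) - ∑ ρ, ω ρ ν • iota ρ x := by
  have h := ((rot_isDer (p := p) ω).comm_even (iota_isDer ν)).ext
    ((IsDer.sum (s := Finset.univ) fun ρ _ => (iota_isDer ρ).smul (ω ρ ν)).smul (-1))
    (fun x => ?_) x
  · simp only [LinearMap.sub_apply, LinearMap.comp_apply, LinearMap.smul_apply, neg_smul, one_smul,
      LinearMap.sum_apply] at h
    rw [sub_eq_iff_eq_add.1 h]
    abel
  · cases x with
    | dx μ =>
      have h1 : rot ω (iota ν (dx n p μ)) = 0 := by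
        rw [iota_dx]
        split_ifs
        · exact (rot_isDer ω).one
        · exact map_zero _
      rw [iota_dx] at h1
      simp [gen_dx, h1, rot_dx, iota_dx]
    | fld a l hl μ α =>
      have h1 : iota ν (rot ω (fld a l hl μ α : LocalForm n p)) = 0 :=
        map_eq_zero_of_mem_fldSpan (fun hl μ α _ => iota_fld ν a l hl μ α)
          (rot_fld_mem_fldSpan ω a l hl μ α)
      simp [gen_fld, h1, iota_fld]

/-- Derivations of the same parity agree if they agree on the components of
the fields and ghosts without derivatives and if agreement extends to total derivatives. -/
theorem IsDer.ext_pd {e : ℕ} {D D' : LocalForm n p →ₗ[ℝ] LocalForm n p} (h : IsDer e D)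
    (h' : IsDer e D') (hdx : ∀ μ, D (dx n p μ) = D' (dx n p μ))
    (hfld : ∀ a l hl μ, D (fld a l hl μ 0) = D' (fld a l hl μ 0))
    (hpd : ∀ a l hl (α : Multiset (Fin n)), (∀ μ, D (fld a l hl μ α) = D' (fld a l hl μ α)) →
      ∀ μ ρ, D (pd ρ (fld a l hl μ α)) = D' (pd ρ (fld a l hl μ α)))
    (x : LocalForm n p) : D x = D' x := by
  refine h.ext h' (fun x => ?_) x
  cases x with
  | dx μ => exact hdx μ
  | fld a l hl μ α =>
    rw [gen_fld]
    induction α using Multiset.induction generalizing μ with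
    | empty => exact hfld a l hl μ
    | cons ρ α ih =>
      have := hpd a l hl α ih μ ρ
      rwa [pd_fld] at this

theorem unpd_fld_zero (ν : Fin n) (a : ι) (l : ℕ) (hl : l ≤ p a) (μ : Fin l → Fin n) :
    unpd ν (fld a l hl μ 0 : LocalForm n p) = 0 := by
  simp [unpd_fld]

theorem kos_fld_zero (a : ι) (l : ℕ) (hl : l ≤ p a) (μ : Fin l → Fin n) :
    kos (fld a l hl μ 0 : LocalForm n p) = 0 := by
  by_cases h : l < p a
  · simp [kos_fld a l hl h]
  · exact kos_fld_top a l hl h μ 0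

theorem rot_unpd (ω : Matrix (Fin n) (Fin n) ℝ) (ν : Fin n) (x : LocalForm n p) :
    rot ω (unpd ν x) = unpd ν (rot ω x) + ∑ ρ, ω ν ρ • unpd ρ x := by
  have hD := (rot_isDer (p := p) ω).comm_even (unpd_isDer ν)
  have hD' := IsDer.sum (s := Finset.univ) fun ρ _ => (unpd_isDer (p := p) ρ).smul (ω ν ρ)
  have h := hD.ext_pd hD' (fun μ => ?_) (fun a l hl μ => ?_) (fun a l hl α ih μ σ => ?_) x
  · simp only [LinearMap.sub_apply, LinearMap.comp_apply, LinearMap.smul_apply,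
      LinearMap.sum_apply] at h
    rw [sub_eq_iff_eq_add.1 h]
    abel
  · simp [rot_dx, unpd_dx]
  · have h1 : unpd ν (rot ω (fld a l hl μ 0 : LocalForm n p)) = 0 :=
      map_eq_zero_of_mem_fldSpan (fun hl μ α hα => by
        rw [Multiset.card_zero, Multiset.card_eq_zero] at hα
        rw [hα, unpd_fld_zero]) (rot_fld_mem_fldSpan ω a l hl μ 0)
    simp [h1, unpd_fld_zero]
  · have ih := ih μ
    generalize (fld a l hl μ α : LocalForm n p) = x at ih ⊢
    simp only [LinearMap.sub_apply, LinearMap.comp_apply, LinearMap.smul_apply,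
      LinearMap.sum_apply] at ih ⊢
    have e1 : rot ω (if ν = σ then num x else 0) = if ν = σ then num (rot ω x) else 0 := by
      split_ifs
      · rw [num_rot]
      · exact map_zero _
    have e2 : ∑ ρ, ω ρ σ • (if ν = ρ then num x else 0) = ω ν σ • num x := by
      simp
    have e3 : ∑ ρ, ω ν ρ • (if ρ = σ then num x else 0) = ω ν σ • num x := by
      simp
    simp only [rot_pd, unpd_pd, map_add, map_sub, map_sum, map_smul, smul_add,
      Finset.sum_add_distrib, e1, e2, e3]
    rw [sub_eq_iff_eq_add.1 ih, map_add, map_sum]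
    simp only [map_smul]
    abel

/-- The commutator of `σ` with a total derivative adds an antisymmetric index. -/
theorem kos_pd_fld (a : ι) (l : ℕ) (hl : l ≤ p a) (h : l < p a) (μ : Fin l → Fin n) (ρ : Fin n)
    (α : Multiset (Fin n)) :
    kos (pd ρ (fld a l hl μ α : LocalForm n p)) = pd ρ (kos (fld a l hl μ α)) +
      (-1 : ℝ) ^ (p a - (l + 1)) •
        fld a (l + 1) h (Fin.cons ρ μ : Fin (l + 1) → Fin n) α := by
  rw [pd_fld, kos_fld a l hl h, kos_fld a l hl h, sum_count_cons ρ α fun ν β =>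
    (fld a (l + 1) h (Fin.cons ν μ : Fin (l + 1) → Fin n) β : LocalForm n p), smul_add, add_comm,
    map_smul, map_sum]
  simp only [map_smul, pd_fld]

/-- The formula `kos_pd_fld` for the linear combinations that arise from an infinitesimal linear
transformation; the last sum completes the transformation of the additional index. -/
theorem kos_pd_rot_fld (ω : Matrix (Fin n) (Fin n) ℝ) (a : ι) (l : ℕ) (hl : l ≤ p a) (h : l < p a)
    (μ : Fin l → Fin n) (ρ : Fin n) (α : Multiset (Fin n)) :
    kos (pd ρ (rot ω (fld a l hl μ α : LocalForm n p))) =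
      pd ρ (kos (rot ω (fld a l hl μ α))) + (-1 : ℝ) ^ (p a - (l + 1)) •
        (rot ω (fld a (l + 1) h (Fin.cons ρ μ : Fin (l + 1) → Fin n) α) +
          ∑ ν, ω ν ρ • fld a (l + 1) h (Fin.cons ν μ : Fin (l + 1) → Fin n) α) := by
  have e : rot ω (fld a (l + 1) h (Fin.cons ρ μ : Fin (l + 1) → Fin n) α : LocalForm n p) +
      ∑ ν, ω ν ρ • fld a (l + 1) h (Fin.cons ν μ : Fin (l + 1) → Fin n) α =
      -(∑ j, ∑ ν, ω ν (μ j) •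
        fld a (l + 1) h (Fin.cons ρ (Function.update μ j ν) : Fin (l + 1) → Fin n) α) -
      (α.map fun σ => ∑ ν, ω ν σ •
        fld a (l + 1) h (Fin.cons ρ μ : Fin (l + 1) → Fin n) (ν ::ₘ α.erase σ)).sum := by
    rw [rot_fld, Fin.sum_univ_succ]
    simp only [Fin.cons_zero, Fin.cons_succ, Fin.update_cons_zero, ← Fin.cons_update]
    abel
  have e2 : ∀ s : Multiset (LocalForm n p), (-1 : ℝ) ^ (p a - (l + 1)) • s.sum =
      (s.map fun x => (-1 : ℝ) ^ (p a - (l + 1)) • x).sum := fun s => Multiset.smul_sum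
  rw [e, rot_fld, smul_sub, e2, smul_neg, Finset.smul_sum]
  simp only [map_sub, map_neg, map_sum, map_smul, map_multiset_sum, Multiset.map_map,
    Function.comp_def, kos_pd_fld a l hl h, smul_add, Finset.sum_add_distrib,
    Multiset.sum_map_add, Finset.smul_sum]
  simp only [smul_comm ((-1 : ℝ) ^ (p a - (l + 1))) (ω _ _)]
  abel

theorem rot_kos (ω : Matrix (Fin n) (Fin n) ℝ) (x : LocalForm n p) :
    rot ω (kos x) = kos (rot ω x) := by
  have hD := (rot_isDer (p := p) ω).comm_even kos_isDer
  refine sub_eq_zero.1 (hD.ext_pd (IsDer.zero _) (fun μ => ?_) (fun a l hl μ => ?_)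
    (fun a l hl α ih μ ρ => ?_) x)
  · simp [rot_dx, kos_dx]
  · have h1 : kos (rot ω (fld a l hl μ 0 : LocalForm n p)) = 0 :=
      map_eq_zero_of_mem_fldSpan (fun hl μ α hα => by
        rw [Multiset.card_zero, Multiset.card_eq_zero] at hα
        rw [hα, kos_fld_zero]) (rot_fld_mem_fldSpan ω a l hl μ 0)
    simp [h1, kos_fld_zero]
  · have ih : rot ω (kos (fld a l hl μ α : LocalForm n p)) = kos (rot ω (fld a l hl μ α)) :=
      sub_eq_zero.1 (ih μ)
    simp only [LinearMap.sub_apply, LinearMap.comp_apply, LinearMap.zero_apply]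
    rw [sub_eq_zero]
    rcases lt_or_eq_of_le hl with h | rfl
    · rw [kos_pd_fld a l hl h, map_add, rot_pd, ih, rot_pd, map_sub, kos_pd_rot_fld ω a l hl h,
        map_sum]
      simp only [map_smul, kos_pd_fld a l hl h, smul_add, Finset.sum_add_distrib, Finset.smul_sum]
      simp only [smul_comm ((-1 : ℝ) ^ (p a - (l + 1))) (ω _ _)]
      abel
    · have h1 := fld_mem_fldSpan (n := n) a (p a) hl μ (α := α) rfl
      rw [pd_fld, kos_fld_top a _ hl (lt_irrefl _), map_zero,
        kos_of_mem_fldSpan (rot_fld_mem_fldSpan ω a _ hl μ (ρ ::ₘ α))]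

theorem rot_htpy (ω : Matrix (Fin n) (Fin n) ℝ) (x : LocalForm n p) :
    rot ω (htpy x) = htpy (rot ω x) := by
  rw [htpy_apply, htpy_apply, map_sum]
  simp only [rot_iota, rot_unpd, map_add, map_sum, map_smul, Finset.sum_add_distrib,
    Finset.sum_sub_distrib]
  rw [Finset.sum_comm, add_sub_cancel_right]

/-! ### Invariant constants -/

theorem constPart_mem_smallAlgConst (x : LocalForm n p) : constPart x ∈ smallAlgConst n p := by
  induction x using LocalForm.induction with
  | halg r => rw [AlgHom.commutes]; exact Subalgebra.algebraMap_mem _ r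
  | hgen x =>
    cases x with
    | dx μ => rw [gen_dx, constPart_dx]; exact Algebra.subset_adjoin (Or.inr ⟨μ, rfl⟩)
    | fld a l hl μ α => rw [gen_fld, constPart_fld]; exact zero_mem _
  | hmul x y hx hy => rw [map_mul]; exact mul_mem hx hy
  | hadd x y hx hy => rw [map_add]; exact add_mem hx hy

/-- A constant of form degree zero is a number. -/
theorem constPart_mem_of_degree_zero (A : Subalgebra ℝ (LocalForm n p)) {x : LocalForm n p}
    (hx : x ∈ formsOfDegree n p 0) : constPart x ∈ A := by
  have : formsOfDegree n p 0 ≤ (Subalgebra.toSubmodule A).comap constPart.toLinearMap := by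
    rw [formsOfDegree, Submodule.span_le]
    rintro x ⟨L, hL, rfl⟩
    change constPart (L.map gen).prod ∈ A
    cases L with
    | nil => rw [List.map_nil, List.prod_nil, map_one]; exact one_mem _
    | cons y L =>
      cases y with
      | dx μ =>
        simp only [List.map_cons, List.sum_cons, Gen.formDeg] at hL
        omega
      | fld a l hl μ α =>
        rw [List.map_cons, List.prod_cons, map_mul, gen_fld, constPart_fld, zero_mul]
        exact zero_mem _
  exact this hx

/-- On constants, a linear transformation acts on the differentials only. -/
theorem rot_of_num_eq_zero (ω : Matrix (Fin n) (Fin n) ℝ) {x : LocalForm n p} (hx : num x = 0) :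
    rot ω x = ∑ μ, ∑ ν, ω μ ν • (dx n p ν * iota μ x) := by
  have hD : IsDer 0 (∑ μ, ∑ ν, ω μ ν • (LinearMap.mulLeft ℝ (dx n p ν) ∘ₗ iota μ)) :=
    IsDer.sum fun μ _ => IsDer.sum fun ν _ => (dx_mul_isDer ν (iota_isDer μ)).smul (ω μ ν)
  have h := ((rot_isDer ω).along.comp_right (ρ' := constPart)).ext
    (hD.along.comp_right (ρ' := constPart)) (fun x => ?_) x
  · simp only [LinearMap.comp_apply, AlgHom.toLinearMap_apply,
      isCounting_num.eq_of_eq_zero hx] at h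
    rw [h]
    simp [LinearMap.sum_apply]
  · simp only [LinearMap.comp_apply, AlgHom.toLinearMap_apply]
    cases x with
    | dx μ =>
      rw [gen_dx, constPart_dx, rot_dx]
      simp only [LinearMap.sum_apply, LinearMap.smul_apply, LinearMap.comp_apply,
        LinearMap.mulLeft_apply, iota_dx]
      rw [Finset.sum_eq_single μ (fun ρ _ hρ => Finset.sum_eq_zero fun ν _ => by
        rw [if_neg (Ne.symm hρ), mul_zero, smul_zero]) (by simp)]
      simp
    | fld a l hl μ α => rw [gen_fld, constPart_fld, map_zero, map_zero]

/-- The sign of the Minkowski metric. -/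
def metricSign (μ : Fin n) : ℝ := if (μ : ℕ) = 0 then -1 else 1

theorem metricSign_mul_self (μ : Fin n) : metricSign μ * metricSign μ = 1 := by
  unfold metricSign
  split_ifs <;> norm_num

/-- The infinitesimal Lorentz transformation in the plane of two coordinates. -/
theorem single_sub_single_mem_lorentzAlg (a b : Fin n) :
    Matrix.diagonal metricSign * (Matrix.single a b (1 : ℝ) - Matrix.single b a 1) ∈
      lorentzAlg n := by
  have h : Matrix.diagonal metricSign * Matrix.diagonal (metricSign (n := n)) = 1 := by
    rw [Matrix.diagonal_mul_diagonal]
    simp [metricSign_mul_self]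
  change Matrix.transpose _ * Matrix.diagonal metricSign +
    Matrix.diagonal metricSign * (Matrix.diagonal metricSign * _) = 0
  rw [Matrix.transpose_mul, Matrix.diagonal_transpose, Matrix.mul_assoc, h, ← Matrix.mul_assoc, h,
    Matrix.mul_one, Matrix.one_mul, Matrix.transpose_sub, Matrix.transpose_single,
    Matrix.transpose_single]
  abel

theorem dx_mul_self (μ : Fin n) : dx n p μ * dx n p μ = 0 := eq_zero_of_eq_neg (dx_dx μ μ)

/-- There are no Lorentz invariant constant forms of form degree `0 < k < n`. -/
theorem eq_zero_of_lorentz_const {k : ℕ} (hk0 : k ≠ 0) (hk : k < n) {x : LocalForm n p}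
    (hx : x ∈ lorentzForm n p) (hxk : x ∈ formsOfDegree n p k) (hn : num x = 0) : x = 0 := by
  have h1 : ∀ a b : Fin n, a ≠ b → metricSign a • (dx n p b * iota a x) =
      metricSign b • (dx n p a * iota b x) := by
    intro a b hab
    have h := mem_lorentzForm.1 hx _ (single_sub_single_mem_lorentzAlg a b)
    rw [rot_of_num_eq_zero _ hn] at h
    simp only [Matrix.diagonal_mul, Matrix.sub_apply, Matrix.single_apply, mul_sub, sub_smul,
      Finset.sum_sub_distrib, mul_ite, mul_one, mul_zero, ite_smul, zero_smul, ite_and,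
      Finset.sum_ite_eq, Finset.mem_univ, if_true, Finset.sum_ite_irrel,
      Finset.sum_const_zero] at h
    exact sub_eq_zero.1 h
  have h2 : ∀ a b : Fin n, dx n p b * (dx n p a * iota a x) = 0 := by
    intro a b
    rcases eq_or_ne a b with rfl | hab
    · rw [← mul_assoc, dx_mul_self, zero_mul]
    · have h := congrArg (fun y => metricSign a • (dx n p a * y)) (h1 a b hab)
      simp only [mul_smul_comm, smul_smul, metricSign_mul_self, one_smul] at h
      rw [← mul_assoc, dx_dx, neg_mul, mul_assoc, h, ← mul_assoc, dx_mul_self, zero_mul, smul_zero,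
        neg_zero]
  have h3 : ∀ b : Fin n, dx n p b * x = 0 := by
    intro b
    have h : dx n p b * ∑ a, dx n p a * iota a x = 0 := by
      rw [Finset.mul_sum]
      exact Finset.sum_eq_zero fun a _ => h2 a b
    rw [sum_dx_iota hxk, mul_smul_comm] at h
    exact (smul_eq_zero.1 h).resolve_left (Nat.cast_ne_zero.2 hk0)
  have h4 : ∀ b : Fin n, dx n p b * iota b x = x := by
    intro b
    have h := iota_dx_mul (p := p) b b x
    rw [h3, map_zero, if_pos rfl] at h
    exact (sub_eq_zero.1 h.symm).symm
  have h5 := sum_dx_iota hxk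
  simp only [h4, Finset.sum_const, Finset.card_univ, Fintype.card_fin] at h5
  rw [← Nat.cast_smul_eq_nsmul ℝ, ← sub_eq_zero, ← sub_smul] at h5
  refine (smul_eq_zero.1 h5).resolve_left (sub_ne_zero.2 ?_)
  exact_mod_cast hk.ne'

/-! ### The two pairs of algebras -/

theorem lap_fld_zero (a : ι) (l : ℕ) (hl : l ≤ p a) (μ : Fin l → Fin n) :
    lap (fld a l hl μ 0 : LocalForm n p) = (l : ℝ) • fld a l hl μ 0 := by
  rw [lap_apply, kos_fld_zero, kos_brst_fld, exch]
  simp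

theorem kos_dxs {l : ℕ} (μ : Fin l → Fin n) : kos (dxs p μ) = 0 := by
  induction l with
  | zero => rw [dxs_zero, kos_isDer.one]
  | succ l ih => rw [dxs_succ, kos_isDer.mul, kos_dx, ih, zero_mul, mul_zero, add_zero]

theorem kos_form (a : ι) (l : ℕ) (hl : l ≤ p a) : kos (form n a l hl) = 0 := by
  simp [form, kos_isDer.mul, kos_fld_zero, kos_dxs]

theorem lap_form (a : ι) (l : ℕ) (hl : l ≤ p a) :
    lap (form n a l hl) = (l : ℝ) • form n a l hl := by
  have h : ∀ μ : Fin l → Fin n, lap (dxs p μ) = 0 := fun μ => by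
    simp [lap_apply, kos_dxs, brst_dxs]
  simp only [form, map_smul, map_sum, lap_isDer.mul_zero, lap_fld_zero, h, mul_zero, add_zero,
    smul_mul_assoc, ← Finset.smul_sum]
  rw [smul_comm]

theorem kos_extD_form (a : ι) (l : ℕ) (hl : l ≤ p a) (A : Subalgebra ℝ (LocalForm n p))
    (hA : smallGens n p ⊆ A) : kos (extD (form n a l hl)) ∈ A := by
  rcases lt_or_eq_of_le hl with h | rfl
  · have h1 := lap_form (n := n) a (l + 1) h
    rw [lap_apply, kos_form, map_zero, zero_add] at h1
    rw [eq_neg_of_add_eq_zero_right (brst_form_succ a l h), map_neg, h1]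
    exact neg_mem (A.smul_mem (hA ⟨a, l + 1, h, Or.inl rfl⟩) _)
  · have h1 : ∀ (μ : Fin (p a) → Fin n) (α : Multiset (Fin n)),
        kos (fld a (p a) hl μ α : LocalForm n p) = 0 :=
      fun μ α => kos_fld_top a _ hl (lt_irrefl _) μ α
    have h2 : kos (extD (form n a (p a) hl)) = 0 := by
      simp [form, extD_apply, pd_mul, pd_dxs, pd_fld, kos_isDer.mul, kos_dx, kos_dxs, h1]
    rw [h2]
    exact zero_mem _

theorem smallAlg_le_smallAlgConst : smallAlg n p ≤ smallAlgConst n p :=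
  Algebra.adjoin_mono Set.subset_union_left

theorem isSmallPair_lorentz :
    IsSmallPair (Subalgebra.toSubmodule (smallAlg n p)) (lorentzForm n p) where
  le_const := smallAlg_le_smallAlgConst
  small_brst := adjoin_stable (smallGens_tw Algebra.subset_adjoin) brst
    (smallGens_brst Algebra.subset_adjoin) brst_mul brst_algebraMap
  small_kos := adjoin_stable (smallGens_tw Algebra.subset_adjoin) kos
    (by
      rintro x ⟨a, l, hl, rfl | rfl⟩
      · rw [kos_form]
        exact zero_mem _
      · exact kos_extD_form a l hl _ Algebra.subset_adjoin)
    kos_isDer.mul kos_isDer.alg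
  small_form_mul a l hl x hx := mul_mem (S := Subalgebra ℝ (LocalForm n p))
    (Algebra.subset_adjoin ⟨a, l, hl, Or.inl rfl⟩) hx
  brst x hx := mem_lorentzForm.2 fun ω hω => by
    rw [rot_brst, mem_lorentzForm.1 hx ω hω, map_zero]
  extD x hx := mem_lorentzForm.2 fun ω hω => by
    rw [rot_extD, mem_lorentzForm.1 hx ω hω, map_zero]
  num x hx := mem_lorentzForm.2 fun ω hω => by
    rw [← num_rot, mem_lorentzForm.1 hx ω hω, map_zero]
  htpy x hx := mem_lorentzForm.2 fun ω hω => by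
    rw [rot_htpy, mem_lorentzForm.1 hx ω hω, map_zero]
  kos x hx := mem_lorentzForm.2 fun ω hω => by
    rw [rot_kos, mem_lorentzForm.1 hx ω hω, map_zero]
  ghostDer a x hx := mem_lorentzForm.2 fun ω hω => by
    rw [rot_ghostDer, mem_lorentzForm.1 hx ω hω, map_zero]
  form_mul a l hl x hx := mem_lorentzForm.2 fun ω hω => by
    rw [rot_mul, rot_form, mem_lorentzForm.1 hx ω hω, zero_mul, mul_zero, add_zero]
  const_mem k hk x hx hxk hn := by
    rcases eq_or_ne k 0 with rfl | hk0
    · rw [← isCounting_num.eq_of_eq_zero hn]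
      exact constPart_mem_of_degree_zero _ hxk
    · rw [eq_zero_of_lorentz_const hk0 hk hx hxk hn]
      exact zero_mem _

theorem smallGens_union_tw : ∀ x ∈ smallGens n p ∪ Set.range (dx n p),
    tw 1 x ∈ Algebra.adjoin ℝ (smallGens n p ∪ Set.range (dx n p)) := by
  rintro x (hx | ⟨μ, rfl⟩)
  · exact smallGens_tw (Set.subset_union_left.trans Algebra.subset_adjoin) x hx
  · rw [tw_dx]
    exact neg_mem (Algebra.subset_adjoin (Or.inr ⟨μ, rfl⟩))

theorem isSmallPair_const :
    IsSmallPair (Subalgebra.toSubmodule (smallAlgConst n p)) ⊤ where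
  le_const := le_rfl
  small_brst := adjoin_stable smallGens_union_tw brst
    (by
      rintro x (hx | ⟨μ, rfl⟩)
      · exact smallGens_brst (Set.subset_union_left.trans Algebra.subset_adjoin) x hx
      · rw [brst_dx]
        exact zero_mem _)
    brst_mul brst_algebraMap
  small_kos := adjoin_stable smallGens_union_tw kos
    (by
      rintro x (⟨a, l, hl, rfl | rfl⟩ | ⟨μ, rfl⟩)
      · rw [kos_form]
        exact zero_mem _
      · exact kos_extD_form a l hl _ (Set.subset_union_left.trans Algebra.subset_adjoin)
      · rw [kos_dx]
        exact zero_mem _)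
    kos_isDer.mul kos_isDer.alg
  small_form_mul a l hl x hx := mul_mem (S := Subalgebra ℝ (LocalForm n p))
    (Algebra.subset_adjoin (Or.inl ⟨a, l, hl, Or.inl rfl⟩)) hx
  brst _ _ := trivial
  extD _ _ := trivial
  num _ _ := trivial
  htpy _ _ := trivial
  kos _ _ := trivial
  ghostDer _ _ _ := trivial
  form_mul _ _ _ _ _ := trivial
  const_mem k hk x hx hxk hn := by
    rw [← isCounting_num.eq_of_eq_zero hn]
    exact constPart_mem_smallAlgConst x

/-- The abstract comparison applied to a pair of algebras of local forms, given as bidifferential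
spaces embedded in the local forms. -/
theorem IsSmallPair.comparison {S Q : Submodule ℝ (LocalForm n p)} (h : IsSmallPair S Q)
    (hp : ∀ a, 1 ≤ p a) {V W : Type*} [AddCommGroup V] [Module ℝ V] [AddCommGroup W] [Module ℝ W]
    {D : Bidiff V} {D' : Bidiff W} {f : V →ₗ[ℝ] W} (hf : D.IsHom D' f)
    {i : V →ₗ[ℝ] LocalForm n p} {j : W →ₗ[ℝ] LocalForm n p} (hi : D.IsHom (localForms n p) i)
    (hj : D'.IsHom (localForms n p) j) (hji : ∀ x, j (f x) = i x) (hi' : Function.Injective i)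
    (hj' : Function.Injective j) (hS : LinearMap.range i = S) (hQ : LinearMap.range j = Q)
    {π : ℕ → V →ₗ[ℝ] V} {π' : ℕ → W →ₗ[ℝ] W} (G : D.Grading n π) (G' : D'.Grading n π')
    (hπ : ∀ k x, i (π k x) = formProj k (i x)) (hπ' : ∀ k x, j (π' k x) = formProj k (j x)) :
    (∀ a, D'.IsWZ a → ∃ s, D.IsWZ s ∧ ∃ t, D'.DescendsTrivially t ∧ D'.IsTrivial (a - (f s + t))) ∧
      ∀ r, 1 ≤ r → (∀ x, Bidiff.mapE hf r (D.dE r x) = D'.dE r (Bidiff.mapE hf r x)) ∧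
        Function.Injective (Bidiff.mapE hf r) ∧
        ∀ k < n, Set.BijOn (Bidiff.mapE hf r)
          (D.classesIn ((formsOfDegree n p k).comap i) r)
          (D'.classesIn ((formsOfDegree n p k).comap j) r) := by
  subst hS hQ
  have hiγ : ∀ x, i (D.γ x) = PForm.brst (i x) := hi.1
  have hjγ : ∀ x, j (D'.γ x) = PForm.brst (j x) := hj.1
  have hjd : ∀ x, j (D'.d x) = PForm.extD (j x) := hj.2
  have hmem : ∀ k x, j x ∈ formsOfDegree n p k ↔ π' k x = x := by
    intro k x
    rw [mem_formsOfDegree_iff, ← hπ']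
    exact hj'.eq_iff
  have hB1 : ∀ y, y ∈ D'.B 1 ↔ ∃ m u, D'.γ u = 0 ∧ y = D'.γ m + D'.d u := by
    intro y
    rw [Bidiff.mem_B_succ]
    constructor
    · rintro ⟨X, u, hu, m, hm⟩
      obtain ⟨rfl, hu⟩ := D'.lift_zero.1 hu
      exact ⟨m, u, hu, by rw [hm, sub_add_cancel]⟩
    · rintro ⟨m, u, hu, rfl⟩
      exact ⟨u, u, D'.lift_zero.2 ⟨rfl, hu⟩, m, by rw [add_sub_cancel_right]⟩
  have hsmall : ∀ y, j y ∈ smallClosed (LinearMap.range i) (LinearMap.range j) ↔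
      ∃ s, D.γ s = 0 ∧ y - f s ∈ D'.B 1 := by
    intro y
    rw [mem_smallClosed]
    constructor
    · rintro ⟨_, ⟨s, rfl⟩, h1, _, ⟨m, rfl⟩, _, ⟨u, rfl⟩, h2, e⟩
      refine ⟨s, hi' (by rw [hiγ, h1, map_zero]), (hB1 _).2 ⟨m, u, hj' (by rw [hjγ, h2, map_zero]),
        hj' ?_⟩⟩
      rw [map_sub, hji, e, map_add, hjγ, hjd, add_sub_cancel_left]
    · rintro ⟨s, h1, h2⟩
      obtain ⟨m, u, h3, h4⟩ := (hB1 _).1 h2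
      refine ⟨_, ⟨s, rfl⟩, by rw [← hiγ, h1, map_zero], _, ⟨m, rfl⟩, _, ⟨u, rfl⟩,
        by rw [← hjγ, h3, map_zero], ?_⟩
      rw [← hjγ, ← hjd, ← map_add, ← h4, map_sub, hji, add_sub_cancel]
  refine Bidiff.comparison hf G G' (fun k x => hj' (by rw [hπ', hji, hji, hπ])) ?_ ?_ ?_ ?_ ?_
  · intro k hk y hy hd
    obtain ⟨_, ⟨z, rfl⟩, hz⟩ := h.exists_brst_eq_extD hk ⟨y, rfl⟩ ((hmem k y).2 hy)
      (by rw [← hjγ, ← hjd, hd, map_zero])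
    exact ⟨z, hj' (by rw [hjγ, hz, hjd])⟩
  · intro x hx
    obtain ⟨m, u, hu, e⟩ := (hB1 _).1 hx
    obtain ⟨_, ⟨y, rfl⟩, hy⟩ := h.exists_eq_brst hp ⟨x, rfl⟩ (m := j m) (u := j u)
      (by rw [← hjγ, hu, map_zero]) (by rw [← hji, e, map_add, hjγ, hjd])
    exact ⟨y, hi' (by rw [hiγ, hy])⟩
  · rintro k hk hβ α hα h1 ⟨m, hm⟩
    rw [← hsmall]
    refine h.mem_smallClosed_of_mem_bottoms hp hk ?_ (mem_bottoms.2 ⟨⟨α, rfl⟩, (hmem k α).2 hα,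
      by rw [← hjγ, h1, map_zero], j m, ⟨m, rfl⟩, by rw [← hjγ, hm, hjd]⟩)
    rintro _ ⟨β, rfl⟩ hd
    rw [← hjd, ← hπ', hsmall]
    exact hβ β (hj' (by rw [hjd, hjγ, hd, map_zero]))
  · intro k x
    rw [Submodule.mem_comap, mem_formsOfDegree_iff, ← hπ]
    exact hi'.eq_iff
  · exact fun k x => hmem k x

end PForm

theorem mainTheorem1 {ι : Type*} (n : ℕ) (p : ι → ℕ) (hp : ∀ a, 1 ≤ p a) :
    -- Lorentz invariant local forms and the small algebra
    ((∀ a, (PForm.lorentz n p).IsWZ a →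
        ∃ s, (PForm.small n p).IsWZ s ∧ ∃ t, (PForm.lorentz n p).DescendsTrivially t ∧
          (PForm.lorentz n p).IsTrivial (a - (PForm.smallIncl n p s + t))) ∧
      ∀ r, 1 ≤ r →
        (∀ x, PForm.Bidiff.mapE (PForm.smallIncl_isHom n p) r ((PForm.small n p).dE r x) =
          (PForm.lorentz n p).dE r (PForm.Bidiff.mapE (PForm.smallIncl_isHom n p) r x)) ∧
        Function.Injective (PForm.Bidiff.mapE (PForm.smallIncl_isHom n p) r) ∧
        ∀ k < n, Set.BijOn (PForm.Bidiff.mapE (PForm.smallIncl_isHom n p) r)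
          ((PForm.small n p).classesIn ((PForm.formsOfDegree n p k).submoduleOf _) r)
          ((PForm.lorentz n p).classesIn ((PForm.formsOfDegree n p k).submoduleOf _) r)) ∧
    -- all local forms and the small algebra with constant forms as coefficients
    ((∀ a, (PForm.localForms n p).IsWZ a →
        ∃ s, (PForm.smallConst n p).IsWZ s ∧ ∃ t, (PForm.localForms n p).DescendsTrivially t ∧
          (PForm.localForms n p).IsTrivial (a - (PForm.smallConstIncl n p s + t))) ∧
      ∀ r, 1 ≤ r →
        (∀ x, PForm.Bidiff.mapE (PForm.smallConstIncl_isHom n p) r ((PForm.smallConst n p).dE r x) =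
          (PForm.localForms n p).dE r
            (PForm.Bidiff.mapE (PForm.smallConstIncl_isHom n p) r x)) ∧
        Function.Injective (PForm.Bidiff.mapE (PForm.smallConstIncl_isHom n p) r) ∧
        ∀ k < n, Set.BijOn (PForm.Bidiff.mapE (PForm.smallConstIncl_isHom n p) r)
          ((PForm.smallConst n p).classesIn ((PForm.formsOfDegree n p k).submoduleOf _) r)
          ((PForm.localForms n p).classesIn (PForm.formsOfDegree n p k) r)) := by
  refine ⟨?_, ?_⟩
  · exact PForm.isSmallPair_lorentz.comparison hp (PForm.smallIncl_isHom n p)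
      (i := Submodule.subtype _) (j := Submodule.subtype _) ⟨fun _ => rfl, fun _ => rfl⟩
      ⟨fun _ => rfl, fun _ => rfl⟩ (fun _ => rfl) Subtype.val_injective Subtype.val_injective
      (Submodule.range_subtype _) (Submodule.range_subtype _)
      (PForm.localForms_grading.restrict _ _ _ PForm.formProj_smallAlg)
      (PForm.localForms_grading.restrict _ _ _ PForm.formProj_lorentzForm)
      (fun _ _ => rfl) (fun _ _ => rfl)
  · exact PForm.isSmallPair_const.comparison hp (PForm.smallConstIncl_isHom n p)
      (i := Submodule.subtype _) (j := LinearMap.id) ⟨fun _ => rfl, fun _ => rfl⟩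
      ⟨fun _ => rfl, fun _ => rfl⟩ (fun _ => rfl) Subtype.val_injective Function.injective_id
      (Submodule.range_subtype _) LinearMap.range_id
      (PForm.localForms_grading.restrict _ _ _ PForm.formProj_smallAlgConst)
      PForm.localForms_grading (fun _ _ => rfl) (fun _ _ => rfl)
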